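/- Let $n,q\ge 0$ be integers, $\lambda_1,\dots,\lambda_n\in\mathbb R$ and $\varphi_0(z)=\sum_{j=1}^n\lambda_j|z_j|^2$ on $\mathbb C^n$. Equip $\mathbb C^n$ with the Hermitian metric for which $\partial/\partial z_1,\dots,\partial/\partial z_n$ is an orthonormal frame of $T^{1,0}\mathbb C^n$, and with the volume form $dv=i^n\,dz_1\wedge d\bar z_1\wedge\cdots\wedge dz_n\wedge d\bar z_n$ (that is, $2^n$ times Lebesgue measure). Let $L^2_{(0,q)}(\mathbb C^n,\varphi_0)$ be the Hilbert space of $(0,q)$-forms with inner product $(u,v)_{\varphi_0}=\int\langle u,v\rangle e^{-\varphi_0}\,dv$, let $\bar\partial$ be the maximal (distributional) extension of the Cauchy–Riemann operator on these spaces, $\bar\partial^{*,\varphi_0}$ its Hilbert space adjoint, and let $$\Box^q_{\varphi_0}=\bar\partial^{*,\varphi_0}\bar\partial+\bar\partial\,\bar\partial^{*,\varphi_0}$$ be the Gaffney extension of the Kodaira Laplacian, whose domain consists of all $u\in\mathrm{Dom}\,\bar\partial\cap\mathrm{Dom}\,\bar\partial^{*,\varphi_0}$ with $\bar\partial u\in\mathrm{Dom}\,\bar\partial^{*,\varphi_0}$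 and $\bar\partial^{*,\varphi_0}u\in\mathrm{Dom}\,\bar\partial$. Let $e^{-t\Box^q_{\varphi_0}}$, $t\ge0$, be its heat semigroup (the strongly continuous semigroup with generator $-\Box^q_{\varphi_0}$), and let $e^{-t\Box^q_{\varphi_0}}(z,w)\in\mathrm{Hom}(T^{*0,q}_w\mathbb C^n,T^{*0,q}_z\mathbb C^n)$ be its heat kernel with respect to $(\cdot,\cdot)_{\varphi_0}$: the smooth function on $(0,\infty)\times\mathbb C^n\times\mathbb C^n$ with $$\big(e^{-t\Box^q_{\varphi_0}}u\big)(z)=\int_{\mathbb C^n} e^{-t\Box^q_{\varphi_0}}(z,w)\,u(w)\,e^{-\varphi_0(w)}\,dv(w)$$ for all smooth compactly supported $(0,q)$-forms $u$. Let $\dot R_0$ be the endomorphism of $T^{1,0}\mathbb C^n$ with $\langle\dot R_0U,V\rangle=\partial\bar\partial\varphi_0(U,\overline V)$, let $(d\bar z_j)^*\lrcorner$ be contraction with $\partial/\partial\bar z_j$, and put $\Theta_0=\sum_{j=1}^n\lambda_j\,d\bar z_j\wedge(d\bar z_j)^*\lrcorner$. **Theorem.** The heat kernel exists, and for every $t>0$,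 as endomorphisms of $T^{*0,q}_0\mathbb C^n$, $$e^{-t\Box^q_{\varphi_0}}(0,0)=\frac{1}{(2\pi)^n}\,\frac{\det\dot R_0}{\det\big(1-e^{-t\dot R_0}\big)}\,e^{-t\Theta_0}=\prod_{j=1}^n\frac{\lambda_j\big(1+(e^{-t\lambda_j}-1)\,d\bar z_j\wedge(d\bar z_j)^*\lrcorner\big)}{2\pi\,(1-e^{-t\lambda_j})}.$$ Here, if some eigenvalue of $\dot R_0$ vanishes, it contributes the factor $1/t$ to $\det\dot R_0/\det(1-e^{-t\dot R_0})$; likewise $\lambda_j/(1-e^{-t\lambda_j})$ is read as $1/t$ if $\lambda_j=0$. -/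

import Mathlib

open MeasureTheory Filter Topology
open scoped ContDiff

noncomputable section

namespace ModelHeat

/-! ### Covectors of type `(0,q)` on `ℂⁿ` -/

/-- The fibre `Λ^q (T^{*0,1} ℂⁿ)`, in coordinates with respect to the orthonormal basis
`dz̄^J = dz̄_{j₁} ∧ ⋯ ∧ dz̄_{j_q}`, where `J = {j₁ < ⋯ < j_q}`. -/
abbrev Cov (n q : ℕ) : Type := EuclideanSpace ℂ {J : Finset (Fin n) // J.card = q}

/-- The coefficient of `dz̄^J` in a `(0,q)`-covector; it is `0` if `J` does not have `q` elements. -/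
def coeff {n q : ℕ} (a : Cov n q) (J : Finset (Fin n)) : ℂ :=
  if h : J.card = q then a ⟨J, h⟩ else 0

/-- `(-1)` to the number of elements of `J` that are smaller than `j`. -/
def sgn {n : ℕ} (j : Fin n) (J : Finset (Fin n)) : ℂ :=
  (-1) ^ (J.filter (fun i => i < j)).card

theorem coeff_add {n q : ℕ} (a b : Cov n q) (J : Finset (Fin n)) :
    coeff (a + b) J = coeff a J + coeff b J := by
  unfold coeff; split_ifs <;> simp

theorem coeff_smul {n q : ℕ} (c : ℂ) (a : Cov n q) (J : Finset (Fin n)) :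
    coeff (c • a) J = c * coeff a J := by
  unfold coeff; split_ifs <;> simp

/-- Exterior multiplication `dz̄_j ∧ · : Λ^{0,p} → Λ^{0,p'}`, determined by
`dz̄_j ∧ dz̄^J = (-1)^{#{i ∈ J, i < j}} dz̄^{J ∪ {j}}` for `j ∉ J` and `dz̄_j ∧ dz̄^J = 0` for `j ∈ J`.
It is meant for `p' = p + 1`, and it is the zero map for all other pairs of degrees
(in particular from degree `0 - 1 = 0` to degree `0`). -/
def wedge {n : ℕ} (j : Fin n) (p p' : ℕ) : Cov n p →L[ℂ] Cov n p' :=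
  LinearMap.toContinuousLinearMap
    { toFun := fun a => WithLp.toLp 2 fun K =>
        if j ∈ K.1 then sgn j (K.1.erase j) * coeff a (K.1.erase j) else 0
      map_add' := by
        intro a b; ext K; simp only [coeff_add, PiLp.add_apply]; split_ifs <;> ring
      map_smul' := by
        intro c a; ext K
        simp only [coeff_smul, PiLp.smul_apply, smul_eq_mul, RingHom.id_apply]
        split_ifs <;> ring }

/-- Contraction `(dz̄_j)^* ⌟ · : Λ^{0,p} → Λ^{0,p'}` with the vector `∂/∂z̄_j`, determined by
`(dz̄_j)^* ⌟ dz̄^J = (-1)^{#{i ∈ J, i < j}} dz̄^{J ∖ {j}}` for `j ∈ J` and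
`(dz̄_j)^* ⌟ dz̄^J = 0` for `j ∉ J`. It is meant for `p = p' + 1`, and it is the zero map for all
other pairs of degrees. -/
def contract {n : ℕ} (j : Fin n) (p p' : ℕ) : Cov n p →L[ℂ] Cov n p' :=
  LinearMap.toContinuousLinearMap
    { toFun := fun a => WithLp.toLp 2 fun K =>
        if j ∈ K.1 then 0 else sgn j K.1 * coeff a (insert j K.1)
      map_add' := by
        intro a b; ext K; simp only [coeff_add, PiLp.add_apply]; split_ifs <;> ring
      map_smul' := by
        intro c a; ext K
        simp only [coeff_smul, PiLp.smul_apply, smul_eq_mul, RingHom.id_apply]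
        split_ifs <;> ring }

/-- `dz̄_j ∧ (dz̄_j)^* ⌟` as an endomorphism of the `(0,q)`-covectors. -/
def wedgeContract {n : ℕ} (j : Fin n) (q : ℕ) : Cov n q →L[ℂ] Cov n q :=
  (wedge j (q - 1) q).comp (contract j q (q - 1))

/-- `Θ₀ = ∑_j λ_j dz̄_j ∧ (dz̄_j)^* ⌟` on `(0,q)`-covectors. -/
def Theta {n : ℕ} (lam : Fin n → ℝ) (q : ℕ) : Cov n q →L[ℂ] Cov n q :=
  ∑ j, (lam j : ℂ) • wedgeContract j q

/-! ### Wirtinger derivatives, the weight and its curvature -/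

/-- `∂f/∂z_j`. -/
def dz {n : ℕ} (j : Fin n) (f : (Fin n → ℂ) → ℂ) (z : Fin n → ℂ) : ℂ :=
  (1 / 2) * (fderiv ℝ f z (Pi.single j 1) - Complex.I * fderiv ℝ f z (Pi.single j Complex.I))

/-- `∂f/∂z̄_j`. -/
def dzbar {n : ℕ} (j : Fin n) (f : (Fin n → ℂ) → ℂ) (z : Fin n → ℂ) : ℂ :=
  (1 / 2) * (fderiv ℝ f z (Pi.single j 1) + Complex.I * fderiv ℝ f z (Pi.single j Complex.I))

/-- The weight `φ₀(z) = ∑_j λ_j |z_j|²`. -/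
def phi {n : ℕ} (lam : Fin n → ℝ) (z : Fin n → ℂ) : ℝ :=
  ∑ j, lam j * ‖z j‖ ^ 2

/-- The matrix, in the orthonormal basis `∂/∂z_1, …, ∂/∂z_n` of `T^{1,0} ℂⁿ`, of the linear map
`Ṙ₀` with `⟨Ṙ₀ U, V⟩ = ∂∂̄φ₀(U, V̄)`: its `(k,j)` entry is
`⟨Ṙ₀ ∂/∂z_j, ∂/∂z_k⟩ = ∂²φ₀/∂z_j∂z̄_k`. The weight is quadratic, so that it does not matter at which
point the second derivatives are taken. -/
def curv {n : ℕ} (lam : Fin n → ℝ) : Matrix (Fin n) (Fin n) ℂ :=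
  Matrix.of fun k j => dz j (dzbar k (fun z => (phi lam z : ℂ))) 0

/-- `x / (1 - e^{-tx})`, with the value `1 / t` at `x = 0`. -/
def todd (t : ℝ) (x : ℂ) : ℂ :=
  if x = 0 then 1 / (t : ℂ) else x / (1 - Complex.exp (-(t * x)))

/-- The quotient `det R / det (1 - e^{-tR})` with the convention that an eigenvalue `0` of `R`
contributes the factor `1 / t`: the product of `x / (1 - e^{-tx})` over the eigenvalues `x` of `R`,
counted with multiplicity. -/
def detQuot {n : ℕ} (R : Matrix (Fin n) (Fin n) ℂ) (t : ℝ) : ℂ :=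
  (R.charpoly.roots.map (todd t)).prod

/-! ### The weighted `L²` spaces and the Gaffney extension of the Kodaira Laplacian -/

/-- The measure `e^{-φ₀} dv`, where `dv = iⁿ dz_1 ∧ dz̄_1 ∧ ⋯ ∧ dz_n ∧ dz̄_n` is `2ⁿ` times
Lebesgue measure. -/
def mu {n : ℕ} (lam : Fin n → ℝ) : Measure (Fin n → ℂ) :=
  volume.withDensity fun z => ENNReal.ofReal (2 ^ n * Real.exp (-phi lam z))

/-- The Hilbert space `L²_{(0,q)}(ℂⁿ, φ₀)`, with inner product `∫ ⟨u, v⟩ e^{-φ₀} dv`. -/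
abbrev L2 {n : ℕ} (lam : Fin n → ℝ) (q : ℕ) : Type := Lp (Cov n q) 2 (mu lam)

/-- The graph of the maximal extension of `∂̄ = ∑_j dz̄_j ∧ ∂/∂z̄_j` from `(0,p)`-forms to
`(0,p')`-forms, where `p' = p + 1` (for all other pairs of degrees it is the graph of the zero
operator): `IsDbar u v` says that `u` and `v` are square integrable and that `∂̄u = v` in the sense
of distributions. -/
def IsDbar {n : ℕ} {lam : Fin n → ℝ} {p p' : ℕ} (u : L2 lam p) (v : L2 lam p') : Prop :=
  ∀ χ : (Fin n → ℂ) → ℂ, ContDiff ℝ ∞ χ → HasCompactSupport χ →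
    ∫ z, χ z • v z = -∫ z, ∑ j, dzbar j χ z • wedge j p p' (u z)

/-- The graph of the Hilbert space adjoint `∂̄^{*,φ₀}` of the maximal extension of `∂̄`:
`IsDbarStar v w` says that `v` lies in the domain of the adjoint and is mapped to `w`. -/
def IsDbarStar {n : ℕ} {lam : Fin n → ℝ} {p p' : ℕ} (v : L2 lam p') (w : L2 lam p) : Prop :=
  ∀ (u : L2 lam p) (u' : L2 lam p'), IsDbar u u' → inner ℂ u' v = inner ℂ u w

/-- The graph of the Gaffney extension of the Kodaira Laplacian
`□^q_{φ₀} = ∂̄^{*,φ₀} ∂̄ + ∂̄ ∂̄^{*,φ₀}` on `(0,q)`-forms: `IsBox u f` says that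
`u ∈ Dom ∂̄ ∩ Dom ∂̄^{*,φ₀}`, `∂̄u ∈ Dom ∂̄^{*,φ₀}`, `∂̄^{*,φ₀}u ∈ Dom ∂̄` and `□^q_{φ₀} u = f`.
For `q = 0` the second term vanishes, since `∂̄` from degree `q - 1 = 0` to degree `0` is zero. -/
def IsBox {n : ℕ} {lam : Fin n → ℝ} {q : ℕ} (u f : L2 lam q) : Prop :=
  ∃ (v : L2 lam (q + 1)) (w : L2 lam (q - 1)) (a b : L2 lam q),
    IsDbar u v ∧ IsDbarStar v a ∧ IsDbarStar u w ∧ IsDbar w b ∧ f = a + b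

/-! ### The heat operator and the heat kernel -/

/-- `T` is the heat semigroup `t ↦ e^{-tA}`, `t ≥ 0`, of the operator with graph `A`: the strongly
continuous semigroup of bounded operators whose infinitesimal generator is `-A` (with equality of
the domains). The values of `T` at negative times are irrelevant. -/
structure IsHeatSemigroup {H : Type*} [NormedAddCommGroup H] [NormedSpace ℂ H]
    (A : H → H → Prop) (T : ℝ → H →L[ℂ] H) : Prop where
  zero : T 0 = ContinuousLinearMap.id ℂ H
  add : ∀ s t : ℝ, 0 ≤ s → 0 ≤ t → T (s + t) = (T s).comp (T t)
  cont : ∀ u : H, ContinuousOn (fun t => T t u) (Set.Ici 0)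
  generator : ∀ u f : H,
    A u f ↔ Tendsto (fun t : ℝ => (t⁻¹ : ℝ) • (T t u - u)) (𝓝[>] 0) (𝓝 (-f))

/-- `K(t,z,w) ∈ Hom(Λ^{0,q}_w, Λ^{0,q}_z)`, `t > 0`, is the heat kernel `e^{-t□^q_{φ₀}}(z,w)`: it is
smooth on `(0,∞) × ℂⁿ × ℂⁿ`, and
`(e^{-t□^q_{φ₀}} u)(z) = ∫ K(t,z,w) u(w) e^{-φ₀(w)} dv(w)` for every smooth compactly supported
`(0,q)`-form `u`. -/
def IsHeatKernel {n : ℕ} (lam : Fin n → ℝ) (q : ℕ)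
    (K : ℝ → (Fin n → ℂ) → (Fin n → ℂ) → (Cov n q →L[ℂ] Cov n q)) : Prop :=
  ContDiffOn ℝ ∞ (fun x : ℝ × (Fin n → ℂ) × (Fin n → ℂ) => K x.1 x.2.1 x.2.2)
    (Set.Ioi 0 ×ˢ Set.univ) ∧
  ∃ T : ℝ → L2 lam q →L[ℂ] L2 lam q, IsHeatSemigroup IsBox T ∧
    ∀ t : ℝ, 0 < t → ∀ u : (Fin n → ℂ) → Cov n q, ContDiff ℝ ∞ u → HasCompactSupport u →
      ∀ hu : MemLp u 2 (mu lam),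
        T t (hu.toLp u) =ᵐ[mu lam] fun z => ∫ w, K t z w (u w) ∂(mu lam)

end ModelHeat

end

open ModelHeat

/-!
On a Gaussian `g(z) = exp ∑_j (-a_j |z_j|² + b_j z_j + c_j z̄_j)` times a constant covector `dz̄^K`
the Kodaira Laplacian and its heat flow are explicit. By the canonical anticommutation relations,
`□(g dz̄^K) = (∑_j δ_j ∂̄_j g + λ_K g) dz̄^K`, where `δ_j = -∂/∂z_j + λ_j z̄_j` is the formal adjoint
of `∂̄_j = ∂/∂z̄_j` and `λ_K = ∑_{j ∈ K} λ_j` is the eigenvalue of `Θ₀` on `dz̄^K` (`isBox_gauss`).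
So the heat operator should be `e^{-tλ_K}` on `dz̄^K`, times the heat operator of `∑_j δ_j ∂̄_j` on
functions, and the latter is the integral operator with Mehler's kernel
`∏_j s_j / (2π) · exp(λ_j z_j w̄_j - (s_j - λ_j) |z_j - w_j|²)`, where `s_j = λ_j / (1 - e^{-tλ_j})`,
read as `1 / t` for `λ_j = 0` (`mehler`). At `z = w = 0` this gives the asserted formulas.

The proof defines the operators `heatOp` in this way and shows that they are the heat semigroup of
the Gaffney extension.

* Schur's test with the weight `e^{φ₀/2}` bounds the operator with Mehler's kernel by
  `∏_j 2 / (1 + e^{-tλ_j})` (`norm_mehlerOp_le`), which compensates for the growth of `e^{-tλ_K}` for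
  negative eigenvalues; so the operators `heatOp` are uniformly bounded (`norm_heatOp_le`).
* They map square integrable Gaussians to square integrable Gaussians (`mehlerOp_gauss`). On these
  the semigroup property is a computation with the parameters, and the derivative at `t = 0` is
  `-□` (`isGen_heatOp_gauss`). Forms orthogonal to all Gaussians vanish, by the injectivity of the
  Fourier transform (`eq_zero_of_inner_gauss`).
* The Gaffney extension is a closed, nonnegative operator (`isAccretiveGraph_isBox`). If a bounded
  semigroup has a generator that agrees with `-A`, for `A` closed and accretive, on an invariant
  total set, then it is the heat semigroup of `A` (`isHeatSemigroup_of_core`). This replaces a proof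
  that the Gaffney extension is selfadjoint.

Finally, the heat semigroup is unique (`IsHeatSemigroup.unique`), and a continuous kernel is
determined by its integrals against test forms, so every heat kernel is the explicit one
(`IsHeatKernel.unique`).
-/

open MeasureTheory Filter Topology
open scoped ContDiff

namespace ModelHeat

/-! ### Closed accretive graphs and heat semigroups -/

section Semigroup

variable {H : Type*} [NormedAddCommGroup H] [InnerProductSpace ℂ H]

/-- The graph of a closed accretive linear operator. -/
structure IsAccretiveGraph (A : H → H → Prop) : Prop where
  zero : A 0 0
  add : ∀ {u f v g : H}, A u f → A v g → A (u + v) (f + g)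
  smul : ∀ (c : ℂ) {u f : H}, A u f → A (c • u) (c • f)
  closed : IsClosed {p : H × H | A p.1 p.2}
  accretive : ∀ {u f : H}, A u f → 0 ≤ (inner ℂ u f).re

/-- `IsGen T u f` says that `u` lies in the domain of the infinitesimal generator of `T`, and that
the generator maps `u` to `-f`. -/
def IsGen (T : ℝ → H →L[ℂ] H) (u f : H) : Prop :=
  Tendsto (fun t : ℝ => (t⁻¹ : ℝ) • (T t u - u)) (𝓝[>] 0) (𝓝 (-f))

theorem IsAccretiveGraph.norm_le {A : H → H → Prop} (hA : IsAccretiveGraph A) {u f : H}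
    (h : A u f) : ‖u‖ ≤ ‖u + f‖ := by
  have h1 : ‖u‖ * ‖u‖ ≤ ‖u‖ * ‖u + f‖ := by
    calc ‖u‖ * ‖u‖ = (inner ℂ u u).re := by
          rw [inner_self_eq_norm_sq_to_K, ← sq]; norm_cast
      _ ≤ (inner ℂ u (u + f)).re := by
          rw [inner_add_right, Complex.add_re]; linarith [hA.accretive h]
      _ ≤ ‖inner ℂ u (u + f)‖ := Complex.re_le_norm _
      _ ≤ _ := norm_inner_le_norm _ _
  rcases (norm_nonneg u).eq_or_lt with h0 | h0
  · rw [← h0]; positivity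
  · exact le_of_mul_le_mul_left h1 h0

theorem IsAccretiveGraph.sub {A : H → H → Prop} (hA : IsAccretiveGraph A) {u f v g : H}
    (h : A u f) (h' : A v g) : A (u - v) (f - g) := by
  simpa [sub_eq_add_neg] using hA.add h (hA.smul (-1) h')

theorem IsGen.add {T : ℝ → H →L[ℂ] H} {u f v g : H} (h : IsGen T u f) (h' : IsGen T v g) :
    IsGen T (u + v) (f + g) := by
  unfold IsGen at *
  rw [neg_add]
  refine (Tendsto.add h h').congr fun t => ?_
  rw [map_add, ← smul_add]; congr 1; abel

theorem IsGen.smul {T : ℝ → H →L[ℂ] H} {u f : H} (c : ℂ) (h : IsGen T u f) :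
    IsGen T (c • u) (c • f) := by
  unfold IsGen at *
  rw [← smul_neg]
  refine (Tendsto.const_smul h c).congr fun t => ?_
  rw [map_smul, ← smul_sub, smul_comm]

theorem IsGen.zero {T : ℝ → H →L[ℂ] H} : IsGen T 0 0 := by
  unfold IsGen; simp

theorem IsGen.sub {T : ℝ → H →L[ℂ] H} {u f v g : H} (h : IsGen T u f) (h' : IsGen T v g) :
    IsGen T (u - v) (f - g) := by
  simpa [sub_eq_add_neg] using h.add (h'.smul (-1))

theorem tendsto_sub_nhdsGT (t : ℝ) : Tendsto (fun r => r - t) (𝓝[>] t) (𝓝[>] 0) := by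
  refine tendsto_nhdsWithin_iff.2 ⟨?_, ?_⟩
  · have : Tendsto (fun r => r - t) (𝓝 t) (𝓝 (t - t)) := (continuous_sub_right t).tendsto t
    rw [sub_self] at this
    exact this.mono_left nhdsWithin_le_nhds
  · filter_upwards [self_mem_nhdsWithin] with r hr
    exact sub_pos.2 (Set.mem_Ioi.1 hr)

/-- The orbit of a vector in the domain of the generator is differentiable from the right. -/
theorem IsGen.hasDerivWithinAt {T : ℝ → H →L[ℂ] H}
    (hadd : ∀ s t : ℝ, 0 ≤ s → 0 ≤ t → T (s + t) = (T s).comp (T t)) {u f : H} (h : IsGen T u f)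
    {t : ℝ} (ht : 0 ≤ t) : HasDerivWithinAt (fun r => T r u) (-(T t f)) (Set.Ici t) t := by
  rw [← hasDerivWithinAt_Ioi_iff_Ici, hasDerivWithinAt_iff_tendsto_slope' (by simp)]
  rw [← map_neg]
  refine (((T t).continuous.tendsto _).comp (h.comp (tendsto_sub_nhdsGT t))).congr' ?_
  filter_upwards [self_mem_nhdsWithin] with r hr
  have hr' : t < r := hr
  have h1 : T r = (T t).comp (T (r - t)) := by
    rw [← hadd _ _ ht (sub_nonneg.2 hr'.le)]; congr 1; ring
  simp only [Function.comp, slope_def_module, h1, ContinuousLinearMap.comp_apply,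
    (T t).map_smul_of_tower, map_sub]

/-- The domain of the generator is invariant under the semigroup. -/
theorem IsGen.apply {T : ℝ → H →L[ℂ] H}
    (hadd : ∀ s t : ℝ, 0 ≤ s → 0 ≤ t → T (s + t) = (T s).comp (T t)) {u f : H} (h : IsGen T u f)
    {t : ℝ} (ht : 0 ≤ t) : IsGen T (T t u) (T t f) := by
  unfold IsGen
  rw [← map_neg]
  refine (((T t).continuous.tendsto _).comp h).congr' ?_
  filter_upwards [self_mem_nhdsWithin] with r hr
  have hr' : (0 : ℝ) < r := hr
  have h1 : T r (T t u) = T t (T r u) := by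
    rw [← ContinuousLinearMap.comp_apply, ← ContinuousLinearMap.comp_apply, ← hadd _ _ ht hr'.le,
      ← hadd _ _ hr'.le ht, add_comm]
  simp only [Function.comp, (T t).map_smul_of_tower, map_sub, h1]

theorem IsGen.tendsto {T : ℝ → H →L[ℂ] H} {u f : H} (h : IsGen T u f) :
    Tendsto (fun t => T t u) (𝓝[>] 0) (𝓝 u) := by
  have h1 : Tendsto (fun t : ℝ => t • ((t⁻¹ : ℝ) • (T t u - u))) (𝓝[>] 0) (𝓝 ((0 : ℝ) • (-f))) :=
    (tendsto_id.mono_left nhdsWithin_le_nhds).smul h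
  rw [zero_smul] at h1
  have h2 := h1.add_const u
  rw [zero_add] at h2
  refine h2.congr' ?_
  filter_upwards [self_mem_nhdsWithin] with t ht
  rw [smul_inv_smul₀ (ne_of_gt ht)]; abel

/-- A closed subspace with trivial orthogonal complement is the whole space. -/
theorem eq_top_of_isClosed_of_orthogonal [CompleteSpace H] {V : Submodule ℂ H}
    (hV : IsClosed (V : Set H)) (h : ∀ x : H, (∀ u ∈ V, inner ℂ x u = 0) → x = 0) : V = ⊤ := by
  have : CompleteSpace V := hV.completeSpace_coe
  rw [← Submodule.orthogonal_eq_bot_iff, eq_bot_iff]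
  intro x hx
  rw [Submodule.mem_bot]
  exact h x ((Submodule.mem_orthogonal' V x).1 hx)

/-- A bounded semigroup that converges strongly to the identity on a total set is strongly
continuous. -/
theorem continuousOn_of_total [CompleteSpace H] {T : ℝ → H →L[ℂ] H}
    (h0 : T 0 = ContinuousLinearMap.id ℂ H)
    (hadd : ∀ s t : ℝ, 0 ≤ s → 0 ≤ t → T (s + t) = (T s).comp (T t))
    {M : ℝ} (hM : ∀ t, 0 ≤ t → ‖T t‖ ≤ M) {S : Set H}
    (hS : ∀ u ∈ S, Tendsto (fun t => T t u) (𝓝[>] 0) (𝓝 u))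
    (hdense : ∀ h : H, (∀ u ∈ S, inner ℂ h u = 0) → h = 0) (u : H) :
    ContinuousOn (fun t => T t u) (Set.Ici 0) := by
  have hM0 : 0 ≤ M := (norm_nonneg _).trans (hM 0 le_rfl)
  have hbd : ∀ t, 0 ≤ t → ∀ v, ‖T t v‖ ≤ M * ‖v‖ := fun t ht v =>
    (T t).le_of_opNorm_le (hM t ht) v
  let V : Submodule ℂ H :=
    { carrier := {u | Tendsto (fun t => T t u) (𝓝[>] 0) (𝓝 u)}
      zero_mem' := by simp
      add_mem' := fun {a b} ha hb => by simpa using Tendsto.add ha hb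
      smul_mem' := fun c a ha => by simpa using Tendsto.const_smul ha c }
  have hV : IsClosed (V : Set H) := by
    refine isClosed_of_closure_subset fun w hw => ?_
    change Tendsto (fun t => T t w) (𝓝[>] 0) (𝓝 w)
    rw [Metric.tendsto_nhds]
    intro ε hε
    obtain ⟨v, hv, hwv⟩ := Metric.mem_closure_iff.1 hw (ε / (2 * (M + 1))) (by positivity)
    have hv' : Tendsto (fun t => T t v) (𝓝[>] 0) (𝓝 v) := hv
    filter_upwards [Metric.tendsto_nhds.1 hv' (ε / 2) (by positivity), self_mem_nhdsWithin]
      with t ht ht0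
    have ht0' : (0 : ℝ) < t := ht0
    rw [dist_eq_norm] at *
    have e1 : T t w - w = T t (w - v) + (T t v - v) - (w - v) := by rw [map_sub]; abel
    have e2 : ‖T t (w - v)‖ ≤ M * ‖w - v‖ := hbd t ht0'.le _
    have e3 : (M + 1) * ‖w - v‖ < ε / 2 := by
      rw [lt_div_iff₀ (by positivity)] at hwv
      nlinarith
    rw [e1]
    refine (norm_sub_le _ _).trans_lt ?_
    have := norm_add_le (T t (w - v)) (T t v - v)
    linarith
  have hVtop : V = ⊤ := eq_top_of_isClosed_of_orthogonal hV fun h hh =>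
    hdense h fun u hu => hh u (hS u hu)
  have hu : Tendsto (fun t => T t u) (𝓝[>] 0) (𝓝 u) := by
    have : u ∈ V := hVtop ▸ Submodule.mem_top
    exact this
  have hu' : Tendsto (fun t => M * ‖T t u - u‖) (𝓝[≥] 0) (𝓝 0) := by
    have h2 : Tendsto (fun t => M * ‖T t u - u‖) (𝓝[>] 0) (𝓝 0) := by
      simpa using ((hu.sub_const u).norm).const_mul M
    have h3 : ContinuousWithinAt (fun t => M * ‖T t u - u‖) (Set.Ioi 0) 0 := by
      unfold ContinuousWithinAt; simpa [h0] using h2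
    have h4 := continuousWithinAt_Ioi_iff_Ici.1 h3
    unfold ContinuousWithinAt at h4; simpa [h0] using h4
  intro t ht
  have ht : 0 ≤ t := ht
  unfold ContinuousWithinAt
  rw [tendsto_iff_norm_sub_tendsto_zero]
  have habs : Tendsto (fun r => |r - t|) (𝓝[Set.Ici 0] t) (𝓝[≥] 0) := by
    refine tendsto_nhdsWithin_iff.2 ⟨?_, Eventually.of_forall fun r => Set.mem_Ici.2 (abs_nonneg _)⟩
    have : Continuous fun r : ℝ => |r - t| := by fun_prop
    simpa using (this.tendsto t).mono_left nhdsWithin_le_nhds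
  refine squeeze_zero' (Eventually.of_forall fun _ => norm_nonneg _) ?_ (hu'.comp habs)
  filter_upwards [self_mem_nhdsWithin] with r hr
  have hr : 0 ≤ r := hr
  simp only [Function.comp]
  rcases le_total t r with h | h
  · have : T r u - T t u = T t (T |r - t| u - u) := by
      rw [map_sub, ← ContinuousLinearMap.comp_apply, ← hadd _ _ ht (abs_nonneg _),
        abs_of_nonneg (sub_nonneg.2 h)]; congr 3; ring
    rw [this]; exact hbd t ht _
  · have : T r u - T t u = -(T r (T |r - t| u - u)) := by
      rw [map_sub, ← ContinuousLinearMap.comp_apply, ← hadd _ _ hr (abs_nonneg _),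
        abs_of_nonpos (sub_nonpos.2 h), neg_sub]; congr 3; ring_nf
    rw [this, norm_neg]; exact hbd r hr _

/-- The generator of a bounded strongly continuous semigroup is closed. -/
theorem isClosed_isGen [CompleteSpace H] {T : ℝ → H →L[ℂ] H}
    (h0 : T 0 = ContinuousLinearMap.id ℂ H)
    (hadd : ∀ s t : ℝ, 0 ≤ s → 0 ≤ t → T (s + t) = (T s).comp (T t))
    {M : ℝ} (hM : ∀ t, 0 ≤ t → ‖T t‖ ≤ M)
    (hcont : ∀ u : H, ContinuousOn (fun t => T t u) (Set.Ici 0)) :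
    IsClosed {p : H × H | IsGen T p.1 p.2} := by
  have hbd : ∀ t, 0 ≤ t → ∀ v, ‖T t v‖ ≤ M * ‖v‖ := fun t ht v =>
    (T t).le_of_opNorm_le (hM t ht) v
  have hint : ∀ (f : H) {t : ℝ}, 0 ≤ t → IntervalIntegrable (fun s => T s f) volume 0 t :=
    fun f t ht => ((hcont f).mono (by rw [Set.uIcc_of_le ht]; exact Set.Icc_subset_Ici_self))
      |>.intervalIntegrable
  -- membership in the graph is equivalent to an integral equation
  have key : {p : H × H | IsGen T p.1 p.2} =
      ⋂ t : Set.Ici (0 : ℝ), {p : H × H | T t p.1 - p.1 = ∫ s in (0 : ℝ)..t, -(T s p.2)} := by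
    ext ⟨u, f⟩
    simp only [Set.mem_iInter, Set.mem_ofPred_eq, Subtype.forall, Set.mem_Ici]
    constructor
    · intro h t ht
      have := intervalIntegral.integral_eq_sub_of_hasDeriv_right (f := fun t => T t u)
        (f' := fun t => -(T t f)) (a := 0) (b := t)
        ((hcont u).mono (by rw [Set.uIcc_of_le ht]; exact Set.Icc_subset_Ici_self))
        (fun x hx => (h.hasDerivWithinAt hadd (by
          rw [min_eq_left ht] at hx; exact hx.1.le)).mono Set.Ioi_subset_Ici_self)
        (hint f ht).neg
      rw [this, h0]; rfl
    · intro h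
      have hc : ContinuousWithinAt (fun s => -(T s f)) (Set.Ioi 0) 0 :=
        ((hcont f).neg 0 (by simp)).mono Set.Ioi_subset_Ici_self
      have hmeas : StronglyMeasurableAtFilter (fun s => -(T s f)) (𝓝[Set.Ioi 0] 0) volume :=
        ⟨Set.Ioi 0, self_mem_nhdsWithin, (((hcont f).neg).mono
          Set.Ioi_subset_Ici_self).aestronglyMeasurable measurableSet_Ioi⟩
      have h1 := intervalIntegral.integral_hasDerivWithinAt_right
        (f := fun s => -(T s f)) (a := 0) (b := 0) (by simp) (s := Set.Ici 0) (t := Set.Ioi 0)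
        hmeas hc
      rw [← hasDerivWithinAt_Ioi_iff_Ici, hasDerivWithinAt_iff_tendsto_slope' (by simp)] at h1
      rw [h0] at h1
      unfold IsGen
      refine h1.congr' ?_
      filter_upwards [self_mem_nhdsWithin] with t ht
      have ht' : (0 : ℝ) < t := ht
      rw [h t ht'.le, slope_def_module]; simp
  rw [key]
  refine isClosed_iInter fun ⟨t, ht⟩ => isClosed_eq ?_ ?_
  · fun_prop
  · have ht : 0 ≤ t := ht
    have hM0 : 0 ≤ M := (norm_nonneg _).trans (hM 0 le_rfl)
    refine Continuous.comp (g := fun f => ∫ s in (0 : ℝ)..t, -(T s f)) ?_ continuous_snd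
    refine (LipschitzWith.of_dist_le_mul (K := Real.toNNReal (M * t)) fun f g => ?_).continuous
    have hsub := intervalIntegral.integral_sub (hint f ht).neg (hint g ht).neg
    simp only [Pi.neg_apply] at hsub
    rw [dist_eq_norm, dist_eq_norm, ← hsub, Real.coe_toNNReal _ (by positivity)]
    have := intervalIntegral.norm_integral_le_of_norm_le_const (a := 0) (b := t)
      (f := fun s => -(T s f) - -(T s g)) (C := M * ‖f - g‖) (fun s hs => by
        rw [Set.uIoc_of_le ht] at hs
        have : -(T s f) - -(T s g) = -(T s (f - g)) := by rw [map_sub]; abel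
        rw [this, norm_neg]; exact hbd s hs.1.le _)
    rw [sub_zero, abs_of_nonneg ht] at this
    linarith

/-- The solutions of `x' = x`, with derivatives from the right, are the multiples of `e^t`. -/
theorem eq_exp_mul_of_hasDerivWithinAt {F : Type*} [NormedAddCommGroup F] [NormedSpace ℝ F]
    {x : ℝ → F} (hc : ContinuousOn x (Set.Ici 0))
    (hx : ∀ t, 0 ≤ t → HasDerivWithinAt x (x t) (Set.Ici t) t) {t : ℝ} (ht : 0 ≤ t) :
    x t = Real.exp t • x 0 := by
  have h1 := constant_of_has_deriv_right_zero (f := fun t => Real.exp (-t) • x t) (a := 0) (b := t)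
    (ContinuousOn.smul (by fun_prop) (hc.mono Set.Icc_subset_Ici_self))
    (fun s hs => by
      have h2 : HasDerivWithinAt (fun t => Real.exp (-t)) (-Real.exp (-s)) (Set.Ici s) s := by
        simpa using ((hasDerivAt_neg s).exp).hasDerivWithinAt
      convert! h2.smul (hx s hs.1) using 1
      simp) t ⟨ht, le_rfl⟩
  simp only [neg_zero, Real.exp_zero, one_smul] at h1
  rw [← h1, smul_smul, ← Real.exp_add]; simp

/-- A bounded solution of `x' = x` starts at `0`, for it equals `e^t x 0`. -/
theorem eq_zero_of_hasDerivWithinAt_self {F : Type*} [NormedAddCommGroup F] [NormedSpace ℝ F]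
    {x : ℝ → F} {C : ℝ} (hc : ContinuousOn x (Set.Ici 0))
    (hd : ∀ t, 0 ≤ t → HasDerivWithinAt x (x t) (Set.Ici t) t) (hC : ∀ t, 0 ≤ t → ‖x t‖ ≤ C) :
    x 0 = 0 := by
  by_contra hne
  have hpos : 0 < ‖x 0‖ := norm_pos_iff.2 hne
  have hC0 : 0 ≤ C := (norm_nonneg _).trans (hC 0 le_rfl)
  have ht : 0 ≤ C / ‖x 0‖ := by positivity
  have h1 := hC _ ht
  rw [eq_exp_mul_of_hasDerivWithinAt hc hd ht, norm_smul, Real.norm_eq_abs,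
    abs_of_pos (Real.exp_pos _)] at h1
  have h2 := Real.add_one_le_exp (C / ‖x 0‖)
  have h3 : (C / ‖x 0‖ + 1) * ‖x 0‖ ≤ C := (mul_le_mul_of_nonneg_right h2 hpos.le).trans h1
  rw [add_mul, div_mul_cancel₀ _ hpos.ne'] at h3
  linarith

/-- A bounded semigroup is the heat semigroup of `A` as soon as `-A` agrees with its generator on
an invariant total set: on such a set `1 + A` has dense range, so `1 + A` and `1 - generator` are
two surjective extensions of the same operator, and both are injective. -/
theorem isHeatSemigroup_of_core [CompleteSpace H] {A : H → H → Prop} (hA : IsAccretiveGraph A)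
    {T : ℝ → H →L[ℂ] H} (h0 : T 0 = ContinuousLinearMap.id ℂ H)
    (hadd : ∀ s t : ℝ, 0 ≤ s → 0 ≤ t → T (s + t) = (T s).comp (T t))
    {M : ℝ} (hM : ∀ t, 0 ≤ t → ‖T t‖ ≤ M) {S : Set H}
    (hinv : ∀ t, 0 ≤ t → ∀ u ∈ S, T t u ∈ S)
    (hS : ∀ u ∈ S, ∃ f, A u f ∧ IsGen T u f)
    (hdense : ∀ h : H, (∀ u ∈ S, inner ℂ h u = 0) → h = 0) :
    IsHeatSemigroup A T := by
  have hcont := continuousOn_of_total h0 hadd hM (S := S)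
    (fun u hu => by obtain ⟨f, -, hf⟩ := hS u hu; exact hf.tendsto) hdense
  have hbd : ∀ t, 0 ≤ t → ∀ v, ‖T t v‖ ≤ M * ‖v‖ := fun t ht v =>
    (T t).le_of_opNorm_le (hM t ht) v
  have hBclosed := isClosed_isGen h0 hadd hM hcont
  -- the common part of the two graphs
  let P : Submodule ℂ (H × H) :=
    { carrier := {p | A p.1 p.2} ∩ {p | IsGen T p.1 p.2}
      zero_mem' := ⟨hA.zero, IsGen.zero⟩
      add_mem' := fun ha hb => ⟨hA.add ha.1 hb.1, ha.2.add hb.2⟩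
      smul_mem' := fun c a ha => ⟨hA.smul c ha.1, ha.2.smul c⟩ }
  have hP : IsClosed (P : Set (H × H)) := hA.closed.inter hBclosed
  have : CompleteSpace P := hP.completeSpace_coe
  let L : P →L[ℂ] H :=
    (ContinuousLinearMap.fst ℂ H H + ContinuousLinearMap.snd ℂ H H).comp P.subtypeL
  have hL : ∀ p : P, L p = p.1.1 + p.1.2 := fun p => rfl
  have hLanti : AntilipschitzWith 2 L := by
    refine L.antilipschitz_of_bound (K := 2) fun p => ?_
    rw [hL]
    have h1 := hA.norm_le p.2.1
    have h2 : ‖p.1.2‖ ≤ ‖p.1.1 + p.1.2‖ + ‖p.1.1‖ := by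
      have := norm_sub_le (p.1.1 + p.1.2) p.1.1
      rwa [add_sub_cancel_left] at this
    change max ‖p.1.1‖ ‖p.1.2‖ ≤ _
    have := norm_nonneg (p.1.1 + p.1.2)
    rw [max_le_iff]
    constructor
    · push_cast; linarith
    · push_cast; linarith
  have hrange : IsClosed (L.range : Set H) := by
    have := hLanti.isClosed_range L.uniformContinuous
    simpa only [LinearMap.coe_range, ContinuousLinearMap.coe_coe] using this
  have hsurj : ∀ g : H, ∃ u f, A u f ∧ IsGen T u f ∧ u + f = g := by
    have htop : L.range = ⊤ := by
      refine eq_top_of_isClosed_of_orthogonal hrange fun h hh => hdense h fun u hu => ?_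
      -- if `h` is orthogonal to the range, then `⟨h, T t u⟩` solves `x' = x` and is bounded
      have hd : ∀ t, 0 ≤ t →
          HasDerivWithinAt (fun t => inner ℂ h (T t u)) (inner ℂ h (T t u)) (Set.Ici t) t := by
        intro t ht
        obtain ⟨f, hf, hf'⟩ := hS _ (hinv t ht u hu)
        have h1 : inner ℂ h (T t u + f) = 0 := hh _ ⟨⟨(T t u, f), hf, hf'⟩, rfl⟩
        have h2 := hf'.hasDerivWithinAt hadd le_rfl
        rw [h0, ContinuousLinearMap.id_apply] at h2
        have h3 : HasDerivWithinAt (fun r => T r u) (-f) (Set.Ici t) t := by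
          have h4 : HasDerivWithinAt (fun r => T (r - t) (T t u)) ((1 : ℝ) • -f)
              (Set.Ici t) t := by
            refine HasDerivWithinAt.scomp t (t' := Set.Ici 0) (h := fun r => r - t) (h' := 1)
              (g₁ := fun r => T r (T t u)) (by simpa using h2) ?_ ?_
            · simpa using ((hasDerivAt_id t).sub_const t).hasDerivWithinAt
            · intro r hr; simpa using hr
          rw [one_smul] at h4
          refine h4.congr_of_mem (fun r hr => ?_) (by simp)
          have hr' : t ≤ r := hr
          rw [← ContinuousLinearMap.comp_apply, ← hadd _ _ (sub_nonneg.2 hr') ht,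
            sub_add_cancel]
        have h5 := ((innerSL ℂ h).restrictScalars ℝ).hasFDerivAt.comp_hasDerivWithinAt t h3
        have h6 : inner ℂ h (T t u) = inner ℂ h (-f) := by
          rw [inner_add_right] at h1
          rw [inner_neg_right]; exact eq_neg_of_add_eq_zero_left h1
        rw [h6]; exact h5
      have := eq_zero_of_hasDerivWithinAt_self (x := fun t => inner ℂ h (T t u))
        (C := ‖h‖ * (M * ‖u‖))
        ((innerSL ℂ h).continuous.comp_continuousOn (hcont u)) hd
        (fun t ht => (norm_inner_le_norm _ _).trans (by gcongr; exact hbd t ht u))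
      simpa [h0] using this
    intro g
    obtain ⟨p, hp⟩ : g ∈ L.range := htop ▸ Submodule.mem_top
    exact ⟨p.1.1, p.1.2, p.2.1, p.2.2, hp⟩
  refine ⟨h0, hadd, hcont, fun u f => ⟨fun h => ?_, fun h => ?_⟩⟩
  · obtain ⟨v, g, hv, hv', hg⟩ := hsurj (u + f)
    have h1 := hA.norm_le (hA.sub h hv)
    have h2 : u - v + (f - g) = 0 := by
      rw [show u - v + (f - g) = (u + f) - (v + g) by abel, hg, sub_self]
    rw [h2, norm_zero] at h1
    have h3 : u = v := sub_eq_zero.1 (norm_le_zero_iff.1 h1)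
    subst h3
    have h4 : g = f := add_left_cancel hg
    exact h4 ▸ hv'
  · have h : IsGen T u f := h
    obtain ⟨v, g, hv, hv', hg⟩ := hsurj (u + f)
    have hx := h.sub hv'
    have h2 : f - g = -(u - v) := by
      have : u - v + (f - g) = 0 := by
        rw [show u - v + (f - g) = (u + f) - (v + g) by abel, hg, sub_self]
      exact eq_neg_of_add_eq_zero_right this
    -- the generator maps `u - v` to itself, so that the orbit of `u - v` solves `x' = x`
    have h3 := eq_zero_of_hasDerivWithinAt_self (x := fun t => T t (u - v))
      (C := M * ‖u - v‖) (hcont _)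
      (fun t ht => by
        have := hx.hasDerivWithinAt hadd ht
        rwa [h2, map_neg, neg_neg] at this)
      (fun t ht => hbd t ht _)
    simp only [h0, ContinuousLinearMap.id_apply] at h3
    have h3 : u = v := sub_eq_zero.1 h3
    subst h3
    have h4 : g = f := add_left_cancel hg
    exact h4 ▸ hv

/-- The heat semigroup of a densely defined accretive operator is unique: the distance of two orbits
of a vector in the domain does not increase. -/
theorem IsHeatSemigroup.unique [CompleteSpace H] {A : H → H → Prop} (hA : IsAccretiveGraph A)
    {T T' : ℝ → H →L[ℂ] H} (hT : IsHeatSemigroup A T) (hT' : IsHeatSemigroup A T')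
    (hdense : ∀ h : H, (∀ u f, A u f → inner ℂ h u = 0) → h = 0) {t : ℝ} (ht : 0 ≤ t) :
    T t = T' t := by
  have key : ∀ u f, A u f → T t u = T' t u := by
    intro u f huf
    have hg : IsGen T u f := (hT.generator u f).1 huf
    have hg' : IsGen T' u f := (hT'.generator u f).1 huf
    have hd : ∀ s, 0 ≤ s → HasDerivWithinAt (fun s => ‖T s u - T' s u‖ ^ 2)
        (2 * (inner ℂ (T s u - T' s u) (-(T s f) - -(T' s f))).re) (Set.Ici s) s := by
      intro s hs
      let : InnerProductSpace ℝ H := InnerProductSpace.rclikeToReal ℂ H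
      exact ((hg.hasDerivWithinAt hT.add hs).sub (hg'.hasDerivWithinAt hT'.add hs)).norm_sq
    have hle := image_le_of_deriv_right_le_deriv_boundary (a := 0) (b := t)
      (f := fun s => ‖T s u - T' s u‖ ^ 2) (B := fun _ => 0) (B' := fun _ => 0)
      (((((hT.cont u).sub (hT'.cont u))).norm.pow 2).mono Set.Icc_subset_Ici_self)
      (fun s hs => hd s hs.1) (by simp [hT.zero, hT'.zero]) continuousOn_const
      (fun s _ => hasDerivWithinAt_const _ _ _)
      (fun s hs => by
        have h1 : A (T s u) (T s f) := (hT.generator _ _).2 (hg.apply hT.add hs.1)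
        have h2 : A (T' s u) (T' s f) := (hT'.generator _ _).2 (hg'.apply hT'.add hs.1)
        have h3 := hA.accretive (hA.sub h1 h2)
        rw [show -(T s f) - -(T' s f) = -(T s f - T' s f) by abel, inner_neg_right, Complex.neg_re]
        linarith)
      (x := t) ⟨ht, le_rfl⟩
    have h4 : ‖T t u - T' t u‖ = 0 := by
      have := sq_nonneg ‖T t u - T' t u‖
      exact pow_eq_zero_iff (two_ne_zero) |>.1 (le_antisymm hle this)
    exact sub_eq_zero.1 (norm_eq_zero.1 h4)
  let V : Submodule ℂ H := (T t - T' t).ker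
  have hV : IsClosed (V : Set H) := (T t - T' t).isClosed_ker
  have hVtop : V = ⊤ := by
    refine eq_top_of_isClosed_of_orthogonal hV fun h hh => hdense h fun u f hu => hh u ?_
    change T t u - T' t u = 0
    rw [key u f hu, sub_self]
  ext u
  have : u ∈ V := hVtop ▸ Submodule.mem_top
  exact sub_eq_zero.1 this

end Semigroup

/-! ### Covectors -/

section Covectors

variable {n : ℕ}

theorem wedge_apply {p p' : ℕ} (j : Fin n) (a : Cov n p)
    (K : {J : Finset (Fin n) // J.card = p'}) :
    wedge j p p' a K = if j ∈ K.1 then sgn j (K.1.erase j) * coeff a (K.1.erase j) else 0 := rfl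

theorem contract_apply {p p' : ℕ} (j : Fin n) (a : Cov n p)
    (K : {J : Finset (Fin n) // J.card = p'}) :
    contract j p p' a K = if j ∈ K.1 then 0 else sgn j K.1 * coeff a (insert j K.1) := rfl

theorem coeff_val {q : ℕ} (a : Cov n q) (K : {J : Finset (Fin n) // J.card = q}) :
    coeff a K.1 = a K := by
  simp [coeff, K.2]

theorem coeff_eq_zero {q : ℕ} (a : Cov n q) {J : Finset (Fin n)} (h : J.card ≠ q) :
    coeff a J = 0 := by
  simp [coeff, h]

theorem coeff_wedge {q : ℕ} (j : Fin n) (a : Cov n q) (I : Finset (Fin n)) :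
    coeff (wedge j q (q + 1) a) I =
      if j ∈ I then sgn j (I.erase j) * coeff a (I.erase j) else 0 := by
  by_cases h : I.card = q + 1
  · exact coeff_val _ ⟨I, h⟩
  · rw [coeff_eq_zero _ h]
    split_ifs with hj
    · rw [coeff_eq_zero, mul_zero]
      have := Finset.card_erase_add_one hj
      omega
    · rfl

theorem coeff_contract {q : ℕ} (j : Fin n) (a : Cov n (q + 1)) (I : Finset (Fin n)) :
    coeff (contract j (q + 1) q a) I =
      if j ∈ I then 0 else sgn j I * coeff a (insert j I) := by
  by_cases h : I.card = q
  · exact coeff_val _ ⟨I, h⟩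
  · rw [coeff_eq_zero _ h]
    split_ifs with hj
    · rfl
    · rw [coeff_eq_zero, mul_zero]
      rw [Finset.card_insert_of_notMem hj]
      omega

theorem sgn_mul_self (j : Fin n) (J : Finset (Fin n)) : sgn j J * sgn j J = 1 := by
  rw [sgn, ← pow_add, ← two_mul, pow_mul]; simp

theorem sgn_insert (j k : Fin n) {J : Finset (Fin n)} (hk : k ∉ J) :
    sgn j (insert k J) = (if k < j then -1 else 1) * sgn j J := by
  unfold sgn
  rw [Finset.filter_insert]
  split_ifs with h
  · rw [Finset.card_insert_of_notMem (by simp [hk]), pow_succ]; ring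
  · ring

theorem sgn_conj (j : Fin n) (J : Finset (Fin n)) : (starRingEnd ℂ) (sgn j J) = sgn j J := by
  simp [sgn]

theorem sgn_insert_mul_sgn_insert {j k : Fin n} (hjk : j ≠ k) {L : Finset (Fin n)} (hj : j ∉ L)
    (hk : k ∉ L) : sgn k (insert j L) * sgn j (insert k L) = -(sgn j L * sgn k L) := by
  rw [sgn_insert k j hj, sgn_insert j k hk]
  rcases lt_or_gt_of_ne hjk with h | h
  · rw [if_pos h, if_neg h.not_gt]; ring
  · rw [if_pos h, if_neg h.not_gt]; ring

/-- The canonical anticommutation relations. -/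
theorem contract_wedge_add_wedge_contract {q : ℕ} (j k : Fin n) (a : Cov n q) :
    contract k (q + 1) q (wedge j q (q + 1) a) + wedge j (q - 1) q (contract k q (q - 1) a) =
      if j = k then a else 0 := by
  ext K
  rw [PiLp.add_apply, contract_apply, coeff_wedge]
  have hK : wedge j (q - 1) q (contract k q (q - 1) a) K =
      if j ∈ K.1 then (if k ∈ K.1.erase j then 0 else
        sgn j (K.1.erase j) * (sgn k (K.1.erase j) * coeff a (insert k (K.1.erase j)))) else 0 := by
    rcases q with _ | q
    · have : K.1 = ∅ := Finset.card_eq_zero.1 K.2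
      rw [wedge_apply, this]
      simp
    · rw [wedge_apply, show coeff (contract k (q + 1) (q + 1 - 1) a) (K.1.erase j) = _ from
        coeff_contract k a _]
      split_ifs <;> simp
  rw [hK]
  by_cases hjk : j = k
  · subst hjk
    by_cases hj : j ∈ K.1
    · simp only [hj, if_true, Finset.notMem_erase, if_false, zero_add, Finset.insert_erase hj]
      rw [← mul_assoc, sgn_mul_self, one_mul, coeff_val]
    · simp only [hj, if_false, Finset.mem_insert_self, if_true, add_zero,
        Finset.erase_insert hj]
      rw [← mul_assoc, sgn_mul_self, one_mul, coeff_val]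
  · rw [if_neg hjk]
    by_cases hk : k ∈ K.1
    · simp [hk, Ne.symm hjk]
    · by_cases hj : j ∈ K.1
      · have h1 : (insert k K.1).erase j = insert k (K.1.erase j) :=
          Finset.erase_insert_of_ne (Ne.symm hjk)
        have hkL : k ∉ K.1.erase j := fun h => hk (Finset.mem_of_mem_erase h)
        simp only [hk, hj, if_true, if_false, Finset.mem_insert, or_true, h1, hkL]
        have h2 := sgn_insert_mul_sgn_insert hjk (Finset.notMem_erase j K.1) hkL
        rw [Finset.insert_erase hj] at h2
        rw [PiLp.zero_apply]
        linear_combination (coeff a (insert k (K.1.erase j))) * h2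
      · simp [hk, hj, hjk]

/-- Contractions anticommute, also in the degrees in which they are defined to be zero. -/
theorem contract_contract {p p' p'' : ℕ} (j k : Fin n) (a : Cov n p) :
    contract k p' p'' (contract j p p' a) = -contract j p' p'' (contract k p p' a) := by
  have key : ∀ (j : Fin n) (I : Finset (Fin n)), coeff (contract j p p' a) I =
      if I.card = p' then (if j ∈ I then 0 else sgn j I * coeff a (insert j I)) else 0 := by
    intro j I
    by_cases h : I.card = p'
    · rw [if_pos h]; exact coeff_val _ ⟨I, h⟩
    · rw [coeff_eq_zero _ h, if_neg h]
  ext K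
  rw [PiLp.neg_apply, contract_apply, contract_apply, key, key]
  by_cases hjk : j = k
  · subst hjk; simp
  by_cases hk : k ∈ K.1
  · simp [hk]
  by_cases hj : j ∈ K.1
  · simp [hj]
  simp only [hk, hj, if_false, Finset.mem_insert, hjk, Ne.symm hjk, or_self,
    Finset.card_insert_of_notMem hk, Finset.card_insert_of_notMem hj]
  split_ifs with hp
  · rw [Finset.insert_comm k j, sgn_insert k j hj, sgn_insert j k hk]
    rcases lt_or_gt_of_ne hjk with h | h
    · rw [if_pos h, if_neg h.not_gt]; ring
    · rw [if_pos h, if_neg h.not_gt]; ring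
  · simp

/-- Contraction is the adjoint of exterior multiplication, in all degrees. -/
theorem inner_contract {p p' : ℕ} (j : Fin n) (e : Cov n p') (x : Cov n p) :
    inner ℂ (contract j p' p e) x = inner ℂ e (wedge j p p' x) := by
  have : (contract j p' p).toLinearMap = LinearMap.adjoint (wedge j p p').toLinearMap := by
    rw [LinearMap.eq_adjoint_iff_basis (EuclideanSpace.basisFun _ ℂ).toBasis
      (EuclideanSpace.basisFun _ ℂ).toBasis]
    intro K J
    simp only [OrthonormalBasis.coe_toBasis, EuclideanSpace.basisFun_apply,
      ContinuousLinearMap.coe_coe, EuclideanSpace.inner_single_right,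
      EuclideanSpace.inner_single_left, contract_apply, wedge_apply, map_one, one_mul]
    have h1 : ∀ {q : ℕ} (L : {J : Finset (Fin n) // J.card = q}) (I : Finset (Fin n)),
        coeff (EuclideanSpace.single L (1 : ℂ)) I = if I = L.1 then 1 else 0 := by
      intro q L I
      by_cases h : I.card = q
      · simp [coeff, h, Subtype.ext_iff]
      · rw [coeff_eq_zero _ h, if_neg]
        rintro rfl
        exact h L.2
    simp only [h1]
    by_cases hj : j ∈ K.1
    · by_cases hJ : K.1.erase j = J.1
      · have h2 : j ∉ J.1 := hJ ▸ Finset.notMem_erase j K.1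
        have h3 : insert j J.1 = K.1 := by rw [← hJ, Finset.insert_erase hj]
        simp [hj, h2, h3, hJ, sgn_conj]
      · rw [if_neg hJ]
        by_cases h2 : j ∈ J.1
        · simp [h2]
        · have h3 : insert j J.1 ≠ K.1 := fun h => hJ (by rw [← h, Finset.erase_insert h2])
          simp [h2, h3]
    · have h3 : insert j J.1 ≠ K.1 := fun h => hj (by rw [← h]; simp)
      simp [hj, h3]
  have h := LinearMap.adjoint_inner_left (wedge j p p').toLinearMap x e
  rw [← this] at h
  exact h

theorem wedgeContract_apply {q : ℕ} (j : Fin n) (a : Cov n q)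
    (K : {J : Finset (Fin n) // J.card = q}) :
    wedgeContract j q a K = if j ∈ K.1 then a K else 0 := by
  have h : wedgeContract j q a = wedge j (q - 1) q (contract j q (q - 1) a) := rfl
  rw [h, wedge_apply]
  rcases q with _ | q
  · have : K.1 = ∅ := Finset.card_eq_zero.1 K.2
    simp [this]
  · rw [show coeff (contract j (q + 1) (q + 1 - 1) a) (K.1.erase j) = _ from
      coeff_contract j a _]
    by_cases hj : j ∈ K.1
    · simp only [hj, if_true, Finset.notMem_erase, if_false, Finset.insert_erase hj]
      rw [← mul_assoc, sgn_mul_self, one_mul, coeff_val]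
    · simp [hj]

theorem Theta_apply {q : ℕ} (lam : Fin n → ℝ) (a : Cov n q)
    (K : {J : Finset (Fin n) // J.card = q}) :
    Theta lam q a K = ((∑ j ∈ K.1, lam j : ℝ) : ℂ) * a K := by
  have : Theta lam q a = ∑ j, (lam j : ℂ) • wedgeContract j q a := by
    simp [Theta]
  rw [this, WithLp.ofLp_sum, Finset.sum_apply, Complex.ofReal_sum, Finset.sum_mul]
  simp only [PiLp.smul_apply, wedgeContract_apply, smul_eq_mul, mul_ite, mul_zero]
  rw [Finset.sum_ite_mem, Finset.univ_inter]

/-- The exponential of a diagonal operator is diagonal. -/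
theorem exp_apply_of_diagonal {q : ℕ} {A : Cov n q →L[ℂ] Cov n q}
    {K : {J : Finset (Fin n) // J.card = q}} {c : ℂ} (hA : ∀ a, A a K = c * a K) (a : Cov n q) :
    (NormedSpace.exp A) a K = Complex.exp c * a K := by
  have h1 := NormedSpace.exp_series_hasSum_exp' (𝕂 := ℂ) A
  let L : (Cov n q →L[ℂ] Cov n q) →L[ℂ] ℂ :=
    (EuclideanSpace.proj K).comp (ContinuousLinearMap.apply ℂ (Cov n q) a)
  have h2 := h1.mapL L
  have h3 : ∀ m : ℕ, ∀ a, (A ^ m) a K = c ^ m * a K := by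
    intro m
    induction m with
    | zero => intro a; simp
    | succ m ih =>
      intro a
      rw [pow_succ, mul_apply_eq_comp, ih, hA, pow_succ, mul_assoc]
  have h4 := (NormedSpace.exp_series_hasSum_exp' (𝕂 := ℂ) c).mul_right (a K)
  rw [← Complex.exp_eq_exp_ℂ] at h4
  refine h2.unique (h4.congr_fun fun m => ?_)
  change ((((m.factorial : ℂ)⁻¹) • A ^ m) a) K = _
  rw [smul_apply, PiLp.smul_apply, h3, smul_eq_mul, smul_eq_mul, mul_assoc]

theorem exp_Theta_apply {q : ℕ} (lam : Fin n → ℝ) (t : ℝ) (a : Cov n q)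
    (K : {J : Finset (Fin n) // J.card = q}) :
    (NormedSpace.exp (-(t : ℂ) • Theta lam q)) a K =
      Complex.exp (-(t * ∑ j ∈ K.1, lam j : ℝ)) * a K :=
  exp_apply_of_diagonal (fun a => by
    rw [smul_apply, PiLp.smul_apply, Theta_apply]
    push_cast; rw [smul_eq_mul]; ring) a

theorem prod_ofFn_apply_of_diagonal {q : ℕ} {K : {J : Finset (Fin n) // J.card = q}} {m : ℕ}
    (A : Fin m → (Cov n q →L[ℂ] Cov n q)) (d : Fin m → ℂ) (hA : ∀ i a, A i a K = d i * a K)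
    (a : Cov n q) : (List.ofFn A).prod a K = (∏ i, d i) * a K := by
  induction m with
  | zero => simp
  | succ m ih =>
    rw [List.ofFn_succ, List.prod_cons, mul_apply_eq_comp, hA,
      ih _ (fun i => d i.succ) (fun i => hA i.succ), Fin.prod_univ_succ, mul_assoc]

theorem prod_ofFn_apply {q : ℕ} (lam : Fin n → ℝ) (t : ℝ) (a : Cov n q)
    (K : {J : Finset (Fin n) // J.card = q}) :
    (List.ofFn fun j : Fin n => (todd t (lam j) / (2 * (Real.pi : ℂ))) •
        (1 + (Complex.exp (-(t * lam j)) - 1) • wedgeContract j q)).prod a K =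
      (∏ j, todd t (lam j) / (2 * (Real.pi : ℂ))) *
        (Complex.exp (-(t * ∑ j ∈ K.1, lam j : ℝ)) * a K) := by
  rw [prod_ofFn_apply_of_diagonal _ (fun j => (todd t (lam j) / (2 * (Real.pi : ℂ))) *
    (if j ∈ K.1 then Complex.exp (-(t * lam j)) else 1)), Finset.prod_mul_distrib, mul_assoc]
  · congr 2
    rw [Finset.prod_ite_mem, Finset.univ_inter, ← Complex.exp_sum]
    push_cast
    rw [Finset.mul_sum, Finset.sum_neg_distrib]
  · intro j a
    simp only [smul_apply, add_apply,
      one_apply_eq_self, PiLp.smul_apply, PiLp.add_apply, wedgeContract_apply,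
      smul_eq_mul]
    split_ifs <;> ring

theorem detQuot_diagonal (d : Fin n → ℂ) (t : ℝ) :
    detQuot (Matrix.diagonal d) t = ∏ j, todd t (d j) := by
  rw [detQuot, Matrix.charpoly_diagonal]
  have h : (∏ i, (Polynomial.X - Polynomial.C (d i))) =
      ((Finset.univ.val.map d).map fun a => Polynomial.X - Polynomial.C a).prod := by
    rw [Multiset.map_map]; rfl
  rw [h, Polynomial.roots_multiset_prod_X_sub_C, Multiset.map_map]
  rfl

theorem one_sub_exp_diagonal (d : Fin n → ℂ) (t : ℂ) :
    (1 - NormedSpace.exp (-t • Matrix.diagonal d)) =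
      Matrix.diagonal fun j => 1 - Complex.exp (-(t * d j)) := by
  rw [← Matrix.diagonal_smul, Matrix.exp_diagonal, ← Matrix.diagonal_one, Matrix.diagonal_sub]
  congr 1
  ext j
  rw [Pi.coe_exp, ← Complex.exp_eq_exp_ℂ]
  simp

end Covectors

/-! ### Wirtinger derivatives and weighted `L²` spaces -/

section Calculus

variable {n : ℕ} {f g : (Fin n → ℂ) → ℂ} {z : Fin n → ℂ}

theorem dzbar_add (j : Fin n) (hf : DifferentiableAt ℝ f z) (hg : DifferentiableAt ℝ g z) :
    dzbar j (fun z => f z + g z) z = dzbar j f z + dzbar j g z := by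
  unfold dzbar; rw [fderiv_fun_add hf hg]; simp only [add_apply]; ring

theorem dz_add (j : Fin n) (hf : DifferentiableAt ℝ f z) (hg : DifferentiableAt ℝ g z) :
    dz j (fun z => f z + g z) z = dz j f z + dz j g z := by
  unfold dz; rw [fderiv_fun_add hf hg]; simp only [add_apply]; ring

theorem dzbar_mul (j : Fin n) (hf : DifferentiableAt ℝ f z) (hg : DifferentiableAt ℝ g z) :
    dzbar j (fun z => f z * g z) z = dzbar j f z * g z + f z * dzbar j g z := by
  unfold dzbar; rw [fderiv_fun_mul hf hg]; simp only [add_apply, smul_apply, smul_eq_mul]; ring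

theorem dz_mul (j : Fin n) (hf : DifferentiableAt ℝ f z) (hg : DifferentiableAt ℝ g z) :
    dz j (fun z => f z * g z) z = dz j f z * g z + f z * dz j g z := by
  unfold dz; rw [fderiv_fun_mul hf hg]; simp only [add_apply, smul_apply, smul_eq_mul]; ring

theorem dzbar_const (j : Fin n) (c : ℂ) : dzbar j (fun _ => c) z = 0 := by
  simp [dzbar]

theorem dz_const (j : Fin n) (c : ℂ) : dz j (fun _ => c) z = 0 := by
  simp [dz]

theorem dzbar_cexp (j : Fin n) (hf : DifferentiableAt ℝ f z) :
    dzbar j (fun z => Complex.exp (f z)) z = Complex.exp (f z) * dzbar j f z := by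
  unfold dzbar; rw [hf.hasFDerivAt.cexp.fderiv]; simp only [smul_apply, smul_eq_mul]; ring

theorem dz_cexp (j : Fin n) (hf : DifferentiableAt ℝ f z) :
    dz j (fun z => Complex.exp (f z)) z = Complex.exp (f z) * dz j f z := by
  unfold dz; rw [hf.hasFDerivAt.cexp.fderiv]; simp only [smul_apply, smul_eq_mul]; ring

theorem fderiv_conj : fderiv ℝ (fun z => (starRingEnd ℂ) (f z)) z =
    (Complex.conjCLE : ℂ →L[ℝ] ℂ).comp (fderiv ℝ f z) :=
  Complex.conjCLE.comp_fderiv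

theorem dzbar_conj (j : Fin n) (f : (Fin n → ℂ) → ℂ) (z : Fin n → ℂ) :
    dzbar j (fun z => (starRingEnd ℂ) (f z)) z = (starRingEnd ℂ) (dz j f z) := by
  unfold dzbar dz; rw [fderiv_conj]; simp [Complex.conj_ofNat, sub_eq_add_neg]

theorem dz_conj (j : Fin n) (f : (Fin n → ℂ) → ℂ) (z : Fin n → ℂ) :
    dz j (fun z => (starRingEnd ℂ) (f z)) z = (starRingEnd ℂ) (dzbar j f z) := by
  unfold dzbar dz; rw [fderiv_conj]; simp [Complex.conj_ofNat, sub_eq_add_neg]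

theorem fderiv_coord (i : Fin n) :
    fderiv ℝ (fun z : Fin n → ℂ => z i) z = ContinuousLinearMap.proj i :=
  (ContinuousLinearMap.proj (R := ℝ) (φ := fun _ : Fin n => ℂ) i).fderiv

theorem dzbar_coord (i j : Fin n) : dzbar j (fun z => z i) z = 0 := by
  unfold dzbar
  rw [fderiv_coord]
  simp only [ContinuousLinearMap.proj_apply, Pi.single_apply]
  split_ifs <;> simp

theorem dz_coord (i j : Fin n) : dz j (fun z => z i) z = if i = j then 1 else 0 := by
  unfold dz
  rw [fderiv_coord]
  simp only [ContinuousLinearMap.proj_apply, Pi.single_apply]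
  split_ifs <;> simp
  norm_num

theorem dzbar_conj_coord (i j : Fin n) :
    dzbar j (fun z => (starRingEnd ℂ) (z i)) z = if i = j then 1 else 0 := by
  rw [dzbar_conj, dz_coord]; split_ifs <;> simp

theorem dz_conj_coord (i j : Fin n) : dz j (fun z => (starRingEnd ℂ) (z i)) z = 0 := by
  rw [dz_conj, dzbar_coord, map_zero]

theorem dzbar_sum {ι : Type*} (s : Finset ι) {F : ι → (Fin n → ℂ) → ℂ} (j : Fin n)
    (h : ∀ i ∈ s, DifferentiableAt ℝ (F i) z) :
    dzbar j (fun z => ∑ i ∈ s, F i z) z = ∑ i ∈ s, dzbar j (F i) z := by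
  unfold dzbar; rw [fderiv_fun_sum h]
  simp only [FunLike.coe_sum, Finset.sum_apply, Finset.mul_sum,
    ← Finset.sum_add_distrib]

theorem dz_sum {ι : Type*} (s : Finset ι) {F : ι → (Fin n → ℂ) → ℂ} (j : Fin n)
    (h : ∀ i ∈ s, DifferentiableAt ℝ (F i) z) :
    dz j (fun z => ∑ i ∈ s, F i z) z = ∑ i ∈ s, dz j (F i) z := by
  unfold dz; rw [fderiv_fun_sum h]
  simp only [FunLike.coe_sum, Finset.sum_apply, Finset.mul_sum,
    ← Finset.sum_sub_distrib]

theorem contDiff_dz {f : (Fin n → ℂ) → ℂ} (hf : ContDiff ℝ ∞ f) (j : Fin n) :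
    ContDiff ℝ ∞ (dz j f) := by
  have h : ContDiff ℝ ∞ (fderiv ℝ f) := hf.fderiv_right le_rfl
  unfold dz
  exact contDiff_const.mul ((h.clm_apply contDiff_const).sub
    (contDiff_const.mul (h.clm_apply contDiff_const)))

theorem contDiff_dzbar {f : (Fin n → ℂ) → ℂ} (hf : ContDiff ℝ ∞ f) (j : Fin n) :
    ContDiff ℝ ∞ (dzbar j f) := by
  have h : ContDiff ℝ ∞ (fderiv ℝ f) := hf.fderiv_right le_rfl
  unfold dzbar
  exact contDiff_const.mul ((h.clm_apply contDiff_const).add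
    (contDiff_const.mul (h.clm_apply contDiff_const)))

theorem hasCompactSupport_dz {f : (Fin n → ℂ) → ℂ} (hf : HasCompactSupport f) (j : Fin n) :
    HasCompactSupport (dz j f) := by
  refine (hf.fderiv (𝕜 := ℝ)).mono fun z hz hz' => hz ?_
  simp only [dz]; rw [hz']; simp

theorem dz_comm {f : (Fin n → ℂ) → ℂ} (hf : ContDiff ℝ ∞ f) (j k : Fin n) (z : Fin n → ℂ) :
    dz j (dz k f) z = dz k (dz j f) z := by
  have hsymm : IsSymmSndFDerivAt ℝ f z :=
    hf.contDiffAt.isSymmSndFDerivAt (by simpa using ENat.LEInfty.out)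
  have hd : DifferentiableAt ℝ (fderiv ℝ f) z :=
    (hf.fderiv_right (m := ∞) le_rfl).differentiable (by simp) z
  have key : ∀ (k : Fin n) (v : Fin n → ℂ), fderiv ℝ (dz k f) z v = (1 / 2) *
      (fderiv ℝ (fderiv ℝ f) z v (Pi.single k 1) -
        Complex.I * fderiv ℝ (fderiv ℝ f) z v (Pi.single k Complex.I)) := by
    intro k v
    have h1 : ∀ w : Fin n → ℂ, HasFDerivAt (fun z => fderiv ℝ f z w)
        ((ContinuousLinearMap.apply ℝ ℂ w).comp (fderiv ℝ (fderiv ℝ f) z)) z := fun w =>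
      (ContinuousLinearMap.apply ℝ ℂ w).hasFDerivAt.comp z hd.hasFDerivAt
    have h2 := (((h1 (Pi.single k 1)).sub ((h1 (Pi.single k Complex.I)).const_mul
      Complex.I)).const_mul (1 / 2 : ℂ)).fderiv
    have h3 : fderiv ℝ (dz k f) z = _ := h2
    rw [h3]; simp
  rw [dz, dz, key, key, key, key]
  rw [hsymm.eq (Pi.single j 1) (Pi.single k 1), hsymm.eq (Pi.single j 1) (Pi.single k Complex.I),
    hsymm.eq (Pi.single j Complex.I) (Pi.single k 1),
    hsymm.eq (Pi.single j Complex.I) (Pi.single k Complex.I)]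
  ring

/-- The formal adjoint `-∂/∂z_j + λ_j z̄_j` of `∂/∂z̄_j` with respect to the weight `φ₀`. -/
noncomputable def del (lam : Fin n → ℝ) (j : Fin n) (f : (Fin n → ℂ) → ℂ) (z : Fin n → ℂ) : ℂ :=
  -dz j f z + lam j * (starRingEnd ℂ) (z j) * f z

theorem contDiff_coord (j : Fin n) : ContDiff ℝ ∞ fun z : Fin n → ℂ => z j :=
  contDiff_apply ℝ ℂ j

theorem contDiff_conj_coord (j : Fin n) :
    ContDiff ℝ ∞ fun z : Fin n → ℂ => (starRingEnd ℂ) (z j) :=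
  Complex.conjCLE.contDiff.comp (contDiff_coord j)

theorem contDiff_conj {f : (Fin n → ℂ) → ℂ} (hf : ContDiff ℝ ∞ f) :
    ContDiff ℝ ∞ fun z => (starRingEnd ℂ) (f z) :=
  Complex.conjCLE.contDiff.comp hf

theorem contDiff_del (lam : Fin n → ℝ) {f : (Fin n → ℂ) → ℂ} (hf : ContDiff ℝ ∞ f) (j : Fin n) :
    ContDiff ℝ ∞ (del lam j f) :=
  (contDiff_dz hf j).neg.add ((contDiff_const.mul (contDiff_conj_coord j)).mul hf)

theorem hasCompactSupport_del (lam : Fin n → ℝ) {f : (Fin n → ℂ) → ℂ} (hf : HasCompactSupport f)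
    (j : Fin n) : HasCompactSupport (del lam j f) :=
  (hasCompactSupport_dz hf j).neg.add hf.mul_left

theorem del_comm (lam : Fin n → ℝ) {f : (Fin n → ℂ) → ℂ} (hf : ContDiff ℝ ∞ f) (j k : Fin n) :
    del lam j (del lam k f) = del lam k (del lam j f) := by
  funext z
  have hdf : DifferentiableAt ℝ f z := hf.differentiable (by simp) z
  have key : ∀ j k : Fin n, dz j (del lam k f) z =
      -dz j (dz k f) z + lam k * (starRingEnd ℂ) (z k) * dz j f z := by
    intro j k
    have h1 : DifferentiableAt ℝ (fun z => -1 * dz k f z) z :=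
      (((contDiff_dz hf k).differentiable (by simp)) z).const_mul _
    have h2 : DifferentiableAt ℝ (fun z : Fin n → ℂ => lam k * (starRingEnd ℂ) (z k)) z :=
      (((contDiff_conj_coord k).differentiable (by simp)) z).const_mul _
    have h3 : del lam k f = fun z => -1 * dz k f z + lam k * (starRingEnd ℂ) (z k) * f z := by
      funext z; simp [del]
    rw [h3, dz_add j h1 (h2.fun_mul hdf), dz_mul j h2 hdf,
      dz_mul j (by fun_prop) ((contDiff_dz hf k).differentiable (by simp) z),
      dz_mul j (by fun_prop) ((contDiff_conj_coord k).differentiable (by simp) z),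
      dz_conj_coord, dz_const, dz_const]
    ring
  change -dz j (del lam k f) z + lam j * (starRingEnd ℂ) (z j) * del lam k f z =
    -dz k (del lam j f) z + lam k * (starRingEnd ℂ) (z k) * del lam j f z
  rw [key, key, dz_comm hf j k]
  simp only [del]
  ring

theorem phi_eq (lam : Fin n → ℝ) (z : Fin n → ℂ) :
    (phi lam z : ℂ) = ∑ j, lam j * (z j * (starRingEnd ℂ) (z j)) := by
  unfold phi; push_cast
  refine Finset.sum_congr rfl fun j _ => ?_
  rw [Complex.mul_conj, Complex.normSq_eq_norm_sq]; push_cast; ring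

theorem differentiableAt_coord (i : Fin n) : DifferentiableAt ℝ (fun z : Fin n → ℂ => z i) z :=
  (contDiff_coord i).differentiable (by simp) z

theorem differentiableAt_conj_coord (i : Fin n) :
    DifferentiableAt ℝ (fun z : Fin n → ℂ => (starRingEnd ℂ) (z i)) z :=
  (contDiff_conj_coord i).differentiable (by simp) z

theorem dzbar_quadratic (c : Fin n → ℂ) (j : Fin n) :
    dzbar j (fun z => ∑ i, c i * (z i * (starRingEnd ℂ) (z i))) z = c j * z j := by
  rw [dzbar_sum _ _ fun i _ => ((differentiableAt_coord i).fun_mul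
    (differentiableAt_conj_coord i)).const_mul _]
  rw [Finset.sum_eq_single j]
  · rw [dzbar_mul _ (by fun_prop) ((differentiableAt_coord j).fun_mul (differentiableAt_conj_coord j)),
      dzbar_mul _ (differentiableAt_coord j) (differentiableAt_conj_coord j), dzbar_const,
      dzbar_coord, dzbar_conj_coord]
    simp
  · intro i _ hij
    rw [dzbar_mul _ (by fun_prop) ((differentiableAt_coord i).fun_mul (differentiableAt_conj_coord i)),
      dzbar_mul _ (differentiableAt_coord i) (differentiableAt_conj_coord i), dzbar_const,
      dzbar_coord, dzbar_conj_coord]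
    simp [hij]
  · simp

theorem dz_quadratic (c : Fin n → ℂ) (j : Fin n) :
    dz j (fun z => ∑ i, c i * (z i * (starRingEnd ℂ) (z i))) z =
      c j * (starRingEnd ℂ) (z j) := by
  rw [dz_sum _ _ fun i _ => ((differentiableAt_coord i).fun_mul
    (differentiableAt_conj_coord i)).const_mul _]
  rw [Finset.sum_eq_single j]
  · rw [dz_mul _ (by fun_prop) ((differentiableAt_coord j).fun_mul (differentiableAt_conj_coord j)),
      dz_mul _ (differentiableAt_coord j) (differentiableAt_conj_coord j), dz_const,
      dz_coord, dz_conj_coord]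
    simp
  · intro i _ hij
    rw [dz_mul _ (by fun_prop) ((differentiableAt_coord i).fun_mul (differentiableAt_conj_coord i)),
      dz_mul _ (differentiableAt_coord i) (differentiableAt_conj_coord i), dz_const,
      dz_coord, dz_conj_coord]
    simp [hij]
  · simp

theorem curv_eq (lam : Fin n → ℝ) : curv lam = Matrix.diagonal fun j => (lam j : ℂ) := by
  ext k j
  have h : dzbar k (fun z => (phi lam z : ℂ)) = fun z => (lam k : ℂ) * z k := by
    funext z
    simp only [phi_eq]
    exact dzbar_quadratic _ k
  rw [curv, Matrix.of_apply, h, dz_mul _ (by fun_prop) (differentiableAt_coord k), dz_const,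
    dz_coord, Matrix.diagonal_apply]
  simp

end Calculus

section Measure

variable {n : ℕ} (lam : Fin n → ℝ)

/-- The density of `e^{-φ₀} dv` with respect to Lebesgue measure. -/
noncomputable def dens (z : Fin n → ℂ) : ℝ := 2 ^ n * Real.exp (-phi lam z)

theorem dens_pos (z : Fin n → ℂ) : 0 < dens lam z := by unfold dens; positivity

theorem contDiff_phi : ContDiff ℝ ∞ (phi lam) := by
  unfold phi
  exact ContDiff.sum fun j _ => contDiff_const.mul ((contDiff_coord j).norm_sq ℝ)

theorem contDiff_dens : ContDiff ℝ ∞ (dens lam) := by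
  unfold dens
  exact contDiff_const.mul (contDiff_phi lam).neg.exp

theorem continuous_dens : Continuous (dens lam) := (contDiff_dens lam).continuous

theorem mu_eq : mu lam = volume.withDensity fun z => ENNReal.ofReal (dens lam z) := rfl

theorem measurable_ofReal_dens : Measurable fun z => ENNReal.ofReal (dens lam z) :=
  (continuous_dens lam).measurable.ennreal_ofReal

instance : IsLocallyFiniteMeasure (mu lam) :=
  IsLocallyFiniteMeasure.withDensity_ofReal (continuous_dens lam)

instance : SigmaFinite (mu lam) :=
  SigmaFinite.withDensity_of_ne_top (Eventually.of_forall fun _ => ENNReal.ofReal_ne_top)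

theorem mu_absolutelyContinuous : mu lam ≪ volume := withDensity_absolutelyContinuous _ _

theorem volume_absolutelyContinuous : volume ≪ mu lam :=
  withDensity_absolutelyContinuous' (measurable_ofReal_dens lam).aemeasurable
    (Eventually.of_forall fun z => (ENNReal.ofReal_pos.2 (dens_pos lam z)).ne')

instance : (mu lam).IsOpenPosMeasure := (volume_absolutelyContinuous lam).isOpenPosMeasure

theorem integral_mu {E : Type*} [NormedAddCommGroup E] [NormedSpace ℝ E]
    (f : (Fin n → ℂ) → E) : ∫ z, f z ∂(mu lam) = ∫ z, dens lam z • f z := by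
  rw [mu_eq, integral_withDensity_eq_integral_toReal_smul (measurable_ofReal_dens lam)
    (Eventually.of_forall fun _ => ENNReal.ofReal_lt_top)]
  refine integral_congr_ae (Eventually.of_forall fun z => ?_)
  simp only [ENNReal.toReal_ofReal (dens_pos lam z).le]

theorem integrable_mu_iff {E : Type*} [NormedAddCommGroup E] [NormedSpace ℝ E]
    {f : (Fin n → ℂ) → E} :
    Integrable f (mu lam) ↔ Integrable fun z => dens lam z • f z := by
  rw [mu_eq, integrable_withDensity_iff_integrable_smul' (measurable_ofReal_dens lam)
    (Eventually.of_forall fun _ => ENNReal.ofReal_lt_top)]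
  simp only [ENNReal.toReal_ofReal (dens_pos lam _).le]

open Classical in
/-- The class in `L²(e^{-φ₀} dv)` of a scalar function; it is `0` if the function is not square
integrable. -/
noncomputable def cls (f : (Fin n → ℂ) → ℂ) : Lp ℂ 2 (mu lam) :=
  if h : MemLp f 2 (mu lam) then h.toLp f else 0

variable {lam}

theorem cls_coe {f : (Fin n → ℂ) → ℂ} (h : MemLp f 2 (mu lam)) : cls lam f =ᵐ[mu lam] f := by
  rw [cls, dif_pos h]; exact h.coeFn_toLp

theorem cls_add {f g : (Fin n → ℂ) → ℂ} (hf : MemLp f 2 (mu lam)) (hg : MemLp g 2 (mu lam)) :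
    cls lam (fun z => f z + g z) = cls lam f + cls lam g := by
  have h : MemLp (fun z => f z + g z) 2 (mu lam) := hf.add hg
  rw [cls, cls, cls, dif_pos hf, dif_pos hg, dif_pos h, ← MemLp.toLp_add]; rfl

theorem cls_sub {f g : (Fin n → ℂ) → ℂ} (hf : MemLp f 2 (mu lam)) (hg : MemLp g 2 (mu lam)) :
    cls lam (fun z => f z - g z) = cls lam f - cls lam g := by
  have h : MemLp (fun z => f z - g z) 2 (mu lam) := hf.sub hg
  rw [cls, cls, cls, dif_pos hf, dif_pos hg, dif_pos h, ← MemLp.toLp_sub]; rfl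

theorem cls_smul {f : (Fin n → ℂ) → ℂ} (c : ℂ) (hf : MemLp f 2 (mu lam)) :
    cls lam (fun z => c * f z) = c • cls lam f := by
  rw [cls, cls, dif_pos hf, dif_pos (hf.const_mul c), ← MemLp.toLp_const_smul]; rfl

theorem memLp_of_hasCompactSupport {f : (Fin n → ℂ) → ℂ} (hf : Continuous f)
    (hf' : HasCompactSupport f) : MemLp f 2 (mu lam) :=
  hf.memLp_of_hasCompactSupport hf'

theorem inner_cls {f : (Fin n → ℂ) → ℂ} (hf : MemLp f 2 (mu lam)) (g : Lp ℂ 2 (mu lam)) :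
    inner ℂ (cls lam f) g = ∫ z, (starRingEnd ℂ) (f z) * g z ∂(mu lam) := by
  rw [L2.inner_def]
  refine integral_congr_ae ?_
  filter_upwards [cls_coe hf] with z hz
  rw [hz, RCLike.inner_apply, mul_comm]

/-- Dominated convergence in `L²`. -/
theorem tendsto_cls {ι : Type*} {l : Filter ι} [l.IsCountablyGenerated]
    {F : ι → (Fin n → ℂ) → ℂ} {f : (Fin n → ℂ) → ℂ} {G : (Fin n → ℂ) → ℝ}
    (hG : MemLp G 2 (mu lam)) (hF : ∀ᶠ i in l, MemLp (F i) 2 (mu lam))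
    (hf : MemLp f 2 (mu lam)) (hFG : ∀ᶠ i in l, ∀ z, ‖F i z‖ ≤ G z) (hfG : ∀ z, ‖f z‖ ≤ G z)
    (hlim : ∀ z, Tendsto (fun i => F i z) l (𝓝 (f z))) :
    Tendsto (fun i => cls lam (F i)) l (𝓝 (cls lam f)) := by
  rw [tendsto_iff_norm_sub_tendsto_zero]
  have h1 : Tendsto (fun i => ∫ z, ‖F i z - f z‖ ^ 2 ∂(mu lam)) l
      (𝓝 (∫ z, (0 : ℝ) ∂(mu lam))) := by
    refine tendsto_integral_filter_of_dominated_convergence (fun z => (2 * G z) ^ 2) ?_ ?_ ?_ ?_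
    · filter_upwards [hF] with i hi
      exact ((hi.sub hf).1.norm.pow 2)
    · filter_upwards [hFG] with i hi
      refine Eventually.of_forall fun z => ?_
      rw [Real.norm_eq_abs, abs_of_nonneg (by positivity)]
      gcongr
      exact (norm_sub_le _ _).trans (by linarith [hi z, hfG z])
    · exact (hG.const_mul 2).integrable_sq
    · refine Eventually.of_forall fun z => ?_
      have := ((hlim z).sub_const (f z)).norm.pow 2
      simpa using this
  rw [integral_zero] at h1
  have h2 : Tendsto (fun i => ‖cls lam (F i) - cls lam f‖ ^ 2) l (𝓝 0) := by
    refine h1.congr' ?_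
    filter_upwards [hF] with i hi
    rw [← cls_sub hi hf]
    have h3 := inner_self_eq_norm_sq_to_K (𝕜 := ℂ) (cls lam fun z => F i z - f z)
    rw [L2.inner_def] at h3
    have h4 : ((∫ z, ‖F i z - f z‖ ^ 2 ∂(mu lam) : ℝ) : ℂ) =
        ∫ a, inner ℂ (cls lam (fun z => F i z - f z) a) (cls lam (fun z => F i z - f z) a)
          ∂(mu lam) := by
      rw [← integral_complex_ofReal]
      refine integral_congr_ae ?_
      filter_upwards [cls_coe (hi.sub hf)] with z hz
      have hz' : cls lam (fun z => F i z - f z) z = F i z - f z := hz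
      rw [hz', inner_self_eq_norm_sq_to_K]; norm_cast
    rw [h3] at h4
    exact Complex.ofReal_injective (by rw [h4]; norm_cast)
  have h5 := h2.sqrt
  simpa using h5

/-- `tens e f` is the `(0,q)`-form `f e` with a constant covector `e` and a scalar
coefficient `f`. -/
noncomputable def tens {q : ℕ} (e : Cov n q) : Lp ℂ 2 (mu lam) →L[ℂ] L2 lam q :=
  (ContinuousLinearMap.toSpanSingleton ℂ e).compLpL 2 (mu lam)

theorem tens_coe {q : ℕ} (e : Cov n q) (f : Lp ℂ 2 (mu lam)) :
    tens e f =ᵐ[mu lam] fun z => f z • e :=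
  (ContinuousLinearMap.coeFn_compLpL _ f).trans (Eventually.of_forall fun z => by simp)

theorem tens_add {q : ℕ} (e e' : Cov n q) (f : Lp ℂ 2 (mu lam)) :
    tens (e + e') f = tens e f + tens e' f := by
  refine Lp.ext ?_
  filter_upwards [tens_coe (e + e') f, tens_coe e f, tens_coe e' f,
    Lp.coeFn_add (tens e f) (tens e' f)] with z h1 h2 h3 h4
  rw [h4, h1, Pi.add_apply, h2, h3, smul_add]

theorem tens_smul {q : ℕ} (c : ℂ) (e : Cov n q) (f : Lp ℂ 2 (mu lam)) :
    tens (c • e) f = c • tens e f := by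
  refine Lp.ext ?_
  filter_upwards [tens_coe (c • e) f, tens_coe e f, Lp.coeFn_smul c (tens e f)] with z h1 h2 h4
  rw [h4, h1, Pi.smul_apply, h2, smul_comm]

theorem tens_zero {q : ℕ} (f : Lp ℂ 2 (mu lam)) : tens (0 : Cov n q) f = 0 := by
  simpa using tens_smul (0 : ℂ) (0 : Cov n q) f

theorem tens_neg {q : ℕ} (e : Cov n q) (f : Lp ℂ 2 (mu lam)) : tens (-e) f = -tens e f := by
  simpa using tens_smul (-1 : ℂ) e f

theorem inner_tens_tens {q : ℕ} (e e' : Cov n q) (f g : Lp ℂ 2 (mu lam)) :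
    inner ℂ (tens e f) (tens e' g) = inner ℂ e e' * inner ℂ f g := by
  rw [L2.inner_def, L2.inner_def, ← integral_const_mul]
  refine integral_congr_ae ?_
  filter_upwards [tens_coe e f, tens_coe e' g] with z h1 h2
  rw [h1, h2, inner_smul_left, inner_smul_right, RCLike.inner_apply]
  ring

theorem integrable_conj_smul {q : ℕ} {f : (Fin n → ℂ) → ℂ} (hf : MemLp f 2 (mu lam))
    (v : L2 lam q) :
    Integrable (fun z => ((dens lam z : ℂ) * (starRingEnd ℂ) (f z)) • v z) := by
  have h1 : Integrable (fun z => (starRingEnd ℂ) (f z) • v z) (mu lam) :=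
    memLp_one_iff_integrable.1 (MemLp.smul (p := 2) (q := 2) (r := 1) (Lp.memLp v)
      (f := fun z => v z) (φ := fun z => (starRingEnd ℂ) (f z)) hf.star)
  rw [integrable_mu_iff] at h1
  refine h1.congr (Eventually.of_forall fun z => ?_)
  simp only [mul_smul, Complex.coe_smul]

theorem inner_tens_cls {q : ℕ} (e : Cov n q) {f : (Fin n → ℂ) → ℂ} (hf : MemLp f 2 (mu lam))
    (v : L2 lam q) : inner ℂ (tens e (cls lam f)) v =
      inner ℂ e (∫ z, ((dens lam z : ℂ) * (starRingEnd ℂ) (f z)) • v z) := by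
  have hae : ∀ᵐ z ∂(mu lam), dens lam z • inner ℂ (tens e (cls lam f) z) (v z) =
      inner ℂ e (((dens lam z : ℂ) * (starRingEnd ℂ) (f z)) • v z) := by
    filter_upwards [tens_coe e (cls lam f), cls_coe hf] with z h1 h2
    rw [h1, h2, inner_smul_left, inner_smul_right, Complex.real_smul]
    ring
  rw [← integral_inner (integrable_conj_smul hf v), L2.inner_def, integral_mu]
  exact integral_congr_ae ((volume_absolutelyContinuous lam).ae_le hae)

end Measure

/-! ### The Kodaira Laplacian as an accretive graph -/

section Dbar

variable {n : ℕ} {lam : Fin n → ℝ}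

/-- Integration by parts. -/
theorem integral_mul_dzbar {χ f : (Fin n → ℂ) → ℂ} (hχ : ContDiff ℝ ∞ χ)
    (hχ' : HasCompactSupport χ) (hf : ContDiff ℝ ∞ f) (j : Fin n) :
    ∫ z, χ z * dzbar j f z = -∫ z, dzbar j χ z * f z := by
  have hdχ : ∀ v, Continuous fun z => fderiv ℝ χ z v := fun v =>
    (hχ.fderiv_right (m := ∞) le_rfl).continuous.clm_apply continuous_const
  have hdf : ∀ v, Continuous fun z => fderiv ℝ f z v := fun v =>
    (hf.fderiv_right (m := ∞) le_rfl).continuous.clm_apply continuous_const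
  have i1 : ∀ v, Integrable fun z => fderiv ℝ χ z v * f z := fun v =>
    ((hdχ v).mul hf.continuous).integrable_of_hasCompactSupport
      (HasCompactSupport.mul_right (hχ'.fderiv_apply (𝕜 := ℝ) v))
  have i2 : ∀ v, Integrable fun z => χ z * fderiv ℝ f z v := fun v =>
    (hχ.continuous.mul (hdf v)).integrable_of_hasCompactSupport hχ'.mul_right
  have key : ∀ v, ∫ z, χ z * fderiv ℝ f z v = -∫ z, fderiv ℝ χ z v * f z := fun v =>
    integral_mul_fderiv_eq_neg_fderiv_mul_of_integrable (i1 v) (i2 v)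
      ((hχ.continuous.mul hf.continuous).integrable_of_hasCompactSupport hχ'.mul_right)
      (fun x _ => hχ.differentiable (by simp) x) (fun x _ => hf.differentiable (by simp) x)
  have e1 : ∀ z, χ z * dzbar j f z = (1 / 2) * (χ z * fderiv ℝ f z (Pi.single j 1)) +
      (Complex.I / 2) * (χ z * fderiv ℝ f z (Pi.single j Complex.I)) := fun z => by
    unfold dzbar; ring
  have e2 : ∀ z, dzbar j χ z * f z = (1 / 2) * (fderiv ℝ χ z (Pi.single j 1) * f z) +
      (Complex.I / 2) * (fderiv ℝ χ z (Pi.single j Complex.I) * f z) := fun z => by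
    unfold dzbar; ring
  simp only [e1, e2]
  rw [integral_add ((i2 _).const_mul _) ((i2 _).const_mul _),
    integral_add ((i1 _).const_mul _) ((i1 _).const_mul _)]
  simp only [integral_const_mul, key]
  ring

theorem dzbar_dens (j : Fin n) (z : Fin n → ℂ) :
    dzbar j (fun z => (dens lam z : ℂ)) z = -(lam j * z j * dens lam z) := by
  have h : (fun z => (dens lam z : ℂ)) = fun z => (2 : ℂ) ^ n *
      Complex.exp (∑ i, (-lam i : ℂ) * (z i * (starRingEnd ℂ) (z i))) := by
    funext z
    have := phi_eq lam z
    simp only [dens]; push_cast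
    rw [this]; simp only [neg_mul, Finset.sum_neg_distrib]
  have hd : DifferentiableAt ℝ
      (fun z : Fin n → ℂ => ∑ i, (-lam i : ℂ) * (z i * (starRingEnd ℂ) (z i))) z :=
    DifferentiableAt.fun_sum fun i _ =>
      ((differentiableAt_coord i).fun_mul (differentiableAt_conj_coord i)).const_mul _
  have h' := congrFun h z
  rw [h', h, dzbar_mul _ (by fun_prop) hd.cexp, dzbar_const, dzbar_cexp _ hd, dzbar_quadratic]
  ring

theorem contDiff_dens_complex : ContDiff ℝ ∞ fun z => (dens lam z : ℂ) :=
  Complex.ofRealCLM.contDiff.comp (contDiff_dens lam)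

theorem dzbar_dens_mul_conj {f : (Fin n → ℂ) → ℂ} (hf : ContDiff ℝ ∞ f) (j : Fin n)
    (z : Fin n → ℂ) :
    dzbar j (fun z => (dens lam z : ℂ) * (starRingEnd ℂ) (f z)) z =
      -((dens lam z : ℂ) * (starRingEnd ℂ) (del lam j f z)) := by
  rw [dzbar_mul _ (contDiff_dens_complex.differentiable (by simp) z)
    ((contDiff_conj hf).differentiable (by simp) z), dzbar_dens, dzbar_conj]
  simp only [del, map_add, map_neg, map_mul, Complex.conj_ofReal, Complex.conj_conj]
  ring

/-- Smooth functions with compact support. -/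
def IsTest (f : (Fin n → ℂ) → ℂ) : Prop := ContDiff ℝ ∞ f ∧ HasCompactSupport f

theorem IsTest.memLp {f : (Fin n → ℂ) → ℂ} (hf : IsTest f) : MemLp f 2 (mu lam) :=
  memLp_of_hasCompactSupport hf.1.continuous hf.2

theorem IsTest.del {f : (Fin n → ℂ) → ℂ} (hf : IsTest f) (j : Fin n) :
    IsTest (del lam j f) := ⟨contDiff_del lam hf.1 j, hasCompactSupport_del lam hf.2 j⟩

/-- The maximal extension of `∂̄` is the Hilbert space adjoint of the formal adjoint of `∂̄` on
test forms. -/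
theorem isDbar_iff {p p' : ℕ} (u : L2 lam p) (v : L2 lam p') :
    IsDbar u v ↔ ∀ f : (Fin n → ℂ) → ℂ, IsTest f → ∀ e : Cov n p',
      inner ℂ (tens e (cls lam f)) v =
        ∑ j, inner ℂ (tens (contract j p' p e) (cls lam (del lam j f))) u := by
  have key : ∀ f : (Fin n → ℂ) → ℂ, IsTest f → ∀ e : Cov n p',
      ∑ j, inner ℂ (tens (contract j p' p e) (cls lam (del lam j f))) u = inner ℂ e
        (-∫ z, ∑ j, dzbar j (fun z => (dens lam z : ℂ) * (starRingEnd ℂ) (f z)) z •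
          wedge j p p' (u z)) := by
    intro f hf e
    have hI := fun j => integrable_conj_smul (hf.del (lam := lam) j).memLp u
    have h1 : ∀ j z, dzbar j (fun z => (dens lam z : ℂ) * (starRingEnd ℂ) (f z)) z •
        wedge j p p' (u z) =
        -wedge j p p' (((dens lam z : ℂ) * (starRingEnd ℂ) (del lam j f z)) • u z) := by
      intro j z
      rw [dzbar_dens_mul_conj hf.1, neg_smul, map_smul]
    simp only [h1, Finset.sum_neg_distrib]
    rw [integral_neg, neg_neg,
      integral_finsetSum _ fun j _ => (wedge j p p').integrable_comp (hI j), inner_sum]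
    refine Finset.sum_congr rfl fun j _ => ?_
    rw [inner_tens_cls _ (hf.del j).memLp, inner_contract,
      ContinuousLinearMap.integral_comp_comm _ (hI j)]
  constructor
  · intro h f hf e
    rw [key f hf e, inner_tens_cls _ hf.memLp]
    congr 1
    exact h _ (contDiff_dens_complex.mul (contDiff_conj hf.1))
      ((hf.2.comp_left (g := starRingEnd ℂ) (map_zero _)).mul_left)
  · intro h χ hχ hχ'
    have hf : IsTest (fun z => (starRingEnd ℂ) (χ z) * ((dens lam z)⁻¹ : ℝ)) :=
      ⟨(contDiff_conj hχ).mul (Complex.ofRealCLM.contDiff.comp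
        ((contDiff_dens lam).inv fun z => (dens_pos lam z).ne')),
        (hχ'.comp_left (g := starRingEnd ℂ) (map_zero _)).mul_right⟩
    have e1 : (fun z => (dens lam z : ℂ) *
        (starRingEnd ℂ) ((starRingEnd ℂ) (χ z) * ((dens lam z)⁻¹ : ℝ))) = χ := by
      funext z
      have := Complex.ofReal_ne_zero.2 (dens_pos lam z).ne'
      rw [map_mul, Complex.conj_conj, Complex.conj_ofReal, Complex.ofReal_inv]
      field_simp
    refine ext_inner_left ℂ fun e => ?_
    have h1 := h _ hf e
    rw [key _ hf, inner_tens_cls _ hf.memLp, e1] at h1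
    have e2 : ∀ z, (dens lam z : ℂ) *
        (starRingEnd ℂ) ((starRingEnd ℂ) (χ z) * ((dens lam z)⁻¹ : ℝ)) = χ z := congrFun e1
    simp only [e2] at h1
    exact h1

theorem IsDbar.add {p p' : ℕ} {u u' : L2 lam p} {v v' : L2 lam p'} (h : IsDbar u v)
    (h' : IsDbar u' v') : IsDbar (u + u') (v + v') := by
  rw [isDbar_iff] at *
  intro f hf e
  simp only [inner_add_right, Finset.sum_add_distrib, h f hf e, h' f hf e]

theorem IsDbar.smul {p p' : ℕ} {u : L2 lam p} {v : L2 lam p'} (c : ℂ) (h : IsDbar u v) :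
    IsDbar (c • u) (c • v) := by
  rw [isDbar_iff] at *
  intro f hf e
  simp only [inner_smul_right, ← Finset.mul_sum, h f hf e]

theorem IsDbar.zero {p p' : ℕ} : IsDbar (0 : L2 lam p) (0 : L2 lam p') := by
  rw [isDbar_iff]; simp

theorem IsDbar.sub {p p' : ℕ} {u u' : L2 lam p} {v v' : L2 lam p'} (h : IsDbar u v)
    (h' : IsDbar u' v') : IsDbar (u - u') (v - v') := by
  simpa [sub_eq_add_neg] using h.add (h'.smul (-1))

theorem isClosed_isDbar {p p' : ℕ} :
    IsClosed {x : L2 lam p × L2 lam p' | IsDbar x.1 x.2} := by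
  simp only [isDbar_iff, Set.ofPred_forall]
  refine isClosed_iInter fun f => isClosed_iInter fun hf => isClosed_iInter fun e =>
    isClosed_eq (by fun_prop) (by fun_prop)

/-- `∂̄ ∂̄ = 0`. -/
theorem IsDbar.isDbar_zero {p p' p'' : ℕ} {u : L2 lam p} {v : L2 lam p'} (h : IsDbar u v) :
    IsDbar v (0 : L2 lam p'') := by
  rw [isDbar_iff] at *
  intro f hf e
  rw [inner_zero_right]
  simp only [h _ (hf.del _)]
  have hswap : ∀ j k : Fin n, inner ℂ (tens (contract k p' p (contract j p'' p' e))
      (cls lam (del lam k (del lam j f)))) u = -inner ℂ (tens (contract j p' p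
        (contract k p'' p' e)) (cls lam (del lam j (del lam k f)))) u := by
    intro j k
    rw [contract_contract, tens_neg, inner_neg_left, del_comm lam hf.1]
  have h2 : ∑ j, ∑ k, inner ℂ (tens (contract k p' p (contract j p'' p' e))
      (cls lam (del lam k (del lam j f)))) u = -∑ j, ∑ k, inner ℂ (tens (contract k p' p
        (contract j p'' p' e)) (cls lam (del lam k (del lam j f)))) u := by
    conv_lhs => rw [Finset.sum_comm]
    simp only [← Finset.sum_neg_distrib]
    exact Finset.sum_congr rfl fun k _ => Finset.sum_congr rfl fun j _ => hswap j k
  symm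
  exact self_eq_neg.1 h2

theorem IsDbarStar.add {p p' : ℕ} {v v' : L2 lam p'} {w w' : L2 lam p} (h : IsDbarStar v w)
    (h' : IsDbarStar v' w') : IsDbarStar (v + v') (w + w') := fun u u' hu => by
  rw [inner_add_right, inner_add_right, h u u' hu, h' u u' hu]

theorem IsDbarStar.smul {p p' : ℕ} {v : L2 lam p'} {w : L2 lam p} (c : ℂ) (h : IsDbarStar v w) :
    IsDbarStar (c • v) (c • w) := fun u u' hu => by
  rw [inner_smul_right, inner_smul_right, h u u' hu]

theorem IsDbarStar.zero {p p' : ℕ} : IsDbarStar (0 : L2 lam p') (0 : L2 lam p) := fun u u' _ => by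
  simp

theorem IsDbarStar.sub {p p' : ℕ} {v v' : L2 lam p'} {w w' : L2 lam p} (h : IsDbarStar v w)
    (h' : IsDbarStar v' w') : IsDbarStar (v - v') (w - w') := by
  simpa [sub_eq_add_neg] using h.add (h'.smul (-1))

theorem isClosed_isDbarStar {p p' : ℕ} :
    IsClosed {x : L2 lam p' × L2 lam p | IsDbarStar x.1 x.2} := by
  simp only [IsDbarStar, Set.ofPred_forall]
  refine isClosed_iInter fun u => isClosed_iInter fun u' => isClosed_iInter fun hu =>
    isClosed_eq (by fun_prop) (by fun_prop)

/-- `del lam j` is the formal adjoint of `∂/∂z̄_j` in the weighted `L²` space. -/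
theorem inner_cls_dzbar {f g : (Fin n → ℂ) → ℂ} (hg : IsTest g) (hf : ContDiff ℝ ∞ f)
    (hfL : MemLp f 2 (mu lam)) (j : Fin n) (hd : MemLp (dzbar j f) 2 (mu lam)) :
    inner ℂ (cls lam g) (cls lam (dzbar j f)) = inner ℂ (cls lam (del lam j g)) (cls lam f) := by
  have h1 : ∀ {a b : (Fin n → ℂ) → ℂ}, MemLp a 2 (mu lam) → MemLp b 2 (mu lam) →
      inner ℂ (cls lam a) (cls lam b) =
        ∫ z, ((dens lam z : ℂ) * (starRingEnd ℂ) (a z)) * b z := by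
    intro a b ha hb
    rw [inner_cls ha]
    have : ∫ z, (starRingEnd ℂ) (a z) * cls lam b z ∂(mu lam) =
        ∫ z, (starRingEnd ℂ) (a z) * b z ∂(mu lam) := by
      refine integral_congr_ae ?_
      filter_upwards [cls_coe hb] with z hz
      rw [hz]
    rw [this, integral_mu]
    simp only [Complex.real_smul, mul_assoc]
  rw [h1 hg.memLp hd, h1 (hg.del j).memLp hfL,
    integral_mul_dzbar (contDiff_dens_complex.mul (contDiff_conj hg.1))
      ((hg.2.comp_left (g := starRingEnd ℂ) (map_zero _)).mul_left) hf]
  simp only [dzbar_dens_mul_conj hg.1, neg_mul, integral_neg, neg_neg]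

/-- For smooth forms the maximal extension of `∂̄` is given by differentiation. -/
theorem isDbar_tens {p p' : ℕ} {f : (Fin n → ℂ) → ℂ} (hf : ContDiff ℝ ∞ f)
    (hfL : MemLp f 2 (mu lam)) (hd : ∀ j, MemLp (dzbar j f) 2 (mu lam)) (e : Cov n p) :
    IsDbar (tens e (cls lam f)) (∑ j, tens (wedge j p p' e) (cls lam (dzbar j f))) := by
  rw [isDbar_iff]
  intro g hg e'
  rw [inner_sum]
  refine Finset.sum_congr rfl fun j _ => ?_
  rw [inner_tens_tens, inner_tens_tens, inner_contract, inner_cls_dzbar hg hf hfL j (hd j)]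

/-- Bounded test functions that tend to `1`, with bounded derivatives that tend to `0`. -/
theorem exists_cutoff (n : ℕ) : ∃ (η : ℕ → (Fin n → ℂ) → ℂ) (C : ℝ),
    (∀ k, IsTest (η k)) ∧ (∀ k z, ‖η k z‖ ≤ 1) ∧ (∀ z, Tendsto (fun k => η k z) atTop (𝓝 1)) ∧
    0 ≤ C ∧ (∀ k j z, ‖dz j (η k) z‖ ≤ C) ∧
    ∀ j z, Tendsto (fun k => dz j (η k) z) atTop (𝓝 0) := by
  let b : ContDiffBump (0 : Fin n → ℂ) := ⟨1, 2, one_pos, one_lt_two⟩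
  let β : (Fin n → ℂ) → ℂ := fun z => (b z : ℂ)
  have hβ : ContDiff ℝ ∞ β := Complex.ofRealCLM.contDiff.comp b.contDiff
  have hβc : HasCompactSupport β := b.hasCompactSupport.comp_left (g := Complex.ofReal) (by simp)
  have hbound : ∃ C : ℝ, ∀ z, ‖fderiv ℝ β z‖ ≤ C :=
    (hβ.continuous_fderiv (by simp)).bounded_above_of_compact_support (hβc.fderiv (𝕜 := ℝ))
  obtain ⟨C, hC⟩ := hbound
  have hC0 : 0 ≤ C := (norm_nonneg _).trans (hC 0)
  let r : ℕ → ℝ := fun k => ((k : ℝ) + 1)⁻¹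
  have hr : ∀ k, 0 < r k := fun k => by positivity
  have hr1 : ∀ k, r k ≤ 1 := fun k => inv_le_one_of_one_le₀ (by simp)
  have hrlim : Tendsto r atTop (𝓝 0) := by
    have := tendsto_one_div_add_atTop_nhds_zero_nat (𝕜 := ℝ)
    simpa [r] using this
  have hdz : ∀ k j z, ‖dz j (fun z => β (r k • z)) z‖ ≤ r k * C := by
    intro k j z
    have h1 : fderiv ℝ (fun z => β (r k • z)) z = r k • fderiv ℝ β (r k • z) := by
      have h2 : HasFDerivAt (fun z : Fin n → ℂ => r k • z)
          (r k • ContinuousLinearMap.id ℝ (Fin n → ℂ)) z := (hasFDerivAt_id z).const_smul (r k)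
      have h3 := (((hβ.differentiable (by simp)) (r k • z)).hasFDerivAt.comp z h2).fderiv
      have h4 : fderiv ℝ (fun z => β (r k • z)) z = _ := h3
      rw [h4]; ext v; simp
    have h2 : ∀ c : ℂ, ‖c‖ = 1 → ‖fderiv ℝ (fun z => β (r k • z)) z (Pi.single j c)‖ ≤ r k * C := by
      intro c hc
      rw [h1, smul_apply, norm_smul, Real.norm_eq_abs, abs_of_pos (hr k)]
      refine mul_le_mul_of_nonneg_left ?_ (hr k).le
      refine ((fderiv ℝ β (r k • z)).le_of_opNorm_le (hC _) _).trans ?_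
      rw [Pi.norm_single, hc, mul_one]
    rw [dz, norm_mul]
    have h3 := norm_sub_le (fderiv ℝ (fun z => β (r k • z)) z (Pi.single j 1))
      (Complex.I * fderiv ℝ (fun z => β (r k • z)) z (Pi.single j Complex.I))
    rw [norm_mul, Complex.norm_I, one_mul] at h3
    have h4 := h2 1 (by simp)
    have h5 := h2 Complex.I (by simp)
    have h6 : ‖(1 / 2 : ℂ)‖ = 1 / 2 := by norm_num
    rw [h6]; linarith
  refine ⟨fun k z => β (r k • z), C, fun k => ⟨hβ.comp (contDiff_const_smul (r k)),
    hβc.comp_smul (hr k).ne'⟩, fun k z => ?_, fun z => ?_, hC0, fun k j z => ?_, fun j z => ?_⟩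
  · simp only [β, Complex.norm_real, Real.norm_eq_abs, abs_of_nonneg b.nonneg]
    exact b.le_one
  · have h1 : Tendsto (fun k => r k • z) atTop (𝓝 ((0 : ℝ) • z)) := hrlim.smul_const z
    rw [zero_smul] at h1
    have h2 := (hβ.continuous.tendsto 0).comp h1
    have h3 : β 0 = 1 := by
      have : b 0 = 1 := b.one_of_mem_closedBall (by simp [b])
      simp [β, this]
    rwa [h3] at h2
  · exact (hdz k j z).trans (mul_le_of_le_one_left hC0 (hr1 k))
  · refine squeeze_zero_norm (fun k => hdz k j z) ?_
    simpa using hrlim.mul_const C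

/-- For smooth forms the adjoint of the maximal extension of `∂̄` is given by differentiation; no
compactness of the support is needed, since the forms can be cut off. -/
theorem isDbarStar_tens {p p' : ℕ} {f : (Fin n → ℂ) → ℂ} (hf : ContDiff ℝ ∞ f)
    (hfL : MemLp f 2 (mu lam)) (hd : ∀ j, MemLp (del lam j f) 2 (mu lam)) (e : Cov n p') :
    IsDbarStar (tens e (cls lam f)) (∑ j, tens (contract j p' p e) (cls lam (del lam j f))) := by
  intro u u' hu
  rw [isDbar_iff] at hu
  obtain ⟨η, C, hη, hη1, hηlim, hC, hdη, hdηlim⟩ := exists_cutoff n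
  have hT : ∀ k, IsTest fun z => η k z * f z := fun k =>
    ⟨(hη k).1.mul hf, (hη k).2.mul_right⟩
  have hdel : ∀ k j z, del lam j (fun z => η k z * f z) z =
      η k z * del lam j f z - dz j (η k) z * f z := by
    intro k j z
    rw [del, dz_mul _ ((hη k).1.differentiable (by simp) z) (hf.differentiable (by simp) z), del]
    ring
  have h1 : Tendsto (fun k => cls lam fun z => η k z * f z) atTop (𝓝 (cls lam f)) := by
    refine tendsto_cls hfL.norm (Eventually.of_forall fun k => (hT k).memLp) hfL
      (Eventually.of_forall fun k z => ?_) (fun z => le_rfl) fun z => ?_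
    · rw [norm_mul]; exact mul_le_of_le_one_left (norm_nonneg _) (hη1 k z)
    · simpa using (hηlim z).mul_const (f z)
  have h2 : ∀ j, Tendsto (fun k => cls lam (del lam j fun z => η k z * f z)) atTop
      (𝓝 (cls lam (del lam j f))) := by
    intro j
    refine tendsto_cls (G := fun z => ‖del lam j f z‖ + C * ‖f z‖)
      ((hd j).norm.add (hfL.norm.const_mul C))
      (Eventually.of_forall fun k => ((hT k).del j).memLp) (hd j)
      (Eventually.of_forall fun k z => ?_) (fun z => ?_) fun z => ?_
    · rw [hdel]
      refine (norm_sub_le _ _).trans (add_le_add ?_ ?_)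
      · rw [norm_mul]; exact mul_le_of_le_one_left (norm_nonneg _) (hη1 k z)
      · rw [norm_mul]; exact mul_le_mul_of_nonneg_right (hdη k j z) (norm_nonneg _)
    · exact le_add_of_nonneg_right (by positivity)
    · simp only [hdel]
      simpa using ((hηlim z).mul_const (del lam j f z)).sub ((hdηlim j z).mul_const (f z))
  have h3 : Tendsto (fun k => inner ℂ (tens e (cls lam fun z => η k z * f z)) u') atTop
      (𝓝 (inner ℂ (tens e (cls lam f)) u')) :=
    (((tens e).continuous.tendsto _).comp h1).inner tendsto_const_nhds
  have h4 : Tendsto (fun k => ∑ j, inner ℂ (tens (contract j p' p e)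
      (cls lam (del lam j fun z => η k z * f z))) u) atTop
      (𝓝 (∑ j, inner ℂ (tens (contract j p' p e) (cls lam (del lam j f))) u)) :=
    tendsto_finsetSum _ fun j _ =>
      (((tens (contract j p' p e)).continuous.tendsto _).comp (h2 j)).inner tendsto_const_nhds
  have h5 := tendsto_nhds_unique h3 (h4.congr fun k => (hu _ (hT k) e).symm)
  rw [← inner_conj_symm, h5, map_sum, inner_sum]
  simp only [inner_conj_symm]

end Dbar

section Box

variable {n : ℕ} {lam : Fin n → ℝ} {q : ℕ}

theorem cauchySeq_of_norm_sub_le {E F : Type*} [NormedAddCommGroup E] [NormedAddCommGroup F]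
    {x : ℕ → E} {y : ℕ → F} (hy : CauchySeq y) (h : ∀ k m, ‖x k - x m‖ ≤ ‖y k - y m‖) :
    CauchySeq x := by
  rw [Metric.cauchySeq_iff] at *
  intro ε hε
  obtain ⟨N, hN⟩ := hy ε hε
  refine ⟨N, fun k hk m hm => ?_⟩
  have := hN k hk m hm
  rw [dist_eq_norm] at *
  exact (h k m).trans_lt this

/-- The Gaffney extension of the Kodaira Laplacian is nonnegative and closed. Closedness holds
because all terms in the definition are controlled by `u` and `□u`:
`(□u, u) = ‖∂̄u‖² + ‖∂̄^*u‖²` and, by `∂̄∂̄ = 0`, `‖□u‖² = ‖∂̄^*∂̄u‖² + ‖∂̄∂̄^*u‖²`. -/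
theorem isAccretiveGraph_isBox : IsAccretiveGraph (IsBox (lam := lam) (q := q)) where
  zero := ⟨0, 0, 0, 0, IsDbar.zero, IsDbarStar.zero, IsDbarStar.zero, IsDbar.zero, by simp⟩
  add := by
    rintro u f u' f' ⟨v, w, a, b, h1, h2, h3, h4, rfl⟩ ⟨v', w', a', b', h1', h2', h3', h4', rfl⟩
    exact ⟨v + v', w + w', a + a', b + b', h1.add h1', h2.add h2', h3.add h3', h4.add h4',
      add_add_add_comm _ _ _ _⟩
  smul := by
    rintro c u f ⟨v, w, a, b, h1, h2, h3, h4, rfl⟩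
    exact ⟨c • v, c • w, c • a, c • b, h1.smul c, h2.smul c, h3.smul c, h4.smul c, smul_add _ _ _⟩
  accretive := by
    rintro u f ⟨v, w, a, b, h1, h2, h3, h4, rfl⟩
    rw [inner_add_right, ← h2 u v h1, ← inner_conj_symm u b, h3 w b h4, Complex.add_re,
      Complex.conj_re]
    exact add_nonneg (inner_self_nonneg (𝕜 := ℂ)) (inner_self_nonneg (𝕜 := ℂ))
  closed := by
    have est : ∀ {u : L2 lam q} {v : L2 lam (q + 1)} {w : L2 lam (q - 1)} {a b : L2 lam q},
        IsDbar u v → IsDbarStar v a → IsDbarStar u w → IsDbar w b →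
        ‖v‖ ≤ ‖(u, a + b)‖ ∧ ‖w‖ ≤ ‖(u, a + b)‖ ∧ ‖a‖ ≤ ‖(u, a + b)‖ ∧ ‖b‖ ≤ ‖(u, a + b)‖ := by
      intro u v w a b h1 h2 h3 h4
      have e1 : ‖v‖ ^ 2 + ‖w‖ ^ 2 ≤ ‖(u, a + b)‖ ^ 2 := by
        have e2 : ((‖v‖ ^ 2 + ‖w‖ ^ 2 : ℝ) : ℂ) = inner ℂ u (a + b) := by
          rw [inner_add_right, ← h2 u v h1, ← inner_conj_symm u b, h3 w b h4, inner_conj_symm,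
            inner_self_eq_norm_sq_to_K, inner_self_eq_norm_sq_to_K]
          push_cast; rfl
        have e3 : ‖v‖ ^ 2 + ‖w‖ ^ 2 ≤ ‖u‖ * ‖a + b‖ := by
          have := norm_inner_le_norm (𝕜 := ℂ) u (a + b)
          rw [← e2, Complex.norm_real, Real.norm_eq_abs, abs_of_nonneg (by positivity)] at this
          exact this
        rw [Prod.norm_mk]
        have := mul_le_mul (le_max_left ‖u‖ ‖a + b‖) (le_max_right ‖u‖ ‖a + b‖) (norm_nonneg _)
          ((norm_nonneg _).trans (le_max_left ‖u‖ ‖a + b‖))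
        nlinarith
      have e4 : inner ℂ a b = 0 := by
        have := h2 b 0 h4.isDbar_zero
        rw [inner_zero_left] at this
        rw [← inner_conj_symm, ← this, map_zero]
      have e5 : ‖a + b‖ ^ 2 = ‖a‖ ^ 2 + ‖b‖ ^ 2 := by
        simpa only [sq] using norm_add_sq_eq_norm_sq_add_norm_sq_of_inner_eq_zero (𝕜 := ℂ) a b e4
      have e6 : ‖a + b‖ ≤ ‖(u, a + b)‖ := norm_snd_le (u, a + b)
      have e7 := norm_nonneg (u, a + b)
      refine ⟨?_, ?_, ?_, ?_⟩
      · exact abs_le_of_sq_le_sq' (by nlinarith [sq_nonneg ‖w‖]) e7 |>.2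
      · exact abs_le_of_sq_le_sq' (by nlinarith [sq_nonneg ‖v‖]) e7 |>.2
      · refine le_trans ?_ e6
        exact abs_le_of_sq_le_sq' (by nlinarith [sq_nonneg ‖b‖]) (norm_nonneg _) |>.2
      · refine le_trans ?_ e6
        exact abs_le_of_sq_le_sq' (by nlinarith [sq_nonneg ‖a‖]) (norm_nonneg _) |>.2
    refine IsSeqClosed.isClosed fun x p hx hp => ?_
    choose v w a b h1 h2 h3 h4 h5 using hx
    have hc : CauchySeq x := hp.cauchySeq
    have est' : ∀ k m, ‖v k - v m‖ ≤ ‖x k - x m‖ ∧ ‖w k - w m‖ ≤ ‖x k - x m‖ ∧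
        ‖a k - a m‖ ≤ ‖x k - x m‖ ∧ ‖b k - b m‖ ≤ ‖x k - x m‖ := by
      intro k m
      have := est ((h1 k).sub (h1 m)) ((h2 k).sub (h2 m)) ((h3 k).sub (h3 m)) ((h4 k).sub (h4 m))
      have e : ((x k).1 - (x m).1, a k - a m + (b k - b m)) = x k - x m := by
        refine Prod.ext rfl ?_
        rw [Prod.snd_sub, h5, h5]; exact sub_add_sub_comm _ _ _ _
      rwa [e] at this
    obtain ⟨v₀, hv⟩ := cauchySeq_tendsto_of_complete
      (cauchySeq_of_norm_sub_le hc fun k m => (est' k m).1)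
    obtain ⟨w₀, hw⟩ := cauchySeq_tendsto_of_complete
      (cauchySeq_of_norm_sub_le hc fun k m => (est' k m).2.1)
    obtain ⟨a₀, ha⟩ := cauchySeq_tendsto_of_complete
      (cauchySeq_of_norm_sub_le hc fun k m => (est' k m).2.2.1)
    obtain ⟨b₀, hb⟩ := cauchySeq_tendsto_of_complete
      (cauchySeq_of_norm_sub_le hc fun k m => (est' k m).2.2.2)
    have hp1 : Tendsto (fun k => (x k).1) atTop (𝓝 p.1) := (continuous_fst.tendsto p).comp hp
    have hp2 : Tendsto (fun k => (x k).2) atTop (𝓝 p.2) := (continuous_snd.tendsto p).comp hp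
    exact ⟨v₀, w₀, a₀, b₀,
      isClosed_isDbar.mem_of_tendsto (hp1.prodMk_nhds hv) (Eventually.of_forall h1),
      isClosed_isDbarStar.mem_of_tendsto (hv.prodMk_nhds ha) (Eventually.of_forall h2),
      isClosed_isDbarStar.mem_of_tendsto (hp1.prodMk_nhds hw) (Eventually.of_forall h3),
      isClosed_isDbar.mem_of_tendsto (hw.prodMk_nhds hb) (Eventually.of_forall h4),
      tendsto_nhds_unique hp2 ((ha.add hb).congr fun k => (h5 k).symm)⟩

end Box

/-! ### Gaussians -/

section FourierUniqueness

variable {E : Type*} [NormedAddCommGroup E] [NormedSpace ℝ E] [MeasurableSpace E] [BorelSpace E]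
  [SecondCountableTopology E] [CompleteSpace E] {ν : Measure E} [SigmaFinite ν]

theorem ae_eq_zero_of_charFun_eq_zero_real {f : E → ℝ} (hf : Integrable f ν)
    (h : ∀ L : StrongDual ℝ E, ∫ x, (f x : ℂ) * Complex.exp (L x * Complex.I) ∂ν = 0) :
    f =ᵐ[ν] 0 := by
  have hm : AEMeasurable f ν := hf.1.aemeasurable
  have : IsFiniteMeasure (ν.withDensity fun x => ENNReal.ofReal (f x)) :=
    isFiniteMeasure_withDensity_ofReal hf.2
  have : IsFiniteMeasure (ν.withDensity fun x => ENNReal.ofReal (-f x)) :=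
    isFiniteMeasure_withDensity_ofReal hf.neg.2
  have hchar : ∀ (g : E → ℝ), AEMeasurable g ν → ∀ L : StrongDual ℝ E,
      charFunDual (ν.withDensity fun x => ENNReal.ofReal (g x)) L =
        ∫ x, ((max (g x) 0 : ℝ) : ℂ) * Complex.exp (L x * Complex.I) ∂ν := by
    intro g hg L
    rw [charFunDual_apply, integral_withDensity_eq_integral_toReal_smul₀ hg.ennreal_ofReal
      (Eventually.of_forall fun _ => ENNReal.ofReal_lt_top)]
    refine integral_congr_ae (Eventually.of_forall fun x => ?_)
    simp only [ENNReal.toReal_ofReal', Complex.real_smul]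
  have hint : ∀ g : E → ℝ, Integrable g ν → ∀ L : StrongDual ℝ E,
      Integrable (fun x => ((g x : ℝ) : ℂ) * Complex.exp (L x * Complex.I)) ν := by
    intro g hg L
    refine hg.ofReal.mul_bdd (c := 1) ?_ (Eventually.of_forall fun x => ?_)
    · exact (Complex.continuous_exp.comp ((Complex.continuous_ofReal.comp L.continuous).mul
        continuous_const)).aestronglyMeasurable
    · rw [Complex.norm_exp_ofReal_mul_I]
  have heq : (ν.withDensity fun x => ENNReal.ofReal (f x)) =
      ν.withDensity fun x => ENNReal.ofReal (-f x) := by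
    refine Measure.ext_of_charFunDual (funext fun L => ?_)
    rw [hchar f hm, hchar (fun x => -f x) hm.neg, ← sub_eq_zero,
      ← integral_sub (hint _ hf.pos_part L) (hint _ hf.neg_part L), ← h L]
    refine integral_congr_ae (Eventually.of_forall fun x => ?_)
    simp only [← sub_mul, ← Complex.ofReal_sub]
    congr 2
    rcases le_total (f x) 0 with h0 | h0
    · rw [max_eq_right h0, max_eq_left (by linarith)]; ring
    · rw [max_eq_left h0, max_eq_right (by linarith)]; ring
  have hm' : AEMeasurable (fun x => -f x) ν := hm.neg
  rw [withDensity_eq_iff_of_sigmaFinite hm.ennreal_ofReal hm'.ennreal_ofReal] at heq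
  filter_upwards [heq] with x hx
  rcases le_total (f x) 0 with h0 | h0
  · rw [ENNReal.ofReal_of_nonpos h0, eq_comm, ENNReal.ofReal_eq_zero] at hx
    exact le_antisymm h0 (neg_nonpos.1 hx)
  · rw [ENNReal.ofReal_of_nonpos (by linarith : -f x ≤ 0), ENNReal.ofReal_eq_zero] at hx
    exact le_antisymm hx h0

/-- An integrable function whose Fourier transform vanishes is zero. -/
theorem ae_eq_zero_of_charFun_eq_zero {f : E → ℂ} (hf : Integrable f ν)
    (h : ∀ L : StrongDual ℝ E, ∫ x, f x * Complex.exp (L x * Complex.I) ∂ν = 0) :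
    f =ᵐ[ν] 0 := by
  have hint : ∀ {g : E → ℂ}, Integrable g ν → ∀ L : StrongDual ℝ E,
      Integrable (fun x => g x * Complex.exp (L x * Complex.I)) ν := by
    intro g hg L
    refine hg.mul_bdd (c := 1) ?_ (Eventually.of_forall fun x => ?_)
    · exact (Complex.continuous_exp.comp ((Complex.continuous_ofReal.comp L.continuous).mul
        continuous_const)).aestronglyMeasurable
    · rw [Complex.norm_exp_ofReal_mul_I]
  have hconj : ∀ L : StrongDual ℝ E,
      ∫ x, (starRingEnd ℂ) (f x) * Complex.exp (L x * Complex.I) ∂ν = 0 := by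
    intro L
    have h1 := congrArg (starRingEnd ℂ) (h (-L))
    rw [← integral_conj, map_zero] at h1
    rw [← h1]
    refine integral_congr_ae (Eventually.of_forall fun x => ?_)
    simp [← Complex.exp_conj]
  have hfc : Integrable (fun x => (starRingEnd ℂ) (f x)) ν :=
    (Complex.conjCLE : ℂ →L[ℝ] ℂ).integrable_comp hf
  have hre := ae_eq_zero_of_charFun_eq_zero_real (f := fun x => (f x).re) hf.re fun L => by
    have e : ∀ x, ((f x).re : ℂ) * Complex.exp (L x * Complex.I) =
        (1 / 2) * (f x * Complex.exp (L x * Complex.I) +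
          (starRingEnd ℂ) (f x) * Complex.exp (L x * Complex.I)) := fun x => by
      rw [Complex.re_eq_add_conj]; ring
    simp only [e]
    rw [integral_const_mul, integral_add (hint hf L) (hint hfc L), h L, hconj L]; simp
  have him := ae_eq_zero_of_charFun_eq_zero_real (f := fun x => (f x).im) hf.im fun L => by
    have e : ∀ x, ((f x).im : ℂ) * Complex.exp (L x * Complex.I) =
        (1 / (2 * Complex.I)) * (f x * Complex.exp (L x * Complex.I) -
          (starRingEnd ℂ) (f x) * Complex.exp (L x * Complex.I)) := fun x => by
      rw [Complex.im_eq_sub_conj]; ring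
    simp only [e]
    rw [integral_const_mul, integral_sub (hint hf L) (hint hfc L), h L, hconj L]; simp
  filter_upwards [hre, him] with x h1 h2
  exact Complex.ext h1 h2

end FourierUniqueness

section GaussianIntegral

/-- The Gaussian integral over the complex plane. -/
theorem integrable_and_integral_gauss {p : ℝ} (hp : 0 < p) (B C : ℂ) :
    Integrable (fun w : ℂ =>
      Complex.exp (-(p : ℂ) * (w * (starRingEnd ℂ) w) + B * w + C * (starRingEnd ℂ) w)) ∧
    ∫ w : ℂ, Complex.exp (-(p : ℂ) * (w * (starRingEnd ℂ) w) + B * w + C * (starRingEnd ℂ) w) =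
      Real.pi / p * Complex.exp (B * C / p) := by
  have hre : ((-p : ℂ)).re < 0 := by simpa using hp
  have hp0 : (p : ℂ) ≠ 0 := by exact_mod_cast hp.ne'
  have hpi : (Real.pi / p : ℂ) ≠ 0 := div_ne_zero (by exact_mod_cast Real.pi_ne_zero) hp0
  have e : ∀ x : ℝ × ℝ, Complex.exp (-(p : ℂ) * (Complex.measurableEquivRealProd.symm x *
      (starRingEnd ℂ) (Complex.measurableEquivRealProd.symm x)) +
      B * Complex.measurableEquivRealProd.symm x +
      C * (starRingEnd ℂ) (Complex.measurableEquivRealProd.symm x)) =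
      Complex.exp (-p * x.1 ^ 2 + (B + C) * x.1 + 0) *
        Complex.exp (-p * x.2 ^ 2 + (Complex.I * (B - C)) * x.2 + 0) := by
    intro x
    have h1 : Complex.measurableEquivRealProd.symm x = x.1 + x.2 * Complex.I := by
      apply Complex.ext <;> simp [Complex.measurableEquivRealProd]
    rw [h1, ← Complex.exp_add]
    congr 1
    simp only [map_add, map_mul, Complex.conj_ofReal, Complex.conj_I]
    ring_nf
    rw [Complex.I_sq]
    ring
  have hmp := Complex.volume_preserving_equiv_real_prod.symm
  constructor
  · rw [← hmp.integrable_comp_emb (MeasurableEquiv.measurableEmbedding _)]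
    refine ((integrable_cexp_quadratic' hre (B + C) 0).mul_prod
      (integrable_cexp_quadratic' hre (Complex.I * (B - C)) 0)).congr
      (Eventually.of_forall fun x => (e x).symm)
  · rw [← hmp.integral_comp (MeasurableEquiv.measurableEmbedding _)]
    simp only [e]
    rw [Measure.volume_eq_prod, integral_prod_mul
      (fun x : ℝ => Complex.exp (-p * x ^ 2 + (B + C) * x + 0))
      (fun x : ℝ => Complex.exp (-p * x ^ 2 + (Complex.I * (B - C)) * x + 0)), integral_cexp_quadratic hre,
      integral_cexp_quadratic hre]
    have h2 : ((Real.pi : ℂ) / - -(p : ℂ)) ^ (1 / 2 : ℂ) * (Real.pi / - -(p : ℂ)) ^ (1 / 2 : ℂ) =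
        Real.pi / p := by
      rw [neg_neg, ← Complex.cpow_add _ _ hpi]; norm_num
    rw [mul_mul_mul_comm, h2, ← Complex.exp_add]
    congr 2
    field_simp
    ring_nf
    rw [Complex.I_sq]
    ring

end GaussianIntegral

section Gauss

variable {n : ℕ}

/-- The Gaussian `exp ∑_j (-a_j |z_j|² + b_j z_j + c_j z̄_j)`. -/
noncomputable def gauss (a : Fin n → ℝ) (b c : Fin n → ℂ) (z : Fin n → ℂ) : ℂ :=
  Complex.exp (∑ j, (-(a j : ℂ) * (z j * (starRingEnd ℂ) (z j)) + b j * z j +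
    c j * (starRingEnd ℂ) (z j)))

theorem gauss_eq_prod (a : Fin n → ℝ) (b c : Fin n → ℂ) (z : Fin n → ℂ) :
    gauss a b c z = ∏ j, Complex.exp (-(a j : ℂ) * (z j * (starRingEnd ℂ) (z j)) + b j * z j +
    c j * (starRingEnd ℂ) (z j)) := Complex.exp_sum _ _

theorem contDiff_gauss (a : Fin n → ℝ) (b c : Fin n → ℂ) : ContDiff ℝ ∞ (gauss a b c) :=
  (ContDiff.sum fun j _ => ((contDiff_const.mul ((contDiff_coord j).mul
    (contDiff_conj_coord j))).add (contDiff_const.mul (contDiff_coord j))).add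
      (contDiff_const.mul (contDiff_conj_coord j))).cexp

theorem integrable_gauss {p : Fin n → ℝ} (hp : ∀ j, 0 < p j) (B C : Fin n → ℂ) :
    Integrable (gauss p B C) := by
  simp only [funext (gauss_eq_prod p B C)]
  exact Integrable.fintype_prod (f := fun j (w : ℂ) => Complex.exp
    (-(p j : ℂ) * (w * (starRingEnd ℂ) w) + B j * w + C j * (starRingEnd ℂ) w))
    fun j => (integrable_and_integral_gauss (hp j) (B j) (C j)).1

theorem integral_gauss {p : Fin n → ℝ} (hp : ∀ j, 0 < p j) (B C : Fin n → ℂ) :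
    ∫ z, gauss p B C z = ∏ j, (Real.pi / p j * Complex.exp (B j * C j / p j)) := by
  simp only [gauss_eq_prod p B C]
  rw [integral_fintype_prod_volume_eq_prod (fun j (w : ℂ) => Complex.exp
    (-(p j : ℂ) * (w * (starRingEnd ℂ) w) + B j * w + C j * (starRingEnd ℂ) w))]
  exact Finset.prod_congr rfl fun j _ => (integrable_and_integral_gauss (hp j) (B j) (C j)).2

theorem norm_gauss_zero (a : Fin n → ℝ) (z : Fin n → ℂ) :
    ‖gauss a 0 0 z‖ = Real.exp (∑ j, -(a j * ‖z j‖ ^ 2)) := by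
  rw [gauss, Complex.norm_exp, Complex.re_sum]
  congr 1
  refine Finset.sum_congr rfl fun j _ => ?_
  rw [Complex.mul_conj, Complex.normSq_eq_norm_sq]
  simp [-Complex.ofReal_pow]

/-- A bound by a Gaussian of rate `a`, up to exponential factors. -/
def HasGaussBound (a : Fin n → ℝ) (F : (Fin n → ℂ) → ℂ) : Prop :=
  ∃ C β : ℝ, 0 ≤ C ∧ 0 ≤ β ∧ ∀ z, ‖F z‖ ≤ C * Real.exp (∑ j, (-(a j * ‖z j‖ ^ 2) + β * ‖z j‖))

theorem hasGaussBound_gauss (a : Fin n → ℝ) (b c : Fin n → ℂ) : HasGaussBound a (gauss a b c) := by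
  refine ⟨1, ∑ j, (‖b j‖ + ‖c j‖), zero_le_one, by positivity, fun z => ?_⟩
  rw [one_mul, gauss, Complex.norm_exp, Complex.re_sum]
  refine Real.exp_le_exp.2 (Finset.sum_le_sum fun j _ => ?_)
  rw [Complex.mul_conj, Complex.normSq_eq_norm_sq, add_assoc, Complex.add_re]
  have h1 : (-(a j : ℂ) * ((‖z j‖ ^ 2 : ℝ) : ℂ)).re = -(a j * ‖z j‖ ^ 2) := by
    rw [← Complex.ofReal_neg, ← Complex.ofReal_mul, Complex.ofReal_re]; ring
  have h2 : (b j * z j + c j * (starRingEnd ℂ) (z j)).re ≤ (‖b j‖ + ‖c j‖) * ‖z j‖ := by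
    refine (Complex.re_le_norm _).trans ((norm_add_le _ _).trans (le_of_eq ?_))
    rw [norm_mul, norm_mul, RCLike.norm_conj]; ring
  have h3 : ‖b j‖ + ‖c j‖ ≤ ∑ j, (‖b j‖ + ‖c j‖) :=
    Finset.single_le_sum (f := fun j => ‖b j‖ + ‖c j‖) (fun i _ => by positivity)
      (Finset.mem_univ j)
  rw [h1]
  have := mul_le_mul_of_nonneg_right h3 (norm_nonneg (z j))
  linarith

theorem HasGaussBound.add {a : Fin n → ℝ} {F G : (Fin n → ℂ) → ℂ} (hF : HasGaussBound a F)
    (hG : HasGaussBound a G) : HasGaussBound a fun z => F z + G z := by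
  obtain ⟨C, β, hC, hβ, h⟩ := hF
  obtain ⟨C', β', hC', hβ', h'⟩ := hG
  refine ⟨C + C', β + β', by positivity, by positivity, fun z => ?_⟩
  rw [add_mul]
  refine (norm_add_le _ _).trans (add_le_add ((h z).trans ?_) ((h' z).trans ?_))
  · gcongr with j; linarith
  · gcongr with j; linarith

theorem HasGaussBound.mul_coord {a : Fin n → ℝ} {F p : (Fin n → ℂ) → ℂ} (j : Fin n) {M : ℝ}
    (hM : 0 ≤ M) (hp : ∀ z, ‖p z‖ ≤ M * Real.exp ‖z j‖) (hF : HasGaussBound a F) :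
    HasGaussBound a fun z => p z * F z := by
  obtain ⟨C, β, hC, hβ, h⟩ := hF
  refine ⟨M * C, β + 1, by positivity, by positivity, fun z => ?_⟩
  rw [norm_mul]
  have h1 : Real.exp ‖z j‖ ≤ Real.exp (∑ i, ‖z i‖) :=
    Real.exp_le_exp.2 (Finset.single_le_sum (f := fun i => ‖z i‖) (fun i _ => norm_nonneg _)
      (Finset.mem_univ j))
  have h2 : Real.exp (∑ i, (-(a i * ‖z i‖ ^ 2) + (β + 1) * ‖z i‖)) =
      Real.exp (∑ i, (-(a i * ‖z i‖ ^ 2) + β * ‖z i‖)) * Real.exp (∑ i, ‖z i‖) := by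
    rw [← Real.exp_add, ← Finset.sum_add_distrib]
    congr 1
    exact Finset.sum_congr rfl fun i _ => by ring
  rw [h2]
  calc ‖p z‖ * ‖F z‖ ≤ (M * Real.exp (∑ i, ‖z i‖)) *
        (C * Real.exp (∑ i, (-(a i * ‖z i‖ ^ 2) + β * ‖z i‖))) :=
        mul_le_mul ((hp z).trans (mul_le_mul_of_nonneg_left h1 hM)) (h z) (norm_nonneg _)
          (by positivity)
    _ = _ := by ring

theorem norm_add_mul_le {α γ w w' : ℂ} (h : ‖w'‖ = ‖w‖) :
    ‖α + γ * w'‖ ≤ (‖α‖ + ‖γ‖) * Real.exp ‖w‖ := by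
  have h1 := Real.add_one_le_exp ‖w‖
  have h2 : 1 ≤ Real.exp ‖w‖ := Real.one_le_exp (norm_nonneg _)
  refine (norm_add_le _ _).trans ?_
  rw [norm_mul, h, add_mul]
  refine add_le_add (le_mul_of_one_le_right (norm_nonneg _) h2) ?_
  exact mul_le_mul_of_nonneg_left (by linarith) (norm_nonneg _)

/-- A factor that is affine in `z_j`. -/
theorem HasGaussBound.affine_mul {a : Fin n → ℝ} {F : (Fin n → ℂ) → ℂ} (j : Fin n) (α γ : ℂ)
    (hF : HasGaussBound a F) : HasGaussBound a fun z => (α + γ * z j) * F z :=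
  hF.mul_coord j (p := fun z => α + γ * z j) (by positivity) fun _ => norm_add_mul_le rfl

/-- A factor that is affine in `z̄_j`. -/
theorem HasGaussBound.affine_conj_mul {a : Fin n → ℝ} {F : (Fin n → ℂ) → ℂ} (j : Fin n) (α γ : ℂ)
    (hF : HasGaussBound a F) : HasGaussBound a fun z => (α + γ * (starRingEnd ℂ) (z j)) * F z :=
  hF.mul_coord j (p := fun z => α + γ * (starRingEnd ℂ) (z j)) (by positivity)
    fun _ => norm_add_mul_le (RCLike.norm_conj _)

theorem HasGaussBound.const_mul {a : Fin n → ℝ} {F : (Fin n → ℂ) → ℂ} (α : ℂ)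
    (hF : HasGaussBound a F) : HasGaussBound a fun z => α * F z := by
  obtain ⟨C, β, hC, hβ, h⟩ := hF
  refine ⟨‖α‖ * C, β, by positivity, hβ, fun z => ?_⟩
  rw [norm_mul, mul_assoc]
  exact mul_le_mul_of_nonneg_left (h z) (norm_nonneg _)

variable {lam : Fin n → ℝ}

theorem memLp_expBound {a : Fin n → ℝ} (ha : ∀ j, 0 < 2 * a j + lam j) (C β : ℝ) :
    MemLp (fun z : Fin n → ℂ => C * Real.exp (∑ j, (-(a j * ‖z j‖ ^ 2) + β * ‖z j‖))) 2
      (mu lam) := by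
  have hcont : Continuous fun z : Fin n → ℂ =>
      C * Real.exp (∑ j, (-(a j * ‖z j‖ ^ 2) + β * ‖z j‖)) := by fun_prop
  rw [memLp_two_iff_integrable_sq hcont.aestronglyMeasurable, integrable_mu_iff]
  let p : Fin n → ℝ := fun j => (2 * a j + lam j) / 2
  have hp : ∀ j, 0 < p j := fun j => half_pos (ha j)
  have hI := (integrable_gauss hp 0 0).norm.const_mul
    (2 ^ n * C ^ 2 * Real.exp (∑ j, β ^ 2 / p j))
  refine hI.mono' ((continuous_dens lam).smul (hcont.pow 2)).aestronglyMeasurable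
    (Eventually.of_forall fun z => ?_)
  rw [norm_gauss_zero, smul_eq_mul, Real.norm_eq_abs,
    abs_of_nonneg (mul_nonneg (dens_pos lam z).le (sq_nonneg _)), dens, mul_pow,
    ← Real.exp_nat_mul, phi]
  have h1 : ∀ j, -(lam j * ‖z j‖ ^ 2) + 2 * (-(a j * ‖z j‖ ^ 2) + β * ‖z j‖) ≤
      β ^ 2 / p j + -(p j * ‖z j‖ ^ 2) := by
    intro j
    have h2 : 2 * (β * ‖z j‖) ≤ β ^ 2 / p j + p j * ‖z j‖ ^ 2 := by
      have h3 := sq_nonneg (β - p j * ‖z j‖)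
      have h4 : 0 ≤ (β - p j * ‖z j‖) ^ 2 / p j := div_nonneg h3 (hp j).le
      have h5 : (β - p j * ‖z j‖) ^ 2 / p j = β ^ 2 / p j - 2 * (β * ‖z j‖) + p j * ‖z j‖ ^ 2 := by
        have := (hp j).ne'
        field_simp; ring
      linarith
    have h6 : 2 * p j = 2 * a j + lam j := by simp only [p]; ring
    nlinarith
  have h7 : Real.exp (-∑ j, lam j * ‖z j‖ ^ 2) *
      Real.exp ((2 : ℕ) * ∑ j, (-(a j * ‖z j‖ ^ 2) + β * ‖z j‖)) ≤
      Real.exp (∑ j, β ^ 2 / p j) * Real.exp (∑ j, -(p j * ‖z j‖ ^ 2)) := by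
    rw [← Real.exp_add, ← Real.exp_add]
    refine Real.exp_le_exp.2 ?_
    rw [Finset.mul_sum, ← Finset.sum_neg_distrib, ← Finset.sum_add_distrib,
      ← Finset.sum_add_distrib]
    exact Finset.sum_le_sum fun j _ => by push_cast; exact h1 j
  have h8 := mul_le_mul_of_nonneg_left h7 (by positivity : 0 ≤ 2 ^ n * C ^ 2)
  linarith

theorem HasGaussBound.memLp {a : Fin n → ℝ} (ha : ∀ j, 0 < 2 * a j + lam j)
    {F : (Fin n → ℂ) → ℂ} (hF : HasGaussBound a F) (hc : Continuous F) :
    MemLp F 2 (mu lam) := by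
  obtain ⟨C, β, hC, hβ, h⟩ := hF
  refine (memLp_expBound ha C β).mono hc.aestronglyMeasurable (Eventually.of_forall fun z => ?_)
  refine (h z).trans (le_abs_self _)

theorem dzbar_linear (b c : Fin n → ℂ) (j : Fin n) (z : Fin n → ℂ) :
    dzbar j (fun z => ∑ i, (b i * z i + c i * (starRingEnd ℂ) (z i))) z = c j := by
  have h1 := fun i => differentiableAt_coord (z := z) i
  have h2 := fun i => differentiableAt_conj_coord (z := z) i
  rw [dzbar_sum _ _ fun i _ => ((h1 i).const_mul _).fun_add ((h2 i).const_mul _),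
    Finset.sum_eq_single j]
  · rw [dzbar_add _ ((h1 j).const_mul _) ((h2 j).const_mul _), dzbar_mul _ (by fun_prop) (h1 j),
      dzbar_mul _ (by fun_prop) (h2 j), dzbar_const, dzbar_const, dzbar_coord, dzbar_conj_coord]
    simp
  · intro i _ hij
    rw [dzbar_add _ ((h1 i).const_mul _) ((h2 i).const_mul _), dzbar_mul _ (by fun_prop) (h1 i),
      dzbar_mul _ (by fun_prop) (h2 i), dzbar_const, dzbar_const, dzbar_coord, dzbar_conj_coord]
    simp [hij]
  · simp

theorem dz_linear (b c : Fin n → ℂ) (j : Fin n) (z : Fin n → ℂ) :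
    dz j (fun z => ∑ i, (b i * z i + c i * (starRingEnd ℂ) (z i))) z = b j := by
  have h1 := fun i => differentiableAt_coord (z := z) i
  have h2 := fun i => differentiableAt_conj_coord (z := z) i
  rw [dz_sum _ _ fun i _ => ((h1 i).const_mul _).fun_add ((h2 i).const_mul _),
    Finset.sum_eq_single j]
  · rw [dz_add _ ((h1 j).const_mul _) ((h2 j).const_mul _), dz_mul _ (by fun_prop) (h1 j),
      dz_mul _ (by fun_prop) (h2 j), dz_const, dz_const, dz_coord, dz_conj_coord]
    simp
  · intro i _ hij
    rw [dz_add _ ((h1 i).const_mul _) ((h2 i).const_mul _), dz_mul _ (by fun_prop) (h1 i),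
      dz_mul _ (by fun_prop) (h2 i), dz_const, dz_const, dz_coord, dz_conj_coord]
    simp [hij]
  · simp

theorem differentiableAt_quadratic (a : Fin n → ℂ) (z : Fin n → ℂ) :
    DifferentiableAt ℝ (fun z : Fin n → ℂ => ∑ j, a j * (z j * (starRingEnd ℂ) (z j))) z :=
  DifferentiableAt.fun_sum fun i _ =>
    ((differentiableAt_coord i).fun_mul (differentiableAt_conj_coord i)).const_mul _

theorem differentiableAt_linear (b c : Fin n → ℂ) (z : Fin n → ℂ) :
    DifferentiableAt ℝ (fun z : Fin n → ℂ => ∑ i, (b i * z i + c i * (starRingEnd ℂ) (z i))) z :=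
  DifferentiableAt.fun_sum fun i _ => ((differentiableAt_coord i).const_mul _).fun_add
    ((differentiableAt_conj_coord i).const_mul _)

theorem gauss_eq (a : Fin n → ℝ) (b c : Fin n → ℂ) : gauss a b c = fun z =>
    Complex.exp ((∑ j, -(a j : ℂ) * (z j * (starRingEnd ℂ) (z j))) +
      ∑ j, (b j * z j + c j * (starRingEnd ℂ) (z j))) := by
  funext z
  rw [gauss, ← Finset.sum_add_distrib]
  simp only [add_assoc]

theorem dzbar_gauss (a : Fin n → ℝ) (b c : Fin n → ℂ) (j : Fin n) :
    dzbar j (gauss a b c) = fun z => (c j + -(a j : ℂ) * z j) * gauss a b c z := by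
  funext z
  rw [gauss_eq, dzbar_cexp _ ((differentiableAt_quadratic _ z).fun_add (differentiableAt_linear _ _ z)),
    dzbar_add _ (differentiableAt_quadratic _ z) (differentiableAt_linear _ _ z),
    dzbar_quadratic, dzbar_linear]
  ring

theorem dz_gauss (a : Fin n → ℝ) (b c : Fin n → ℂ) (j : Fin n) :
    dz j (gauss a b c) = fun z => (b j + -(a j : ℂ) * (starRingEnd ℂ) (z j)) * gauss a b c z := by
  funext z
  rw [gauss_eq, dz_cexp _ ((differentiableAt_quadratic _ z).fun_add (differentiableAt_linear _ _ z)),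
    dz_add _ (differentiableAt_quadratic _ z) (differentiableAt_linear _ _ z),
    dz_quadratic, dz_linear]
  ring

theorem del_gauss (a : Fin n → ℝ) (b c : Fin n → ℂ) (j : Fin n) :
    del lam j (gauss a b c) = fun z =>
      (-b j + (a j + lam j : ℂ) * (starRingEnd ℂ) (z j)) * gauss a b c z := by
  funext z
  rw [del, dz_gauss]
  ring

theorem del_dzbar_gauss (a : Fin n → ℝ) (b c : Fin n → ℂ) (j k : Fin n) :
    del lam k (dzbar j (gauss a b c)) = fun z => (if j = k then (a j : ℂ) else 0) * gauss a b c z +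
      (c j + -(a j : ℂ) * z j) * ((-b k + (a k + lam k : ℂ) * (starRingEnd ℂ) (z k)) *
        gauss a b c z) := by
  funext z
  rw [dzbar_gauss, del, dz_mul _ (((differentiableAt_coord j).const_mul _).const_add _)
    ((contDiff_gauss a b c).differentiable (by simp) z), dz_gauss,
    dz_add _ (by fun_prop) ((differentiableAt_coord j).const_mul _), dz_const,
    dz_mul _ (by fun_prop) (differentiableAt_coord j), dz_const, dz_coord]
  split_ifs <;> ring

theorem dzbar_del_gauss (a : Fin n → ℝ) (b c : Fin n → ℂ) (j k : Fin n) :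
    dzbar j (del lam k (gauss a b c)) = fun z =>
      (if j = k then (a j + lam j : ℂ) else 0) * gauss a b c z +
      (c j + -(a j : ℂ) * z j) * ((-b k + (a k + lam k : ℂ) * (starRingEnd ℂ) (z k)) *
        gauss a b c z) := by
  funext z
  rw [del_gauss, dzbar_mul _ (((differentiableAt_conj_coord k).const_mul _).const_add _)
    ((contDiff_gauss a b c).differentiable (by simp) z), dzbar_gauss,
    dzbar_add _ (by fun_prop) ((differentiableAt_conj_coord k).const_mul _), dzbar_const,
    dzbar_mul _ (by fun_prop) (differentiableAt_conj_coord k), dzbar_const, dzbar_conj_coord]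
  by_cases h : j = k
  · subst h; simp; ring
  · simp [h, Ne.symm h]; ring

end Gauss

/-! ### The Kodaira Laplacian on Gaussians -/

section ExpInt

/-- `∫_0^t e^{-lr} dr`. -/
noncomputable def expInt (l t : ℝ) : ℝ := if l = 0 then t else (1 - Real.exp (-(l * t))) / l

theorem one_sub_mul_expInt (l t : ℝ) : 1 - l * expInt l t = Real.exp (-(l * t)) := by
  unfold expInt
  split_ifs with h
  · simp [h]
  · field_simp; ring

theorem expInt_zero (l : ℝ) : expInt l 0 = 0 := by
  unfold expInt; split_ifs <;> simp

theorem expInt_add (l s t : ℝ) :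
    expInt l (s + t) = expInt l s + expInt l t - l * expInt l s * expInt l t := by
  unfold expInt
  split_ifs with h
  · simp [h]
  · rw [mul_add, neg_add, Real.exp_add]; field_simp; ring

theorem contDiff_expInt (l : ℝ) : ContDiff ℝ ∞ (expInt l) := by
  by_cases h : l = 0
  · have : expInt l = fun t => t := by funext t; simp [expInt, h]
    rw [this]; exact contDiff_id
  · have : expInt l = fun t => (1 - Real.exp (-(l * t))) / l := by funext t; simp [expInt, h]
    rw [this]; fun_prop

theorem hasDerivAt_expInt (l t : ℝ) : HasDerivAt (expInt l) (Real.exp (-(l * t))) t := by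
  by_cases h : l = 0
  · have : expInt l = fun t => t := by funext t; simp [expInt, h]
    rw [this, h, zero_mul, neg_zero, Real.exp_zero]; exact hasDerivAt_id t
  · have : expInt l = fun t => (1 - Real.exp (-(l * t))) / l := by funext t; simp [expInt, h]
    rw [this]
    have h1 : HasDerivAt (fun t => -(l * t)) (-(l * 1)) t := ((hasDerivAt_id t).const_mul l).neg
    have h2 := (h1.exp.const_sub 1).div_const l
    convert! h2 using 1
    field_simp

theorem expInt_pos (l : ℝ) {t : ℝ} (ht : 0 < t) : 0 < expInt l t := by
  have hmono : StrictMono (expInt l) := strictMono_of_hasDerivAt_pos (hasDerivAt_expInt l)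
    fun _ => Real.exp_pos _
  have := hmono ht
  rwa [expInt_zero] at this

theorem expInt_nonneg (l : ℝ) {t : ℝ} (ht : 0 ≤ t) : 0 ≤ expInt l t := by
  rcases ht.eq_or_lt with h | h
  · rw [← h, expInt_zero]
  · exact (expInt_pos l h).le

/-- The factor `λ / (1 - e^{-tλ})`, read as `1 / t` for `λ = 0`, is the inverse of `∫_0^t e^{-λr} dr`. -/
theorem todd_eq (l t : ℝ) : todd t (l : ℂ) = ((expInt l t)⁻¹ : ℝ) := by
  unfold todd expInt
  by_cases h : l = 0
  · simp [h]
  · rw [if_neg (by exact_mod_cast h), if_neg h, inv_div]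
    push_cast
    rw [mul_comm (t : ℂ)]

theorem mul_expInt_lt_one (l t : ℝ) : l * expInt l t < 1 := by
  have := one_sub_mul_expInt l t
  have := Real.exp_pos (-(l * t))
  linarith

theorem one_add_mul_expInt_pos {a l t : ℝ} (h : 0 < 2 * a + l) (ht : 0 ≤ t) :
    0 < 1 + a * expInt l t := by
  have h1 := mul_expInt_lt_one l t
  have h2 := mul_nonneg h.le (expInt_nonneg l ht)
  linarith

/-- The rate at time `t` of a Gaussian that has rate `a` at time `0` and evolves under the heat flow
of `(-∂/∂z + l z̄) ∂/∂z̄` in one variable. -/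
noncomputable def flowRate (l t a : ℝ) : ℝ := a * (1 - l * expInt l t) / (1 + a * expInt l t)

theorem two_mul_flowRate_add_pos {a l t : ℝ} (h : 0 < 2 * a + l) (ht : 0 ≤ t) :
    0 < 2 * flowRate l t a + l := by
  have hd := one_add_mul_expInt_pos h ht
  have h1 : 2 * flowRate l t a + l = (2 * a + l - a * (l * expInt l t)) / (1 + a * expInt l t) := by
    unfold flowRate; field_simp; ring
  rw [h1]
  refine div_pos ?_ hd
  have hE := expInt_nonneg l ht
  have hlE := mul_expInt_lt_one l t
  rcases le_or_gt a 0 with ha | ha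
  · have : 0 ≤ -a * (l * expInt l t) := mul_nonneg (by linarith) (mul_nonneg (by linarith) hE)
    linarith
  · rcases le_or_gt l 0 with hl | hl
    · have : a * (l * expInt l t) ≤ 0 :=
        mul_nonpos_of_nonneg_of_nonpos ha.le (mul_nonpos_of_nonpos_of_nonneg hl hE)
      linarith
    · have := mul_lt_mul_of_pos_left hlE ha
      linarith

end ExpInt

section BoxGauss

variable {n : ℕ} {lam : Fin n → ℝ}

/-- The scalar function `∑_j ((-∂_j + λ_j z̄_j) ∂̄_j) g` for a Gaussian `g`. -/
noncomputable def boxGauss (lam a : Fin n → ℝ) (b c : Fin n → ℂ) (z : Fin n → ℂ) : ℂ :=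
  ∑ j, ((a j : ℂ) + (c j + -(a j : ℂ) * z j) * (-b j + (a j + lam j : ℂ) * (starRingEnd ℂ) (z j))) *
    gauss a b c z

theorem HasGaussBound.sum {ι : Type*} {a : Fin n → ℝ} (s : Finset ι) {F : ι → (Fin n → ℂ) → ℂ}
    (h : ∀ i ∈ s, HasGaussBound a (F i)) : HasGaussBound a fun z => ∑ i ∈ s, F i z := by
  classical
  induction s using Finset.induction_on with
  | empty => exact ⟨0, 0, le_rfl, le_rfl, fun z => by simp⟩
  | insert i s hi ih =>
    simp only [Finset.sum_insert hi]
    exact (h i (Finset.mem_insert_self i s)).add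
      (ih fun j hj => h j (Finset.mem_insert_of_mem hj))

theorem cls_sum {ι : Type*} (s : Finset ι) {F : ι → (Fin n → ℂ) → ℂ}
    (h : ∀ i ∈ s, MemLp (F i) 2 (mu lam)) :
    cls lam (fun z => ∑ i ∈ s, F i z) = ∑ i ∈ s, cls lam (F i) := by
  classical
  induction s using Finset.induction_on with
  | empty =>
    have : cls lam (fun _ : Fin n → ℂ => (0 : ℂ)) = 0 := by
      simpa using cls_smul (lam := lam) (f := fun _ => 0) 0 MemLp.zero'
    simpa using this
  | insert i s hi ih =>
    simp only [Finset.sum_insert hi]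
    rw [cls_add (h i (Finset.mem_insert_self i s))
      (memLp_finsetSum s fun j hj => h j (Finset.mem_insert_of_mem hj)),
      ih fun j hj => h j (Finset.mem_insert_of_mem hj)]

theorem hasGaussBound_quadratic (a : Fin n → ℝ) (b c : Fin n → ℂ) (j k : Fin n)
    (α β γ δ : ℂ) : HasGaussBound a fun z =>
      (α + β * z j) * ((γ + δ * (starRingEnd ℂ) (z k)) * gauss a b c z) :=
  ((hasGaussBound_gauss a b c).affine_conj_mul k γ δ).affine_mul j α β

theorem continuous_boxGauss (a : Fin n → ℝ) (b c : Fin n → ℂ) :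
    Continuous (boxGauss lam a b c) := by
  have := (contDiff_gauss a b c).continuous
  unfold boxGauss
  have h : ∀ j, Continuous fun z : Fin n → ℂ => (starRingEnd ℂ) (z j) :=
    fun j => (contDiff_conj_coord j).continuous
  fun_prop

/-- A Gaussian of rate `a` is square integrable with respect to `e^{-φ₀} dv` if `2a_j + λ_j > 0` for
all `j`. -/
theorem memLp_gauss {a : Fin n → ℝ} (ha : ∀ j, 0 < 2 * a j + lam j) (b c : Fin n → ℂ) :
    MemLp (gauss a b c) 2 (mu lam) :=
  (hasGaussBound_gauss a b c).memLp ha (contDiff_gauss a b c).continuous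

theorem memLp_boxGauss {a : Fin n → ℝ} (ha : ∀ j, 0 < 2 * a j + lam j) (b c : Fin n → ℂ) :
    MemLp (boxGauss lam a b c) 2 (mu lam) := by
  refine HasGaussBound.memLp ha ?_ (continuous_boxGauss a b c)
  have h : boxGauss lam a b c = fun z => ∑ j, ((a j : ℂ) * gauss a b c z +
      (c j + -(a j : ℂ) * z j) * ((-b j + (a j + lam j : ℂ) * (starRingEnd ℂ) (z j)) *
        gauss a b c z)) := by
    funext z
    exact Finset.sum_congr rfl fun j _ => by ring
  rw [h]
  exact HasGaussBound.sum _ fun j _ =>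
    ((hasGaussBound_gauss a b c).const_mul _).add (hasGaussBound_quadratic a b c j j _ _ _ _)

theorem memLp_dzbar_gauss {a : Fin n → ℝ} (ha : ∀ j, 0 < 2 * a j + lam j) (b c : Fin n → ℂ)
    (j : Fin n) : MemLp (dzbar j (gauss a b c)) 2 (mu lam) := by
  refine HasGaussBound.memLp ha ?_ (contDiff_dzbar (contDiff_gauss a b c) j).continuous
  rw [dzbar_gauss]
  exact (hasGaussBound_gauss a b c).affine_mul j _ _

theorem memLp_del_gauss {a : Fin n → ℝ} (ha : ∀ j, 0 < 2 * a j + lam j) (b c : Fin n → ℂ)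
    (j : Fin n) : MemLp (del lam j (gauss a b c)) 2 (mu lam) := by
  refine HasGaussBound.memLp ha ?_ (contDiff_del lam (contDiff_gauss a b c) j).continuous
  rw [del_gauss]
  exact (hasGaussBound_gauss a b c).affine_conj_mul j _ _

theorem memLp_del_dzbar_gauss {a : Fin n → ℝ} (ha : ∀ j, 0 < 2 * a j + lam j) (b c : Fin n → ℂ)
    (j k : Fin n) : MemLp (del lam k (dzbar j (gauss a b c))) 2 (mu lam) := by
  refine HasGaussBound.memLp ha ?_
    (contDiff_del lam (contDiff_dzbar (contDiff_gauss a b c) j) k).continuous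
  rw [del_dzbar_gauss]
  exact ((hasGaussBound_gauss a b c).const_mul _).add (hasGaussBound_quadratic a b c j k _ _ _ _)

theorem memLp_dzbar_del_gauss {a : Fin n → ℝ} (ha : ∀ j, 0 < 2 * a j + lam j) (b c : Fin n → ℂ)
    (j k : Fin n) : MemLp (dzbar j (del lam k (gauss a b c))) 2 (mu lam) := by
  refine HasGaussBound.memLp ha ?_
    (contDiff_dzbar (contDiff_del lam (contDiff_gauss a b c) k) j).continuous
  rw [dzbar_del_gauss]
  exact ((hasGaussBound_gauss a b c).const_mul _).add (hasGaussBound_quadratic a b c j k _ _ _ _)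

/-- `∂/∂z̄_j` and its formal adjoints commute up to the curvature. -/
theorem cls_dzbar_del_gauss {a : Fin n → ℝ} (ha : ∀ j, 0 < 2 * a j + lam j) (b c : Fin n → ℂ)
    (j k : Fin n) : cls lam (dzbar j (del lam k (gauss a b c))) =
      cls lam (del lam k (dzbar j (gauss a b c))) +
        (if j = k then (lam j : ℂ) else 0) • cls lam (gauss a b c) := by
  have h : dzbar j (del lam k (gauss a b c)) = fun z => del lam k (dzbar j (gauss a b c)) z +
      (if j = k then (lam j : ℂ) else 0) * gauss a b c z := by
    rw [dzbar_del_gauss, del_dzbar_gauss]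
    funext z
    split_ifs <;> ring
  rw [← cls_smul _ (memLp_gauss ha b c), h, cls_add (memLp_del_dzbar_gauss ha b c j k)
    ((memLp_gauss ha b c).const_mul _)]

/-- `boxGauss` is `∑_j δ_j ∂̄_j g`. -/
theorem cls_boxGauss {a : Fin n → ℝ} (ha : ∀ j, 0 < 2 * a j + lam j) (b c : Fin n → ℂ) :
    cls lam (boxGauss lam a b c) = ∑ j, cls lam (del lam j (dzbar j (gauss a b c))) := by
  rw [← cls_sum _ fun j _ => memLp_del_dzbar_gauss ha b c j j]
  congr 1
  funext z
  refine Finset.sum_congr rfl fun j _ => ?_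
  rw [del_dzbar_gauss, if_pos rfl]; ring

theorem IsDbar.sum {ι : Type*} {p p' : ℕ} (s : Finset ι) {u : ι → L2 lam p} {v : ι → L2 lam p'}
    (h : ∀ j, IsDbar (u j) (v j)) : IsDbar (∑ j ∈ s, u j) (∑ j ∈ s, v j) := by
  classical
  induction s using Finset.induction_on with
  | empty => simpa using IsDbar.zero
  | insert i s hi ih => rw [Finset.sum_insert hi, Finset.sum_insert hi]; exact (h i).add ih

theorem IsDbarStar.sum {ι : Type*} {p p' : ℕ} (s : Finset ι) {v : ι → L2 lam p'}
    {w : ι → L2 lam p} (h : ∀ j, IsDbarStar (v j) (w j)) :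
    IsDbarStar (∑ j ∈ s, v j) (∑ j ∈ s, w j) := by
  classical
  induction s using Finset.induction_on with
  | empty => simpa using IsDbarStar.zero
  | insert i s hi ih => rw [Finset.sum_insert hi, Finset.sum_insert hi]; exact (h i).add ih

theorem tens_sum {ι : Type*} {q : ℕ} (s : Finset ι) (e : ι → Cov n q) (f : Lp ℂ 2 (mu lam)) :
    tens (∑ j ∈ s, e j) f = ∑ j ∈ s, tens (e j) f := by
  classical
  induction s using Finset.induction_on with
  | empty => simp [tens_zero]
  | insert i s hi ih => rw [Finset.sum_insert hi, Finset.sum_insert hi, tens_add, ih]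

theorem tens_Theta {q : ℕ} (e : Cov n q) (f : Lp ℂ 2 (mu lam)) :
    tens (Theta lam q e) f = ∑ j, (lam j : ℂ) • tens (wedgeContract j q e) f := by
  have hT : Theta lam q e = ∑ j, (lam j : ℂ) • wedgeContract j q e := by simp [Theta]
  rw [hT, tens_sum]
  simp only [tens_smul]

/-- If second derivatives `D j k = δ_k ∂̄_j g` and `D' j k = ∂̄_j δ_k g` differ by the curvature, then
the mixed terms in the Kodaira Laplacian cancel. -/
theorem sum_contract_wedge {q : ℕ} (e : Cov n q) (f : Lp ℂ 2 (mu lam))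
    (D D' : Fin n → Fin n → Lp ℂ 2 (mu lam))
    (hD : ∀ j k, D' j k = D j k + (if j = k then (lam j : ℂ) else 0) • f) :
    tens e (∑ j, D j j) + tens (Theta lam q e) f =
      (∑ j, ∑ k, tens (contract k (q + 1) q (wedge j q (q + 1) e)) (D j k)) +
        ∑ k, ∑ j, tens (wedge j (q - 1) q (contract k q (q - 1) e)) (D' j k) := by
  have h1 : ∀ j k, tens (contract k (q + 1) q (wedge j q (q + 1) e)) (D j k) +
      tens (wedge j (q - 1) q (contract k q (q - 1) e)) (D' j k) =
      if j = k then tens e (D j j) + (lam j : ℂ) • tens (wedgeContract j q e) f else 0 := by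
    intro j k
    rw [hD, map_add, ← add_assoc, ← tens_add, contract_wedge_add_wedge_contract]
    split_ifs with h
    · subst h
      rw [map_smul]; rfl
    · rw [tens_zero, zero_smul, map_zero, add_zero]
  rw [Finset.sum_comm (s := Finset.univ) (f := fun k j =>
    tens (wedge j (q - 1) q (contract k q (q - 1) e)) (D' j k)), ← Finset.sum_add_distrib]
  simp only [← Finset.sum_add_distrib, h1]
  simp only [Finset.sum_ite_eq, Finset.mem_univ, if_true]
  rw [Finset.sum_add_distrib, tens_Theta, map_sum]

/-- The Kodaira Laplacian of `g e` for a Gaussian `g` and a constant covector `e`. -/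
theorem isBox_gauss {q : ℕ} {a : Fin n → ℝ} (ha : ∀ j, 0 < 2 * a j + lam j) (b c : Fin n → ℂ)
    (e : Cov n q) : IsBox (tens e (cls lam (gauss a b c)))
      (tens e (cls lam (boxGauss lam a b c)) + tens (Theta lam q e) (cls lam (gauss a b c))) := by
  have hg := contDiff_gauss a b c
  have hgL := memLp_gauss ha b c
  rw [cls_boxGauss ha, sum_contract_wedge e _ _ _ (cls_dzbar_del_gauss ha b c)]
  exact ⟨_, _, _, _, isDbar_tens hg hgL (memLp_dzbar_gauss ha b c) e,
    IsDbarStar.sum _ fun j => isDbarStar_tens (contDiff_dzbar hg j) (memLp_dzbar_gauss ha b c j)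
      (memLp_del_dzbar_gauss ha b c j) (wedge j q (q + 1) e),
    isDbarStar_tens hg hgL (memLp_del_gauss ha b c) e,
    IsDbar.sum _ fun k => isDbar_tens (contDiff_del lam hg k) (memLp_del_gauss ha b c k)
      (fun j => memLp_dzbar_del_gauss ha b c j k) (contract k q (q - 1) e), rfl⟩

/-- Forms that are orthogonal to all Gaussians vanish. -/
theorem eq_zero_of_inner_gauss {q : ℕ} {a : Fin n → ℝ} (ha : ∀ j, 0 < 2 * a j + lam j)
    (h : L2 lam q) (hh : ∀ (K : {J : Finset (Fin n) // J.card = q}) (b c : Fin n → ℂ),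
      inner ℂ h (tens (EuclideanSpace.single K 1) (cls lam (gauss a b c))) = 0) : h = 0 := by
  have key : ∀ K : {J : Finset (Fin n) // J.card = q}, ∀ᵐ z ∂(volume : Measure (Fin n → ℂ)),
      h z K = 0 := by
    intro K
    have hI : ∀ b c, Integrable fun z =>
        ((dens lam z : ℂ) * (starRingEnd ℂ) (gauss a b c z)) * h z K := fun b c => by
      have := (EuclideanSpace.proj (𝕜 := ℂ) K).integrable_comp
        (integrable_conj_smul (memLp_gauss ha b c) h)
      simpa using this
    have h0 : ∀ b c, ∫ z, ((dens lam z : ℂ) * (starRingEnd ℂ) (gauss a b c z)) * h z K = 0 := by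
      intro b c
      have h1 := hh K b c
      rw [← inner_conj_symm, inner_tens_cls _ (memLp_gauss ha b c), map_eq_zero,
        EuclideanSpace.inner_single_left, map_one, one_mul] at h1
      have h2 := (EuclideanSpace.proj (𝕜 := ℂ) K).integral_comp_comm
        (integrable_conj_smul (memLp_gauss ha b c) h)
      have h3 : (EuclideanSpace.proj (𝕜 := ℂ) K) (∫ z, ((dens lam z : ℂ) *
          (starRingEnd ℂ) (gauss a b c z)) • h z) = 0 := h1
      rw [h3] at h2
      exact h2
    -- Gaussians with imaginary linear terms provide the characters in the Fourier transform
    have h1 := ae_eq_zero_of_charFun_eq_zero (hI 0 0) fun L => by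
      let m : Fin n → ℂ := fun j =>
        ((L (Pi.single j (1 : ℂ)) : ℂ) - Complex.I * (L (Pi.single j Complex.I) : ℂ)) / 2
      have hL : ∀ z : Fin n → ℂ, (L z : ℂ) = ∑ j, (m j * z j + (starRingEnd ℂ) (m j * z j)) := by
        intro z
        have hz : z = ∑ j, ((z j).re • (Pi.single j (1 : ℂ) : Fin n → ℂ) +
            (z j).im • (Pi.single j Complex.I : Fin n → ℂ)) := by
          funext i
          rw [Finset.sum_apply, Finset.sum_eq_single i]
          · simp
          · intro j _ hj
            simp [Ne.symm hj]
          · simp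
        conv_lhs => rw [hz]
        rw [map_sum, Complex.ofReal_sum]
        refine Finset.sum_congr rfl fun j _ => ?_
        rw [map_add, map_smul, map_smul, Complex.add_conj]
        congr 1
        simp [m]
        ring
      have h2 := h0 (fun j => -Complex.I * m j) (fun j => -Complex.I * (starRingEnd ℂ) (m j))
      rw [← h2]
      refine integral_congr_ae (Eventually.of_forall fun z => ?_)
      have h3 : (starRingEnd ℂ) (gauss a (fun j => -Complex.I * m j)
          (fun j => -Complex.I * (starRingEnd ℂ) (m j)) z) =
          (starRingEnd ℂ) (gauss a 0 0 z) * Complex.exp (L z * Complex.I) := by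
        rw [gauss, gauss, ← Complex.exp_conj, ← Complex.exp_conj, ← Complex.exp_add, hL,
          map_sum, map_sum, Finset.sum_mul, ← Finset.sum_add_distrib]
        congr 1
        refine Finset.sum_congr rfl fun j _ => ?_
        simp only [map_add, map_mul, map_neg, Complex.conj_I, Complex.conj_conj, Pi.zero_apply,
          map_zero]
        ring
      simp only [h3]
      ring
    filter_upwards [h1] with z hz
    have hd : (dens lam z : ℂ) ≠ 0 := Complex.ofReal_ne_zero.2 (dens_pos lam z).ne'
    have hg : (starRingEnd ℂ) (gauss a 0 0 z) ≠ 0 := by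
      rw [map_ne_zero]; exact Complex.exp_ne_zero _
    have hz' : ((dens lam z : ℂ) * (starRingEnd ℂ) (gauss a 0 0 z)) * h z K = 0 := hz
    exact (mul_eq_zero.1 hz').resolve_left (mul_ne_zero hd hg)
  rw [Lp.eq_zero_iff_ae_eq_zero]
  refine (mu_absolutelyContinuous lam).ae_le ?_
  filter_upwards [ae_all_iff.2 key] with z hz
  ext K
  exact hz K

end BoxGauss

/-! ### Differentiating families of Gaussians -/

section Slope

/-- A `C¹` function and its derivative are bounded near `0`. -/
theorem eventually_hasDerivAt_bound {p : ℝ → ℂ} (hp : ContDiffAt ℝ 1 p 0) :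
    ∃ M : ℝ, 0 ≤ M ∧ ∀ᶠ t in 𝓝 (0 : ℝ), HasDerivAt p (deriv p t) t ∧ ‖p t‖ ≤ M ∧
      ‖deriv p t‖ ≤ M := by
  have h1 : ∀ᶠ t in 𝓝 (0 : ℝ), ContDiffAt ℝ 1 p t := hp.eventually (by simp)
  have h2 : ContinuousAt (fun t => ‖deriv p t‖) 0 := by
    have h3 : ContinuousAt (fderiv ℝ p) 0 :=
      (hp.fderiv_right (m := 0) (by simp)).continuousAt
    have h4 : ContinuousAt (fun t => fderiv ℝ p t 1) 0 := h3.clm_apply continuousAt_const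
    exact h4.norm
  have h3 : ContinuousAt (fun t => ‖p t‖) 0 := hp.continuousAt.norm
  refine ⟨‖p 0‖ + ‖deriv p 0‖ + 1, by positivity, ?_⟩
  filter_upwards [h1, h2.eventually_lt continuousAt_const (lt_add_one ‖deriv p 0‖),
    h3.eventually_lt continuousAt_const (lt_add_one ‖p 0‖)] with t h4 h5 h6
  refine ⟨(h4.differentiableAt (by simp)).hasDerivAt, ?_, ?_⟩
  · linarith [norm_nonneg (deriv p 0)]
  · linarith [norm_nonneg (p 0)]

theorem eventually_hasDerivAt_bound_family {n : ℕ} {p : Fin n → ℝ → ℂ}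
    (hp : ∀ j, ContDiffAt ℝ 1 (p j) 0) :
    ∃ M : ℝ, 0 ≤ M ∧ ∀ᶠ t in 𝓝 (0 : ℝ), ∀ j, HasDerivAt (p j) (deriv (p j) t) t ∧ ‖p j t‖ ≤ M ∧
      ‖deriv (p j) t‖ ≤ M := by
  choose M hM h using fun j => eventually_hasDerivAt_bound (hp j)
  refine ⟨∑ j, M j, Finset.sum_nonneg fun j _ => hM j, ?_⟩
  filter_upwards [eventually_all.2 h] with t ht j
  have := Finset.single_le_sum (f := M) (fun i _ => hM i) (Finset.mem_univ j)
  exact ⟨(ht j).1, (ht j).2.1.trans this, (ht j).2.2.trans this⟩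

variable {n : ℕ} {lam : Fin n → ℝ}

/-- A family of Gaussians with differentiable parameters is differentiable in `L²`. The mean value
inequality bounds the difference quotients by a fixed Gaussian of slightly smaller rate. -/
theorem tendsto_slope_gauss {A : Fin n → ℝ → ℝ} {B C D : Fin n → ℝ → ℂ}
    (hA : ∀ j, ContDiffAt ℝ 1 (A j) 0) (hB : ∀ j, ContDiffAt ℝ 1 (B j) 0)
    (hC : ∀ j, ContDiffAt ℝ 1 (C j) 0) (hD : ∀ j, ContDiffAt ℝ 1 (D j) 0)
    (hD0 : ∀ j, D j 0 = 0) (ha : ∀ j, 0 < 2 * A j 0 + lam j) {F : (Fin n → ℂ) → ℂ}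
    (hFm : MemLp F 2 (mu lam))
    (hF : ∀ z, F z = (∑ j, (-(deriv (fun t => (A j t : ℂ)) 0) * (z j * (starRingEnd ℂ) (z j)) +
      deriv (B j) 0 * z j + deriv (C j) 0 * (starRingEnd ℂ) (z j) + deriv (D j) 0)) *
        gauss (fun j => A j 0) (fun j => B j 0) (fun j => C j 0) z) :
    Tendsto (fun t : ℝ => (t⁻¹ : ℝ) • (Complex.exp (∑ j, D j t) •
        cls lam (gauss (fun j => A j t) (fun j => B j t) (fun j => C j t)) -
        cls lam (gauss (fun j => A j 0) (fun j => B j 0) (fun j => C j 0)))) (𝓝[>] 0)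
      (𝓝 (cls lam F)) := by
  let W : ℝ → (Fin n → ℂ) → ℂ := fun t z =>
    Complex.exp (∑ j, (-(A j t : ℂ) * (z j * (starRingEnd ℂ) (z j)) + B j t * z j +
      C j t * (starRingEnd ℂ) (z j) + D j t))
  let W' : ℝ → (Fin n → ℂ) → ℂ := fun t z => W t z *
    ∑ j, (-(deriv (fun t => (A j t : ℂ)) t) * (z j * (starRingEnd ℂ) (z j)) +
      deriv (B j) t * z j + deriv (C j) t * (starRingEnd ℂ) (z j) + deriv (D j) t)
  have hW : ∀ t z, W t z = Complex.exp (∑ j, D j t) *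
      gauss (fun j => A j t) (fun j => B j t) (fun j => C j t) z := by
    intro t z
    rw [gauss, ← Complex.exp_add, add_comm, ← Finset.sum_add_distrib]
  have hW0 : ∀ z, W 0 z = gauss (fun j => A j 0) (fun j => B j 0) (fun j => C j 0) z := by
    intro z; rw [hW]; simp [hD0]
  have hFW : ∀ z, F z = W' 0 z := fun z => by rw [hF, ← hW0, mul_comm]
  obtain ⟨M1, hM1, h1⟩ := eventually_hasDerivAt_bound_family (p := fun j t => (A j t : ℂ))
    fun j => Complex.ofRealCLM.contDiff.contDiffAt.comp 0 (hA j)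
  obtain ⟨M2, hM2, h2⟩ := eventually_hasDerivAt_bound_family hB
  obtain ⟨M3, hM3, h3⟩ := eventually_hasDerivAt_bound_family hC
  obtain ⟨M4, hM4, h4⟩ := eventually_hasDerivAt_bound_family hD
  let M := M1 + M2 + M3 + M4
  have hM : 0 ≤ M := by positivity
  -- a rate smaller than `A j t` for small `t`, but still that of a square integrable Gaussian
  let a : Fin n → ℝ := fun j => A j 0 - (2 * A j 0 + lam j) / 4
  have ha' : ∀ j, 0 < 2 * a j + lam j := fun j => by simp only [a]; linarith [ha j]
  have h5 : ∀ᶠ t in 𝓝 (0 : ℝ), ∀ j, a j ≤ A j t := by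
    refine eventually_all.2 fun j => ?_
    have h6 := continuousAt_const.eventually_lt (hA j).continuousAt
      (show a j < A j 0 by simp only [a]; linarith [ha j])
    exact h6.mono fun t ht => ht.le
  obtain ⟨δ, hδ, hall⟩ := Metric.eventually_nhds_iff_ball.1
    (h1.and (h2.and (h3.and (h4.and h5))))
  let K : ℝ := n * M * Real.exp (n * M)
  let G : (Fin n → ℂ) → ℝ := fun z =>
    K * Real.exp (∑ j, (-(a j * ‖z j‖ ^ 2) + (2 * M + 2) * ‖z j‖))
  have hG : MemLp G 2 (mu lam) := memLp_expBound ha' _ _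
  have hderiv : ∀ t ∈ Metric.ball (0 : ℝ) δ, ∀ z, HasDerivAt (fun t => W t z) (W' t z) t := by
    intro t ht z
    obtain ⟨g1, g2, g3, g4, -⟩ := hall t ht
    refine HasDerivAt.cexp (HasDerivAt.fun_sum fun j _ => ?_)
    have k1 : HasDerivAt (fun t => -(A j t : ℂ)) (-deriv (fun t => (A j t : ℂ)) t) t :=
      (g1 j).1.neg
    exact (((k1.mul_const _).add ((g2 j).1.mul_const _)).add ((g3 j).1.mul_const _)).add (g4 j).1
  have hbound : ∀ t ∈ Metric.ball (0 : ℝ) δ, ∀ z, ‖W' t z‖ ≤ G z := by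
    intro t ht z
    obtain ⟨g1, g2, g3, g4, g5⟩ := hall t ht
    have e1 : ‖W t z‖ ≤ Real.exp (n * M) *
        Real.exp (∑ j, (-(a j * ‖z j‖ ^ 2) + 2 * M * ‖z j‖)) := by
      simp only [W]
      rw [Complex.norm_exp, ← Real.exp_add, Complex.re_sum]
      have e2 : (n * M : ℝ) = ∑ _j : Fin n, M := by simp
      rw [e2, ← Finset.sum_add_distrib]
      refine Real.exp_le_exp.2 (Finset.sum_le_sum fun j _ => ?_)
      rw [Complex.mul_conj, Complex.normSq_eq_norm_sq]
      simp only [Complex.add_re]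
      have e3 : (-(A j t : ℂ) * ((‖z j‖ ^ 2 : ℝ) : ℂ)).re = -(A j t * ‖z j‖ ^ 2) := by
        rw [← Complex.ofReal_neg, ← Complex.ofReal_mul, Complex.ofReal_re]; ring
      have e4 : (B j t * z j).re ≤ M * ‖z j‖ := by
        refine (Complex.re_le_norm _).trans ?_
        rw [norm_mul]
        exact mul_le_mul_of_nonneg_right ((g2 j).2.1.trans (by simp only [M]; linarith))
          (norm_nonneg _)
      have e5 : (C j t * (starRingEnd ℂ) (z j)).re ≤ M * ‖z j‖ := by
        refine (Complex.re_le_norm _).trans ?_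
        rw [norm_mul, RCLike.norm_conj]
        exact mul_le_mul_of_nonneg_right ((g3 j).2.1.trans (by simp only [M]; linarith))
          (norm_nonneg _)
      have e6 : (D j t).re ≤ M :=
        (Complex.re_le_norm _).trans ((g4 j).2.1.trans (by simp only [M]; linarith))
      have e7 := mul_le_mul_of_nonneg_right (g5 j) (sq_nonneg ‖z j‖)
      rw [e3]; linarith
    have e8 : ‖∑ j, (-(deriv (fun t => (A j t : ℂ)) t) * (z j * (starRingEnd ℂ) (z j)) +
        deriv (B j) t * z j + deriv (C j) t * (starRingEnd ℂ) (z j) + deriv (D j) t)‖ ≤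
        n * M * Real.exp (2 * ∑ j, ‖z j‖) := by
      have e9 : (n * M * Real.exp (2 * ∑ j, ‖z j‖) : ℝ) =
          ∑ _j : Fin n, M * Real.exp (2 * ∑ j, ‖z j‖) := by simp [mul_assoc]
      rw [e9]
      refine (norm_sum_le _ _).trans (Finset.sum_le_sum fun j _ => ?_)
      have r0 := norm_nonneg (z j)
      have f1 : ‖-(deriv (fun t => (A j t : ℂ)) t) * (z j * (starRingEnd ℂ) (z j))‖ ≤
          M1 * (‖z j‖ * ‖z j‖) := by
        rw [norm_mul, norm_mul, norm_neg, RCLike.norm_conj]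
        exact mul_le_mul_of_nonneg_right (g1 j).2.2 (by positivity)
      have f2 : ‖deriv (B j) t * z j‖ ≤ M2 * ‖z j‖ := by
        rw [norm_mul]; exact mul_le_mul_of_nonneg_right (g2 j).2.2 r0
      have f3 : ‖deriv (C j) t * (starRingEnd ℂ) (z j)‖ ≤ M3 * ‖z j‖ := by
        rw [norm_mul, RCLike.norm_conj]; exact mul_le_mul_of_nonneg_right (g3 j).2.2 r0
      have f4 : ‖deriv (D j) t‖ ≤ M4 := (g4 j).2.2
      have f5 : (1 + ‖z j‖) ^ 2 ≤ Real.exp (2 * ∑ j, ‖z j‖) := by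
        have f6 : 1 + ‖z j‖ ≤ Real.exp (∑ j, ‖z j‖) := by
          have := Finset.single_le_sum (f := fun j => ‖z j‖) (fun i _ => norm_nonneg _)
            (Finset.mem_univ j)
          have f7 := Real.add_one_le_exp (∑ j, ‖z j‖)
          linarith
        calc (1 + ‖z j‖) ^ 2 ≤ Real.exp (∑ j, ‖z j‖) ^ 2 := by gcongr
          _ = _ := by rw [← Real.exp_nat_mul]; norm_num
      have f8 : M1 * (‖z j‖ * ‖z j‖) + M2 * ‖z j‖ + M3 * ‖z j‖ + M4 ≤ M * (1 + ‖z j‖) ^ 2 := by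
        have : M * (1 + ‖z j‖) ^ 2 = M1 * (‖z j‖ * ‖z j‖) + M2 * ‖z j‖ + M3 * ‖z j‖ + M4 +
            (M1 * (1 + 2 * ‖z j‖) + M2 * (1 + ‖z j‖ + ‖z j‖ * ‖z j‖) +
              M3 * (1 + ‖z j‖ + ‖z j‖ * ‖z j‖) + M4 * (2 * ‖z j‖ + ‖z j‖ * ‖z j‖)) := by
          simp only [M]; ring
        rw [this]
        have : 0 ≤ (M1 * (1 + 2 * ‖z j‖) + M2 * (1 + ‖z j‖ + ‖z j‖ * ‖z j‖) +
              M3 * (1 + ‖z j‖ + ‖z j‖ * ‖z j‖) + M4 * (2 * ‖z j‖ + ‖z j‖ * ‖z j‖)) := by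
          positivity
        linarith
      have f9 := mul_le_mul_of_nonneg_left f5 hM
      have f10 := norm_add_le (-(deriv (fun t => (A j t : ℂ)) t) * (z j * (starRingEnd ℂ) (z j)) +
        deriv (B j) t * z j + deriv (C j) t * (starRingEnd ℂ) (z j)) (deriv (D j) t)
      have f11 := norm_add₃_le (a := -(deriv (fun t => (A j t : ℂ)) t) *
        (z j * (starRingEnd ℂ) (z j))) (b := deriv (B j) t * z j)
        (c := deriv (C j) t * (starRingEnd ℂ) (z j))
      linarith
    have e10 : G z = (Real.exp (n * M) *
        Real.exp (∑ j, (-(a j * ‖z j‖ ^ 2) + 2 * M * ‖z j‖))) *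
          (n * M * Real.exp (2 * ∑ j, ‖z j‖)) := by
      have : Real.exp (∑ j, (-(a j * ‖z j‖ ^ 2) + (2 * M + 2) * ‖z j‖)) =
          Real.exp (∑ j, (-(a j * ‖z j‖ ^ 2) + 2 * M * ‖z j‖)) *
            Real.exp (2 * ∑ j, ‖z j‖) := by
        rw [← Real.exp_add, Finset.mul_sum, ← Finset.sum_add_distrib]
        congr 1
        exact Finset.sum_congr rfl fun j _ => by ring
      simp only [G, K, this]
      ring
    rw [e10, norm_mul]
    exact mul_le_mul e1 e8 (norm_nonneg _) (by positivity)
  have hIoo : ∀ᶠ t in 𝓝[>] (0 : ℝ), t ∈ Set.Ioo 0 δ := Ioo_mem_nhdsGT hδ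
  have hball : ∀ {t : ℝ}, 0 ≤ t → t < δ → t ∈ Metric.ball (0 : ℝ) δ := fun h0 h1 => by
    rwa [Metric.mem_ball, Real.dist_eq, sub_zero, abs_of_nonneg h0]
  have hcontW : ∀ t, Continuous (W t) := fun t => by
    rw [funext (hW t)]
    exact continuous_const.mul (contDiff_gauss _ _ _).continuous
  have hquot : ∀ t ∈ Set.Ioo 0 δ, ∀ z, ‖(t⁻¹ : ℂ) * (W t z - W 0 z)‖ ≤ G z := by
    intro t ht z
    have h6 := norm_image_sub_le_of_norm_deriv_le_segment' (f := fun t => W t z)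
      (f' := fun t => W' t z) (a := 0) (b := t) (C := G z)
      (fun x hx => (hderiv x (hball hx.1 (hx.2.trans_lt ht.2)) z).hasDerivWithinAt)
      (fun x hx => hbound x (hball hx.1 (hx.2.trans ht.2)) z) t ⟨ht.1.le, le_rfl⟩
    rw [norm_mul, norm_inv, Complex.norm_real, Real.norm_eq_abs, abs_of_pos ht.1,
      inv_mul_le_iff₀ ht.1]
    simpa [mul_comm] using h6
  have hmem : ∀ t ∈ Set.Ioo 0 δ, MemLp (W t) 2 (mu lam) := by
    intro t ht
    obtain ⟨-, -, -, -, g5⟩ := hall t (hball ht.1.le ht.2)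
    rw [funext (hW t)]
    exact (memLp_gauss (fun j => (ha' j).trans_le (by linarith [g5 j])) _ _).const_mul _
  have hmem0 : MemLp (W 0) 2 (mu lam) := by
    rw [funext hW0]; exact memLp_gauss ha _ _
  have hlim := tendsto_cls (l := 𝓝[>] (0 : ℝ)) (F := fun t z => (t⁻¹ : ℂ) * (W t z - W 0 z))
    (f := F) hG
    (hIoo.mono fun t ht => ((hmem t ht).sub hmem0).const_mul _) hFm
    (hIoo.mono hquot)
    (fun z => by rw [hFW]; exact hbound 0 (Metric.mem_ball_self hδ) z)
    (fun z => by
      have h7 := (hderiv 0 (Metric.mem_ball_self hδ) z).hasDerivWithinAt (s := Set.Ioi 0)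
      rw [hasDerivWithinAt_iff_tendsto_slope' (by simp), ← hFW] at h7
      refine h7.congr fun t => ?_
      rw [slope_def_module, sub_zero, Complex.real_smul, Complex.ofReal_inv])
  refine hlim.congr' ?_
  filter_upwards [hIoo] with t ht
  have hgt : MemLp (gauss (fun j => A j t) (fun j => B j t) (fun j => C j t)) 2 (mu lam) := by
    obtain ⟨-, -, -, -, g5⟩ := hall t (hball ht.1.le ht.2)
    exact memLp_gauss (fun j => (ha' j).trans_le (by linarith [g5 j])) _ _
  rw [cls_smul (f := fun z => W t z - W 0 z) _ ((hmem t ht).sub hmem0),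
    cls_sub (hmem t ht) hmem0, ← Complex.ofReal_inv, Complex.coe_smul]
  congr 2
  · rw [← cls_smul _ hgt]
    exact congrArg _ (funext (hW t))
  · exact congrArg _ (funext hW0)

end Slope

/-! ### Mehler's kernel and the heat operator on functions -/

section Schur

variable {α : Type*} [MeasurableSpace α] {ν : Measure α} [SigmaFinite ν]

/-- **Schur's test**, with the same weight in both variables. -/
theorem lintegral_integral_sq_le {k : α → α → ℂ} (hk : Measurable (Function.uncurry k))
    {p : α → ENNReal} (hp : Measurable p) (hp0 : ∀ z, p z ≠ 0) (hpt : ∀ z, p z ≠ ⊤) {C : ENNReal}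
    (h1 : ∀ z, ∫⁻ w, ‖k z w‖ₑ * p w ∂ν ≤ C * p z) (h2 : ∀ w, ∫⁻ z, ‖k z w‖ₑ * p z ∂ν ≤ C * p w)
    {f : α → ℂ} (hf : Measurable f) :
    ∫⁻ z, ‖∫ w, k z w * f w ∂ν‖ₑ ^ (2 : ℝ) ∂ν ≤ C ^ (2 : ℝ) * ∫⁻ z, ‖f z‖ₑ ^ (2 : ℝ) ∂ν := by
  have hkm : Measurable fun x : α × α => ‖k x.1 x.2‖ₑ := hk.enorm
  have hkz : ∀ z, Measurable fun w => ‖k z w‖ₑ := fun z => hkm.comp measurable_prodMk_left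
  have hfm : Measurable fun w => ‖f w‖ₑ := hf.enorm
  have hhalf : (0 : ℝ) ≤ 1 / 2 := by norm_num
  have step : ∀ z, ‖∫ w, k z w * f w ∂ν‖ₑ ^ (2 : ℝ) ≤
      C * p z * ∫⁻ w, ‖k z w‖ₑ * (‖f w‖ₑ ^ (2 : ℝ) * (p w)⁻¹) ∂ν := by
    intro z
    have e1 : ‖∫ w, k z w * f w ∂ν‖ₑ ≤ ∫⁻ w, ‖k z w‖ₑ * ‖f w‖ₑ ∂ν := by
      refine (enorm_integral_le_lintegral_enorm _).trans (le_of_eq ?_)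
      simp only [enorm_mul]
    have e2 : ∫⁻ w, ‖k z w‖ₑ * ‖f w‖ₑ ∂ν ≤ (∫⁻ w, ‖k z w‖ₑ * p w ∂ν) ^ (1 / 2 : ℝ) *
        (∫⁻ w, ‖k z w‖ₑ * (‖f w‖ₑ ^ (2 : ℝ) * (p w)⁻¹) ∂ν) ^ (1 / 2 : ℝ) := by
      have e3 := ENNReal.lintegral_mul_le_Lp_mul_Lq ν Real.HolderConjugate.two_two
        (f := fun w => (‖k z w‖ₑ * p w) ^ (1 / 2 : ℝ))
        (g := fun w => (‖k z w‖ₑ * (‖f w‖ₑ ^ (2 : ℝ) * (p w)⁻¹)) ^ (1 / 2 : ℝ))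
        (((hkz z).mul hp).pow_const _).aemeasurable
        (((hkz z).mul ((hfm.pow_const _).mul hp.inv)).pow_const _).aemeasurable
      have e4 : ∀ x : ENNReal, (x ^ (1 / 2 : ℝ)) ^ (2 : ℝ) = x := fun x => by
        rw [← ENNReal.rpow_mul]; norm_num
      simp only [Pi.mul_apply, e4] at e3
      refine le_trans (le_of_eq ?_) e3
      refine lintegral_congr fun w => ?_
      rw [← ENNReal.mul_rpow_of_nonneg _ _ hhalf]
      have e5 : ‖k z w‖ₑ * p w * (‖k z w‖ₑ * (‖f w‖ₑ ^ (2 : ℝ) * (p w)⁻¹)) =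
          (‖k z w‖ₑ * ‖f w‖ₑ) ^ (2 : ℝ) := by
        rw [ENNReal.mul_rpow_of_nonneg _ _ (by norm_num), ENNReal.rpow_two, ENNReal.rpow_two]
        calc ‖k z w‖ₑ * p w * (‖k z w‖ₑ * (‖f w‖ₑ ^ 2 * (p w)⁻¹)) =
            ‖k z w‖ₑ ^ 2 * ‖f w‖ₑ ^ 2 * (p w * (p w)⁻¹) := by ring
          _ = _ := by rw [ENNReal.mul_inv_cancel (hp0 w) (hpt w), mul_one]
      rw [e5, ← ENNReal.rpow_mul]; norm_num
    calc ‖∫ w, k z w * f w ∂ν‖ₑ ^ (2 : ℝ) ≤ ((∫⁻ w, ‖k z w‖ₑ * p w ∂ν) ^ (1 / 2 : ℝ) *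
        (∫⁻ w, ‖k z w‖ₑ * (‖f w‖ₑ ^ (2 : ℝ) * (p w)⁻¹) ∂ν) ^ (1 / 2 : ℝ)) ^ (2 : ℝ) :=
          ENNReal.rpow_le_rpow (e1.trans e2) (by norm_num)
      _ = (∫⁻ w, ‖k z w‖ₑ * p w ∂ν) * ∫⁻ w, ‖k z w‖ₑ * (‖f w‖ₑ ^ (2 : ℝ) * (p w)⁻¹) ∂ν := by
          rw [ENNReal.mul_rpow_of_nonneg _ _ (by norm_num), ← ENNReal.rpow_mul,
            ← ENNReal.rpow_mul]
          norm_num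
      _ ≤ _ := by gcongr; exact h1 z
  have hG : Measurable fun x : α × α =>
      C * p x.1 * (‖k x.1 x.2‖ₑ * (‖f x.2‖ₑ ^ (2 : ℝ) * (p x.2)⁻¹)) :=
    ((hp.comp measurable_fst).const_mul C).mul (hkm.mul
      (((hfm.pow_const _).mul hp.inv).comp measurable_snd))
  calc ∫⁻ z, ‖∫ w, k z w * f w ∂ν‖ₑ ^ (2 : ℝ) ∂ν
      ≤ ∫⁻ z, ∫⁻ w, C * p z * (‖k z w‖ₑ * (‖f w‖ₑ ^ (2 : ℝ) * (p w)⁻¹)) ∂ν ∂ν := by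
        refine lintegral_mono fun z => (step z).trans (le_of_eq ?_)
        rw [lintegral_const_mul]
        exact (hkz z).mul ((hfm.pow_const _).mul hp.inv)
    _ = ∫⁻ w, ∫⁻ z, C * p z * (‖k z w‖ₑ * (‖f w‖ₑ ^ (2 : ℝ) * (p w)⁻¹)) ∂ν ∂ν :=
        lintegral_lintegral_swap hG.aemeasurable
    _ ≤ ∫⁻ w, C ^ (2 : ℝ) * ‖f w‖ₑ ^ (2 : ℝ) ∂ν := by
        refine lintegral_mono fun w => ?_
        have e6 : ∀ z, C * p z * (‖k z w‖ₑ * (‖f w‖ₑ ^ (2 : ℝ) * (p w)⁻¹)) =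
            C * (‖f w‖ₑ ^ (2 : ℝ) * (p w)⁻¹) * (‖k z w‖ₑ * p z) := fun z => by ring
        simp only [e6]
        have hm : Measurable fun z => ‖k z w‖ₑ * p z :=
          (hkm.comp (measurable_prodMk_right (y := w))).mul hp
        rw [lintegral_const_mul _ hm]
        calc C * (‖f w‖ₑ ^ (2 : ℝ) * (p w)⁻¹) * ∫⁻ z, ‖k z w‖ₑ * p z ∂ν
            ≤ C * (‖f w‖ₑ ^ (2 : ℝ) * (p w)⁻¹) * (C * p w) := by gcongr; exact h2 w
          _ = C ^ (2 : ℝ) * ‖f w‖ₑ ^ (2 : ℝ) * (p w * (p w)⁻¹) := by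
              rw [ENNReal.rpow_two C]; ring
          _ = _ := by rw [ENNReal.mul_inv_cancel (hp0 w) (hpt w), mul_one]
    _ = _ := lintegral_const_mul _ (hfm.pow_const _)

/-- The bounded integral operator on `L²` given by Schur's test. -/
theorem exists_integralOperator {k : α → α → ℂ} (hk : Measurable (Function.uncurry k))
    {p : α → ENNReal} (hp : Measurable p) (hp0 : ∀ z, p z ≠ 0) (hpt : ∀ z, p z ≠ ⊤) {C : ℝ}
    (hC : 0 ≤ C) (h1 : ∀ z, ∫⁻ w, ‖k z w‖ₑ * p w ∂ν ≤ ENNReal.ofReal C * p z)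
    (h2 : ∀ w, ∫⁻ z, ‖k z w‖ₑ * p z ∂ν ≤ ENNReal.ofReal C * p w)
    (hkL : ∀ z, MemLp (k z) 2 ν) :
    ∃ S : Lp ℂ 2 ν →L[ℂ] Lp ℂ 2 ν, ‖S‖ ≤ C ∧ ∀ f, S f =ᵐ[ν] fun z => ∫ w, k z w * f w ∂ν := by
  have hbound : ∀ f : Lp ℂ 2 ν, eLpNorm (fun z => ∫ w, k z w * f w ∂ν) 2 ν ≤
      ENNReal.ofReal C * eLpNorm f 2 ν := by
    intro f
    have h3 := lintegral_integral_sq_le hk hp hp0 hpt h1 h2 (Lp.stronglyMeasurable f).measurable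
    have h4 := eLpNorm_nnreal_pow_eq_lintegral (f := fun z => ∫ w, k z w * f w ∂ν) (μ := ν)
      (p := 2) two_ne_zero
    have h5 := eLpNorm_nnreal_pow_eq_lintegral (f := f) (μ := ν) (p := 2) two_ne_zero
    simp only [NNReal.coe_ofNat, ENNReal.coe_ofNat] at h4 h5
    rw [← h4, ← h5, ← ENNReal.mul_rpow_of_nonneg _ _ (by norm_num)] at h3
    exact (ENNReal.rpow_le_rpow_iff (by norm_num : (0 : ℝ) < 2)).1 h3
  have hmem : ∀ f : Lp ℂ 2 ν, MemLp (fun z => ∫ w, k z w * f w ∂ν) 2 ν := by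
    intro f
    refine ⟨?_, (hbound f).trans_lt (ENNReal.mul_lt_top ENNReal.ofReal_lt_top
      (Lp.memLp f).eLpNorm_lt_top)⟩
    have : StronglyMeasurable fun x : α × α => k x.1 x.2 * f x.2 :=
      (hk.mul ((Lp.stronglyMeasurable f).measurable.comp measurable_snd)).stronglyMeasurable
    exact (this.integral_prod_right (ν := ν)).aestronglyMeasurable
  have hint : ∀ (f : Lp ℂ 2 ν) z, Integrable (fun w => k z w * f w) ν := fun f z =>
    (hkL z).integrable_mul (Lp.memLp f)
  let S₀ : Lp ℂ 2 ν →ₗ[ℂ] Lp ℂ 2 ν :=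
    { toFun := fun f => (hmem f).toLp _
      map_add' := fun f g => by
        rw [← MemLp.toLp_add]
        refine (MemLp.toLp_eq_toLp_iff _ _).2 (Eventually.of_forall fun z => ?_)
        simp only [Pi.add_apply]
        rw [← integral_add (hint f z) (hint g z)]
        refine integral_congr_ae ?_
        filter_upwards [Lp.coeFn_add f g] with w hw
        rw [hw, Pi.add_apply, mul_add]
      map_smul' := fun c f => by
        rw [RingHom.id_apply, ← MemLp.toLp_const_smul]
        refine (MemLp.toLp_eq_toLp_iff _ _).2 (Eventually.of_forall fun z => ?_)
        simp only [Pi.smul_apply]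
        rw [smul_eq_mul, ← integral_const_mul]
        refine integral_congr_ae ?_
        filter_upwards [Lp.coeFn_smul c f] with w hw
        rw [hw, Pi.smul_apply, smul_eq_mul]; ring }
  refine ⟨S₀.mkContinuous C fun f => ?_, LinearMap.mkContinuous_norm_le _ hC _, fun f =>
    (hmem f).coeFn_toLp⟩
  change ‖(hmem f).toLp _‖ ≤ _
  rw [Lp.norm_toLp, Lp.norm_def, ← ENNReal.toReal_ofReal hC, ← ENNReal.toReal_mul]
  exact ENNReal.toReal_mono (ENNReal.mul_ne_top ENNReal.ofReal_ne_top
    (Lp.memLp f).eLpNorm_lt_top.ne) (hbound f)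

end Schur

section Mehler

variable {n : ℕ} {lam : Fin n → ℝ}

/-- Mehler's kernel: the heat kernel of `∑_j (-∂/∂z_j + λ_j z̄_j) ∂/∂z̄_j` on functions, with respect
to the measure `e^{-φ₀} dv`. It is meant for `t > 0`. -/
noncomputable def mehler (lam : Fin n → ℝ) (t : ℝ) (z w : Fin n → ℂ) : ℂ :=
  (∏ j, (((expInt (lam j) t)⁻¹ / (2 * Real.pi) : ℝ) : ℂ)) *
    Complex.exp (∑ j, ((lam j : ℂ) * (z j * (starRingEnd ℂ) (w j)) -
      ((Real.exp (-(lam j * t)) * (expInt (lam j) t)⁻¹ : ℝ) : ℂ) *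
        ((z j - w j) * (starRingEnd ℂ) (z j - w j))))

theorem exp_mul_inv_expInt (l : ℝ) {t : ℝ} (ht : 0 < t) :
    Real.exp (-(l * t)) * (expInt l t)⁻¹ = (expInt l t)⁻¹ - l := by
  rw [← one_sub_mul_expInt, sub_mul, one_mul, mul_assoc,
    mul_inv_cancel₀ (expInt_pos l ht).ne', mul_one]

/-- As a function of `w`, Mehler's kernel is a Gaussian. -/
theorem mehler_eq_gauss {t : ℝ} (ht : 0 < t) (z w : Fin n → ℂ) : mehler lam t z w =
    (∏ j, (((expInt (lam j) t)⁻¹ / (2 * Real.pi) : ℝ) : ℂ) *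
      Complex.exp (-((((expInt (lam j) t)⁻¹ - lam j : ℝ) : ℂ) * (z j * (starRingEnd ℂ) (z j))))) *
    gauss (fun j => (expInt (lam j) t)⁻¹ - lam j)
      (fun j => (((expInt (lam j) t)⁻¹ - lam j : ℝ) : ℂ) * (starRingEnd ℂ) (z j))
      (fun j => (((expInt (lam j) t)⁻¹ : ℝ) : ℂ) * z j) w := by
  rw [mehler, Finset.prod_mul_distrib, mul_assoc, ← Complex.exp_sum, gauss, ← Complex.exp_add,
    ← Finset.sum_add_distrib]
  congr 2
  refine Finset.sum_congr rfl fun j _ => ?_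
  rw [exp_mul_inv_expInt _ ht]
  push_cast
  rw [map_sub]
  ring

theorem two_mul_sub_add_pos (l : ℝ) {t : ℝ} (ht : 0 < t) :
    0 < 2 * ((expInt l t)⁻¹ - l) + l := by
  have hE := expInt_pos l ht
  have h1 := mul_expInt_lt_one l t
  have h2 : 2 * ((expInt l t)⁻¹ - l) + l = (2 - l * expInt l t) * (expInt l t)⁻¹ := by
    rw [sub_mul, mul_assoc, mul_inv_cancel₀ hE.ne']; ring
  rw [h2]
  exact mul_pos (by linarith) (inv_pos.2 hE)

theorem memLp_mehler {t : ℝ} (ht : 0 < t) (z : Fin n → ℂ) :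
    MemLp (mehler lam t z) 2 (mu lam) := by
  rw [funext (mehler_eq_gauss ht z)]
  exact (memLp_gauss (fun j => two_mul_sub_add_pos (lam j) ht) _ _).const_mul _

theorem continuous_mehler (t : ℝ) :
    Continuous fun x : (Fin n → ℂ) × (Fin n → ℂ) => mehler lam t x.1 x.2 := by
  have h : Continuous (starRingEnd ℂ) := Complex.continuous_conj
  unfold mehler
  fun_prop

theorem norm_mehler (t : ℝ) (ht : 0 < t) (z w : Fin n → ℂ) : ‖mehler lam t z w‖ =
    (∏ j, ((expInt (lam j) t)⁻¹ / (2 * Real.pi))) *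
      Real.exp (∑ j, (lam j / 2 * ‖z j‖ ^ 2 + lam j / 2 * ‖w j‖ ^ 2 -
        ((expInt (lam j) t)⁻¹ - lam j / 2) * ‖z j - w j‖ ^ 2)) := by
  rw [mehler, norm_mul, norm_prod, Complex.norm_exp, Complex.re_sum]
  congr 1
  · refine Finset.prod_congr rfl fun j _ => ?_
    rw [Complex.norm_real, Real.norm_eq_abs, abs_of_pos]
    have := expInt_pos (lam j) ht
    have := Real.pi_pos
    positivity
  · congr 1
    refine Finset.sum_congr rfl fun j _ => ?_
    rw [exp_mul_inv_expInt _ ht, Complex.mul_conj, Complex.normSq_eq_norm_sq, Complex.sub_re,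
      Complex.re_ofReal_mul, Complex.re_ofReal_mul, Complex.ofReal_re]
    have h1 : ‖z j - w j‖ ^ 2 = ‖z j‖ ^ 2 + ‖w j‖ ^ 2 - 2 * (z j * (starRingEnd ℂ) (w j)).re := by
      rw [← Complex.normSq_eq_norm_sq, ← Complex.normSq_eq_norm_sq, ← Complex.normSq_eq_norm_sq,
        Complex.normSq_sub]
    linear_combination (lam j / 2) * h1

theorem lintegral_gauss {p : Fin n → ℝ} (hp : ∀ j, 0 < p j) :
    ∫⁻ z, ‖gauss p 0 0 z‖ₑ = ENNReal.ofReal (∏ j, (Real.pi / p j)) := by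
  have h1 : ∀ z, gauss p 0 0 z = ((‖gauss p 0 0 z‖ : ℝ) : ℂ) := by
    intro z
    rw [norm_gauss_zero, gauss, Complex.ofReal_exp, Complex.ofReal_sum]
    congr 1
    refine Finset.sum_congr rfl fun j _ => ?_
    rw [Complex.mul_conj, Complex.normSq_eq_norm_sq]
    simp
  have h2 := integral_gauss hp 0 0
  rw [integral_congr_ae (Eventually.of_forall h1), integral_complex_ofReal] at h2
  have h3 : ∫ z, ‖gauss p 0 0 z‖ = ∏ j, (Real.pi / p j) := by
    refine Complex.ofReal_injective (h2.trans ?_)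
    push_cast
    exact Finset.prod_congr rfl fun j _ => by simp
  rw [← h3, ofReal_integral_norm_eq_lintegral_enorm (integrable_gauss hp 0 0)]

/-- The weight in Schur's test for Mehler's kernel. -/
noncomputable def schurWeight (lam : Fin n → ℝ) (z : Fin n → ℂ) : ENNReal :=
  ENNReal.ofReal (Real.exp (phi lam z / 2))

theorem norm_mehler_comm (t : ℝ) (ht : 0 < t) (z w : Fin n → ℂ) :
    ‖mehler lam t z w‖ = ‖mehler lam t w z‖ := by
  rw [norm_mehler t ht, norm_mehler t ht]
  congr 2
  refine Finset.sum_congr rfl fun j _ => ?_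
  rw [norm_sub_rev]; ring

/-- After multiplication by `e^{-φ₀/2}` in both variables, the modulus of Mehler's kernel is a
Gaussian in `z - w`. -/
theorem dens_mul_norm_mehler {t : ℝ} (ht : 0 < t) (z w : Fin n → ℂ) :
    dens lam w * (‖mehler lam t z w‖ * Real.exp (phi lam w / 2)) =
      Real.exp (phi lam z / 2) * (2 ^ n * ∏ j, ((expInt (lam j) t)⁻¹ / (2 * Real.pi))) *
        ‖gauss (fun j => (expInt (lam j) t)⁻¹ - lam j / 2) 0 0 (z - w)‖ := by
  rw [norm_mehler t ht, norm_gauss_zero, dens]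
  have e : Real.exp (-phi lam w) * (Real.exp (∑ j, (lam j / 2 * ‖z j‖ ^ 2 +
      lam j / 2 * ‖w j‖ ^ 2 - ((expInt (lam j) t)⁻¹ - lam j / 2) * ‖z j - w j‖ ^ 2)) *
      Real.exp (phi lam w / 2)) = Real.exp (phi lam z / 2) *
        Real.exp (∑ j, -(((expInt (lam j) t)⁻¹ - lam j / 2) * ‖(z - w) j‖ ^ 2)) := by
    rw [← Real.exp_add, ← Real.exp_add, ← Real.exp_add, phi, phi, Finset.sum_div,
      Finset.sum_div, ← Finset.sum_neg_distrib, ← Finset.sum_add_distrib,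
      ← Finset.sum_add_distrib, ← Finset.sum_add_distrib]
    congr 1
    refine Finset.sum_congr rfl fun j _ => ?_
    simp only [Pi.sub_apply]
    ring
  linear_combination (2 ^ n * ∏ j, ((expInt (lam j) t)⁻¹ / (2 * Real.pi))) * e

/-- The constant in Schur's test for Mehler's kernel, a bound for the norm of the heat operator on
functions. -/
noncomputable def schurConst (lam : Fin n → ℝ) (t : ℝ) : ℝ :=
  ∏ j, (2 / (1 + Real.exp (-(lam j * t))))

theorem schurConst_nonneg (lam : Fin n → ℝ) (t : ℝ) : 0 ≤ schurConst lam t :=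
  Finset.prod_nonneg fun j _ => by positivity

theorem schurConst_eq {t : ℝ} (ht : 0 < t) :
    (2 ^ n * ∏ j, ((expInt (lam j) t)⁻¹ / (2 * Real.pi))) *
      ∏ j, (Real.pi / ((expInt (lam j) t)⁻¹ - lam j / 2)) = schurConst lam t := by
  have h2 : (2 : ℝ) ^ n = ∏ _j : Fin n, (2 : ℝ) := by simp
  rw [h2, ← Finset.prod_mul_distrib, ← Finset.prod_mul_distrib, schurConst]
  refine Finset.prod_congr rfl fun j _ => ?_
  have hE := (expInt_pos (lam j) ht).ne'
  have h3 := (two_mul_sub_add_pos (lam j) ht).ne'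
  have h4 := one_sub_mul_expInt (lam j) t
  have h5 : (0 : ℝ) < 2 - lam j * expInt (lam j) t := by
    have := mul_expInt_lt_one (lam j) t; linarith
  have h6 : (expInt (lam j) t)⁻¹ - lam j / 2 =
      (2 - lam j * expInt (lam j) t) / (2 * expInt (lam j) t) := by field_simp
  rw [← h4, h6]
  have h7 : 1 + (1 - lam j * expInt (lam j) t) = 2 - lam j * expInt (lam j) t := by ring
  rw [h7]
  have := Real.pi_pos.ne'
  have := h5.ne'
  field_simp

theorem enorm_mehler_mul_schurWeight (t : ℝ) (z w : Fin n → ℂ) :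
    ‖mehler lam t z w‖ₑ * schurWeight lam w =
      ENNReal.ofReal (‖mehler lam t z w‖ * Real.exp (phi lam w / 2)) := by
  rw [schurWeight, ENNReal.ofReal_mul (norm_nonneg _), ofReal_norm]

theorem measurable_norm_mehler (t : ℝ) (z : Fin n → ℂ) :
    Measurable fun w => ENNReal.ofReal (‖mehler lam t z w‖ * Real.exp (phi lam w / 2)) := by
  have h1 : Continuous fun w => mehler lam t z w :=
    Continuous.comp (g := fun x : (Fin n → ℂ) × (Fin n → ℂ) => mehler lam t x.1 x.2)
      (f := fun w => (z, w)) (continuous_mehler t) (Continuous.prodMk_right z)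
  have h2 : Continuous (phi lam) := (contDiff_phi lam).continuous
  have h3 : Continuous fun w => ‖mehler lam t z w‖ * Real.exp (phi lam w / 2) := by fun_prop
  exact h3.measurable.ennreal_ofReal

/-- Schur's condition for Mehler's kernel. -/
theorem lintegral_mehler {t : ℝ} (ht : 0 < t) (z : Fin n → ℂ) :
    ∫⁻ w, ‖mehler lam t z w‖ₑ * schurWeight lam w ∂(mu lam) =
      ENNReal.ofReal (schurConst lam t) * schurWeight lam z := by
  have hp : ∀ j, 0 < (expInt (lam j) t)⁻¹ - lam j / 2 := fun j => by
    have := two_mul_sub_add_pos (lam j) ht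
    linarith
  have hc : 0 ≤ 2 ^ n * ∏ j, ((expInt (lam j) t)⁻¹ / (2 * Real.pi)) := by
    refine mul_nonneg (by positivity) (Finset.prod_nonneg fun j _ => ?_)
    have := expInt_pos (lam j) ht
    positivity
  have hm := measurable_norm_mehler (lam := lam) t z
  simp only [enorm_mehler_mul_schurWeight]
  rw [mu_eq, lintegral_withDensity_eq_lintegral_mul _ (measurable_ofReal_dens lam) hm]
  have key : ∀ w, ((fun z => ENNReal.ofReal (dens lam z)) *
      fun w => ENNReal.ofReal (‖mehler lam t z w‖ * Real.exp (phi lam w / 2))) w =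
      ENNReal.ofReal (Real.exp (phi lam z / 2) *
        (2 ^ n * ∏ j, ((expInt (lam j) t)⁻¹ / (2 * Real.pi)))) *
        ‖gauss (fun j => (expInt (lam j) t)⁻¹ - lam j / 2) 0 0 (z - w)‖ₑ := by
    intro w
    change ENNReal.ofReal (dens lam w) *
      ENNReal.ofReal (‖mehler lam t z w‖ * Real.exp (phi lam w / 2)) = _
    rw [← ENNReal.ofReal_mul (dens_pos lam w).le, dens_mul_norm_mehler ht,
      ENNReal.ofReal_mul (mul_nonneg (Real.exp_pos _).le hc), ofReal_norm]
  have hg : Measurable fun w =>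
      ‖gauss (fun j => (expInt (lam j) t)⁻¹ - lam j / 2) 0 0 (z - w)‖ₑ :=
    ((contDiff_gauss _ 0 0).continuous.comp (continuous_sub_left z)).measurable.enorm
  rw [lintegral_congr key, lintegral_const_mul _ hg, lintegral_sub_left_eq_self
    (fun w => ‖gauss (fun j => (expInt (lam j) t)⁻¹ - lam j / 2) 0 0 w‖ₑ) z, lintegral_gauss hp,
    ← ENNReal.ofReal_mul (mul_nonneg (Real.exp_pos _).le hc), mul_assoc, schurConst_eq ht,
    ENNReal.ofReal_mul (Real.exp_pos _).le, mul_comm, schurWeight]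

theorem exists_mehlerOp (lam : Fin n → ℝ) {t : ℝ} (ht : 0 < t) :
    ∃ S : Lp ℂ 2 (mu lam) →L[ℂ] Lp ℂ 2 (mu lam), ‖S‖ ≤ schurConst lam t ∧
      ∀ f, S f =ᵐ[mu lam] fun z => ∫ w, mehler lam t z w * f w ∂(mu lam) := by
  refine exists_integralOperator (p := schurWeight lam) (continuous_mehler t).measurable ?_ ?_ ?_
    (schurConst_nonneg lam t) (fun z => (lintegral_mehler ht z).le) (fun w => ?_) (memLp_mehler ht)
  · exact ((contDiff_phi lam).continuous.div_const 2).rexp.measurable.ennreal_ofReal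
  · exact fun z => (ENNReal.ofReal_pos.2 (Real.exp_pos _)).ne'
  · exact fun z => ENNReal.ofReal_ne_top
  · refine le_of_eq_of_le (lintegral_congr fun z => ?_) (lintegral_mehler ht w).le
    rw [← ofReal_norm, norm_mehler_comm t ht, ofReal_norm]

open Classical in
/-- The heat operator on functions. For `t > 0` it is the integral operator with Mehler's kernel,
for `t ≤ 0` it is the identity. -/
noncomputable def mehlerOp (lam : Fin n → ℝ) (t : ℝ) : Lp ℂ 2 (mu lam) →L[ℂ] Lp ℂ 2 (mu lam) :=
  if ht : 0 < t then (exists_mehlerOp lam ht).choose else ContinuousLinearMap.id ℂ _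

theorem mehlerOp_zero : mehlerOp lam 0 = ContinuousLinearMap.id ℂ _ := by
  rw [mehlerOp, dif_neg (lt_irrefl _)]

theorem norm_mehlerOp_le (lam : Fin n → ℝ) {t : ℝ} (ht : 0 ≤ t) :
    ‖mehlerOp lam t‖ ≤ schurConst lam t := by
  rcases ht.eq_or_lt with h | h
  · rw [← h, mehlerOp_zero]
    refine ContinuousLinearMap.norm_id_le.trans (le_of_eq ?_)
    rw [schurConst, Finset.prod_eq_one fun j _ => by norm_num]
  · rw [mehlerOp, dif_pos h]
    exact (exists_mehlerOp lam h).choose_spec.1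

theorem mehlerOp_coe {t : ℝ} (ht : 0 < t) (f : Lp ℂ 2 (mu lam)) :
    mehlerOp lam t f =ᵐ[mu lam] fun z => ∫ w, mehler lam t z w * f w ∂(mu lam) := by
  rw [mehlerOp, dif_pos ht]
  exact (exists_mehlerOp lam ht).choose_spec.2 f

/-- The logarithm of the amplitude of the image of a Gaussian under the heat flow, in one
variable. -/
noncomputable def flowAmp (l t a : ℝ) (b c : ℂ) : ℂ :=
  b * c * expInt l t / (1 + a * expInt l t : ℝ) - Real.log (1 + a * expInt l t)

/-- The exponent of the product of Mehler's kernel and a Gaussian, after integration. -/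
theorem completed_square {E a l d : ℂ} (b c z w : ℂ) (hE : E ≠ 0) (hd : d ≠ 0)
    (h : d = 1 + a * E) :
    -((E⁻¹ - l) * (z * w)) + (b + (E⁻¹ - l) * w) * (c + E⁻¹ * z) / (d * E⁻¹) =
      b * c * E / d + (-(a * (1 - l * E) / d) * (z * w) + b / d * z + c * (1 - l * E) / d * w) := by
  field_simp
  rw [h]
  ring

/-- The integral of Mehler's kernel against a Gaussian, in one variable. The factor `2` comes from the
volume form. -/
theorem mehler_integral_factor {l t a : ℝ} (ht : 0 < t) (h : 0 < 2 * a + l) (b c z : ℂ) :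
    2 * ((((expInt l t)⁻¹ / (2 * Real.pi) : ℝ) : ℂ) *
      Complex.exp (-((((expInt l t)⁻¹ - l : ℝ) : ℂ) * (z * (starRingEnd ℂ) z)))) *
      (Real.pi / ((expInt l t)⁻¹ + a : ℝ) * Complex.exp
        ((b + (((expInt l t)⁻¹ - l : ℝ) : ℂ) * (starRingEnd ℂ) z) *
          (c + (((expInt l t)⁻¹ : ℝ) : ℂ) * z) / ((expInt l t)⁻¹ + a : ℝ))) =
    Complex.exp (flowAmp l t a b c) *
      Complex.exp (-(flowRate l t a : ℂ) * (z * (starRingEnd ℂ) z) +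
        b / (1 + a * expInt l t : ℝ) * z +
        c * (1 - l * expInt l t : ℝ) / (1 + a * expInt l t : ℝ) * (starRingEnd ℂ) z) := by
  have hE := expInt_pos l ht
  have hd := one_add_mul_expInt_pos h ht.le
  have hE' : (expInt l t : ℂ) ≠ 0 := by exact_mod_cast hE.ne'
  have hd' : (1 + a * expInt l t : ℂ) ≠ 0 := by exact_mod_cast hd.ne'
  have hpi : (Real.pi : ℂ) ≠ 0 := by exact_mod_cast Real.pi_ne_zero
  have hsa : ((expInt l t)⁻¹ + a : ℝ) = (1 + a * expInt l t) * (expInt l t)⁻¹ := by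
    field_simp
  have hlog : Complex.exp (-(Real.log (1 + a * expInt l t) : ℂ)) =
      (1 + a * expInt l t : ℂ)⁻¹ := by
    rw [Complex.exp_neg, ← Complex.ofReal_exp, Real.exp_log hd]; push_cast; rfl
  have hamp : Complex.exp (flowAmp l t a b c) =
      Complex.exp (b * c * expInt l t / (1 + a * expInt l t)) * (1 + a * expInt l t : ℂ)⁻¹ := by
    rw [flowAmp, sub_eq_add_neg, Complex.exp_add, hlog]; push_cast; rfl
  rw [hamp, hsa, flowRate]
  push_cast
  have e : Complex.exp (-(((expInt l t : ℂ)⁻¹ - l) * (z * (starRingEnd ℂ) z))) *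
      Complex.exp ((b + ((expInt l t : ℂ)⁻¹ - l) * (starRingEnd ℂ) z) *
        (c + (expInt l t : ℂ)⁻¹ * z) / ((1 + a * expInt l t) * (expInt l t : ℂ)⁻¹)) =
      Complex.exp (b * c * expInt l t / (1 + a * expInt l t)) *
      Complex.exp (-(a * (1 - l * expInt l t) / (1 + a * expInt l t)) * (z * (starRingEnd ℂ) z) +
        b / (1 + a * expInt l t) * z +
        c * (1 - l * expInt l t) / (1 + a * expInt l t) * (starRingEnd ℂ) z) := by
    rw [← Complex.exp_add, ← Complex.exp_add]
    congr 1
    exact completed_square b c z _ hE' hd' rfl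
  have e2 : (2 : ℂ) * ((expInt l t : ℂ)⁻¹ / (2 * Real.pi)) *
      (Real.pi / ((1 + a * expInt l t) * (expInt l t : ℂ)⁻¹)) = (1 + a * expInt l t : ℂ)⁻¹ := by
    field_simp
  linear_combination (2 : ℂ) * ((expInt l t : ℂ)⁻¹ / (2 * Real.pi)) *
      (Real.pi / ((1 + a * expInt l t) * (expInt l t : ℂ)⁻¹)) * e +
    Complex.exp (b * c * expInt l t / (1 + a * expInt l t)) *
      Complex.exp (-(a * (1 - l * expInt l t) / (1 + a * expInt l t)) * (z * (starRingEnd ℂ) z) +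
        b / (1 + a * expInt l t) * z +
        c * (1 - l * expInt l t) / (1 + a * expInt l t) * (starRingEnd ℂ) z) * e2

/-- The image of a Gaussian under the heat flow, up to its amplitude. -/
noncomputable def flowGauss (lam : Fin n → ℝ) (t : ℝ) (a : Fin n → ℝ) (b c : Fin n → ℂ) :
    (Fin n → ℂ) → ℂ :=
  gauss (fun j => flowRate (lam j) t (a j))
    (fun j => b j / (1 + a j * expInt (lam j) t : ℝ))
    (fun j => c j * (1 - lam j * expInt (lam j) t : ℝ) / (1 + a j * expInt (lam j) t : ℝ))

theorem integral_mehler_mul_gauss {t : ℝ} (ht : 0 < t) {a : Fin n → ℝ}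
    (ha : ∀ j, 0 < 2 * a j + lam j) (b c z : Fin n → ℂ) :
    ∫ w, mehler lam t z w * gauss a b c w ∂(mu lam) =
      Complex.exp (∑ j, flowAmp (lam j) t (a j) (b j) (c j)) * flowGauss lam t a b c z := by
  have hpos : ∀ j, 0 < (expInt (lam j) t)⁻¹ + a j := fun j => by
    have hE := expInt_pos (lam j) ht
    have hd := one_add_mul_expInt_pos (ha j) ht.le
    have : (expInt (lam j) t)⁻¹ + a j = (1 + a j * expInt (lam j) t) * (expInt (lam j) t)⁻¹ := by
      field_simp
    rw [this]
    exact mul_pos hd (inv_pos.2 hE)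
  rw [integral_mu]
  have e : ∀ w, dens lam w • (mehler lam t z w * gauss a b c w) =
      (2 ^ n * ∏ j, (((expInt (lam j) t)⁻¹ / (2 * Real.pi) : ℝ) : ℂ) *
      Complex.exp (-((((expInt (lam j) t)⁻¹ - lam j : ℝ) : ℂ) * (z j * (starRingEnd ℂ) (z j))))) *
      gauss (fun j => (expInt (lam j) t)⁻¹ + a j)
        (fun j => b j + (((expInt (lam j) t)⁻¹ - lam j : ℝ) : ℂ) * (starRingEnd ℂ) (z j))
        (fun j => c j + (((expInt (lam j) t)⁻¹ : ℝ) : ℂ) * z j) w := by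
    intro w
    have e1 : (dens lam w : ℂ) = 2 ^ n *
        Complex.exp (∑ j, -((lam j : ℂ) * (w j * (starRingEnd ℂ) (w j)))) := by
      have := phi_eq lam w
      rw [Finset.sum_neg_distrib, ← this, dens]; push_cast; rfl
    have e2 : Complex.exp (∑ j, -((lam j : ℂ) * (w j * (starRingEnd ℂ) (w j)))) *
        (gauss (fun j => (expInt (lam j) t)⁻¹ - lam j)
        (fun j => (((expInt (lam j) t)⁻¹ - lam j : ℝ) : ℂ) * (starRingEnd ℂ) (z j))
        (fun j => (((expInt (lam j) t)⁻¹ : ℝ) : ℂ) * z j) w * gauss a b c w) =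
        gauss (fun j => (expInt (lam j) t)⁻¹ + a j)
        (fun j => b j + (((expInt (lam j) t)⁻¹ - lam j : ℝ) : ℂ) * (starRingEnd ℂ) (z j))
        (fun j => c j + (((expInt (lam j) t)⁻¹ : ℝ) : ℂ) * z j) w := by
      simp only [gauss]
      rw [← Complex.exp_add, ← Complex.exp_add, ← Finset.sum_add_distrib, ← Finset.sum_add_distrib]
      congr 1
      refine Finset.sum_congr rfl fun j _ => ?_
      push_cast
      ring
    rw [Complex.real_smul, e1, mehler_eq_gauss ht, ← e2]
    ring
  simp only [e]
  rw [integral_const_mul, integral_gauss hpos, Complex.exp_sum, flowGauss, gauss, Complex.exp_sum,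
    ← Finset.prod_mul_distrib]
  have e3 : (2 : ℂ) ^ n = ∏ _j : Fin n, (2 : ℂ) := by simp
  rw [e3, ← Finset.prod_mul_distrib, ← Finset.prod_mul_distrib]
  exact Finset.prod_congr rfl fun j _ => mehler_integral_factor ht (ha j) (b j) (c j) (z j)

theorem flowGauss_zero (a : Fin n → ℝ) (b c : Fin n → ℂ) :
    flowGauss lam 0 a b c = gauss a b c := by
  simp [flowGauss, flowRate, expInt_zero]

theorem flowAmp_zero (l a : ℝ) (b c : ℂ) : flowAmp l 0 a b c = 0 := by
  simp [flowAmp, expInt_zero]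

/-- The heat operator maps Gaussians to Gaussians. -/
theorem mehlerOp_gauss {t : ℝ} (ht : 0 ≤ t) {a : Fin n → ℝ} (ha : ∀ j, 0 < 2 * a j + lam j)
    (b c : Fin n → ℂ) : mehlerOp lam t (cls lam (gauss a b c)) =
      Complex.exp (∑ j, flowAmp (lam j) t (a j) (b j) (c j)) •
        cls lam (flowGauss lam t a b c) := by
  rcases ht.eq_or_lt with h | h
  · subst h
    rw [mehlerOp_zero, flowGauss_zero]
    simp [flowAmp_zero]
  · have hm : MemLp (flowGauss lam t a b c) 2 (mu lam) :=
      memLp_gauss (fun j => two_mul_flowRate_add_pos (ha j) ht) _ _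
    rw [← cls_smul _ hm]
    refine Lp.ext ((mehlerOp_coe h _).trans ?_)
    refine EventuallyEq.trans (Eventually.of_forall fun z => ?_) (cls_coe (hm.const_mul _)).symm
    simp only
    rw [← integral_mehler_mul_gauss h ha]
    refine integral_congr_ae ?_
    filter_upwards [cls_coe (memLp_gauss ha b c)] with w hw
    rw [hw]

/-- The additivity of the amplitudes along the heat flow, in one variable. -/
theorem amplitude_add {a b c l r S E x y : ℂ} (hd : 1 + a * E ≠ 0) (hd' : 1 + r * S ≠ 0)
    (hr : r * (1 + a * E) = a * (1 - l * E)) :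
    b * c * (S + E - l * S * E) / ((1 + a * E) * (1 + r * S)) - (x + y) =
      b * c * E / (1 + a * E) - x +
        (b / (1 + a * E) * (c * (1 - l * E) / (1 + a * E)) * S / (1 + r * S) - y) := by
  have key : b * c * (S + E - l * S * E) / ((1 + a * E) * (1 + r * S)) =
      b / (1 + a * E) * (c * (1 - l * E) / (1 + a * E)) * S / (1 + r * S) +
        b * c * E / (1 + a * E) := by
    have h : b * c * (S + E - l * S * E) * (1 + a * E) =
        b * c * (1 - l * E) * S + b * c * E * ((1 + a * E) * (1 + r * S)) := by
      linear_combination (-(b * c * E * S)) * hr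
    generalize 1 + a * E = d at *
    generalize 1 + r * S = d' at *
    field_simp
    linear_combination h
  rw [key]
  ring

/-- The semigroup property on Gaussians. -/
theorem mehlerOp_add_gauss {s t : ℝ} (hs : 0 ≤ s) (ht : 0 ≤ t) {a : Fin n → ℝ}
    (ha : ∀ j, 0 < 2 * a j + lam j) (b c : Fin n → ℂ) :
    mehlerOp lam (s + t) (cls lam (gauss a b c)) =
      mehlerOp lam s (mehlerOp lam t (cls lam (gauss a b c))) := by
  have ha' : ∀ j, 0 < 2 * flowRate (lam j) t (a j) + lam j := fun j =>
    two_mul_flowRate_add_pos (ha j) ht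
  have h0 := mehlerOp_gauss hs ha' (fun j => b j / (1 + a j * expInt (lam j) t : ℝ))
    (fun j => c j * (1 - lam j * expInt (lam j) t : ℝ) / (1 + a j * expInt (lam j) t : ℝ))
  rw [mehlerOp_gauss (add_nonneg hs ht) ha, mehlerOp_gauss ht ha, map_smul,
    show flowGauss lam t a b c = gauss _ _ _ from rfl, h0, smul_smul, ← Complex.exp_add, ← Finset.sum_add_distrib]
  have hd : ∀ j, 1 + a j * expInt (lam j) (s + t) =
      (1 + a j * expInt (lam j) t) * (1 + flowRate (lam j) t (a j) * expInt (lam j) s) := by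
    intro j
    have := (one_add_mul_expInt_pos (ha j) ht).ne'
    rw [expInt_add, flowRate]; field_simp; ring
  have h1 : ∀ j, (1 + a j * expInt (lam j) t) ≠ 0 := fun j =>
    (one_add_mul_expInt_pos (ha j) ht).ne'
  have h2 : ∀ j, (1 + flowRate (lam j) t (a j) * expInt (lam j) s) ≠ 0 := fun j =>
    (one_add_mul_expInt_pos (ha' j) hs).ne'
  have h1' : ∀ j, (1 + a j * expInt (lam j) t : ℂ) ≠ 0 := fun j => by exact_mod_cast h1 j
  have h2' : ∀ j, (1 + flowRate (lam j) t (a j) * expInt (lam j) s : ℂ) ≠ 0 :=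
    fun j => by exact_mod_cast h2 j
  have hq : ∀ j, 1 - lam j * expInt (lam j) (s + t) =
      (1 - lam j * expInt (lam j) t) * (1 - lam j * expInt (lam j) s) := by
    intro j; rw [expInt_add]; ring
  have hr : ∀ j, flowRate (lam j) t (a j) * (1 + a j * expInt (lam j) t) =
      a j * (1 - lam j * expInt (lam j) t) := fun j => div_mul_cancel₀ _ (h1 j)
  have hr' : ∀ j, (flowRate (lam j) t (a j) * (1 + a j * expInt (lam j) t) : ℂ) =
      a j * (1 - lam j * expInt (lam j) t) := fun j => by exact_mod_cast hr j
  congr 2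
  · refine Finset.sum_congr rfl fun j _ => ?_
    rw [flowAmp, flowAmp, flowAmp, hd, Real.log_mul (h1 j) (h2 j), expInt_add]
    push_cast
    exact amplitude_add (h1' j) (h2' j) (hr' j)
  · simp only [flowGauss]
    congr 1
    · funext j
      rw [show flowRate (lam j) (s + t) (a j) = a j * (1 - lam j * expInt (lam j) (s + t)) /
        (1 + a j * expInt (lam j) (s + t)) from rfl, show flowRate (lam j) s (flowRate (lam j) t
        (a j)) = flowRate (lam j) t (a j) * (1 - lam j * expInt (lam j) s) /
        (1 + flowRate (lam j) t (a j) * expInt (lam j) s) from rfl, hd, hq,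
        div_eq_div_iff (mul_ne_zero (h1 j) (h2 j)) (h2 j), ← mul_assoc, ← hr]
      ring
    · funext j
      rw [hd]; push_cast
      have h1j := h1' j
      have h2j := h2' j
      field_simp
    · funext j
      rw [hd, hq]; push_cast
      have h1j := h1' j
      have h2j := h2' j
      field_simp

end Mehler

/-! ### The heat operator on forms -/

section HeatOperator

variable {n : ℕ} {lam : Fin n → ℝ} {q : ℕ}

/-- The coefficient of `dz̄^K` in a square integrable `(0,q)`-form. -/
noncomputable def component (K : {J : Finset (Fin n) // J.card = q}) :
    L2 lam q →L[ℂ] Lp ℂ 2 (mu lam) :=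
  (EuclideanSpace.proj (𝕜 := ℂ) K).compLpL 2 (mu lam)

theorem component_coe (K : {J : Finset (Fin n) // J.card = q}) (u : L2 lam q) :
    component K u =ᵐ[mu lam] fun z => u z K :=
  ContinuousLinearMap.coeFn_compLpL _ u

theorem component_tens (K : {J : Finset (Fin n) // J.card = q}) (e : Cov n q)
    (f : Lp ℂ 2 (mu lam)) : component K (tens e f) = e K • f := by
  refine Lp.ext ?_
  filter_upwards [component_coe K (tens e f), tens_coe e f, Lp.coeFn_smul (e K) f] with z h1 h2 h3
  rw [h1, h2, h3, PiLp.smul_apply, Pi.smul_apply, smul_eq_mul, smul_eq_mul, mul_comm]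

theorem ext_component {u v : L2 lam q}
    (h : ∀ K : {J : Finset (Fin n) // J.card = q}, component K u = component K v) : u = v := by
  refine Lp.ext ?_
  have h1 : ∀ K : {J : Finset (Fin n) // J.card = q}, ∀ᵐ z ∂(mu lam), u z K = v z K := fun K => by
    filter_upwards [component_coe K u, component_coe K v] with z h2 h3
    rw [← h2, ← h3, h]
  filter_upwards [ae_all_iff.2 h1] with z hz
  ext K
  exact hz K

theorem norm_component_le (K : {J : Finset (Fin n) // J.card = q}) :
    ‖(component K : L2 lam q →L[ℂ] _)‖ ≤ 1 := by
  refine (ContinuousLinearMap.norm_compLpL_le _).trans ?_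
  refine ContinuousLinearMap.opNorm_le_bound _ zero_le_one fun a => ?_
  rw [one_mul]
  exact PiLp.norm_apply_le a K

theorem norm_tens_le (e : Cov n q) :
    ‖(tens e : Lp ℂ 2 (mu lam) →L[ℂ] L2 lam q)‖ ≤ ‖e‖ := by
  refine (ContinuousLinearMap.norm_compLpL_le _).trans ?_
  rw [ContinuousLinearMap.norm_toSpanSingleton]

/-- The heat operator on `(0,q)`-forms: the Kodaira Laplacian acts on the coefficient of `dz̄^K` as
the Laplacian on functions plus the eigenvalue `∑_{j ∈ K} λ_j` of `Θ₀`. -/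
noncomputable def heatOp (lam : Fin n → ℝ) (q : ℕ) (t : ℝ) : L2 lam q →L[ℂ] L2 lam q :=
  ∑ K : {J : Finset (Fin n) // J.card = q}, Complex.exp (-(t * ∑ j ∈ K.1, lam j : ℝ)) •
    (tens (EuclideanSpace.single K 1)).comp ((mehlerOp lam t).comp (component K))

theorem heatOp_apply (t : ℝ) (u : L2 lam q) : heatOp lam q t u =
    ∑ K : {J : Finset (Fin n) // J.card = q}, Complex.exp (-(t * ∑ j ∈ K.1, lam j : ℝ)) •
      tens (EuclideanSpace.single K 1) (mehlerOp lam t (component K u)) := by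
  simp [heatOp, sum_apply]

theorem component_heatOp (t : ℝ) (u : L2 lam q) (K : {J : Finset (Fin n) // J.card = q}) :
    component K (heatOp lam q t u) =
      Complex.exp (-(t * ∑ j ∈ K.1, lam j : ℝ)) • mehlerOp lam t (component K u) := by
  rw [heatOp_apply, map_sum, Finset.sum_eq_single K]
  · rw [map_smul, component_tens]; simp
  · intro L _ hL
    rw [map_smul, component_tens]; simp [hL.symm]
  · simp

theorem heatOp_tens_single (t : ℝ) (K : {J : Finset (Fin n) // J.card = q})
    (f : Lp ℂ 2 (mu lam)) : heatOp lam q t (tens (EuclideanSpace.single K 1) f) =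
      Complex.exp (-(t * ∑ j ∈ K.1, lam j : ℝ)) •
        tens (EuclideanSpace.single K 1) (mehlerOp lam t f) := by
  refine ext_component fun L => ?_
  rw [component_heatOp, map_smul, component_tens, component_tens]
  by_cases h : L = K
  · subst h; simp
  · simp [h]

theorem heatOp_zero : heatOp lam q 0 = ContinuousLinearMap.id ℂ _ := by
  refine ContinuousLinearMap.ext fun u => ext_component fun K => ?_
  rw [component_heatOp, mehlerOp_zero]
  simp

/-- The growth of `e^{-tλ_K}` for negative eigenvalues is compensated by the decay of the heat
operator on functions. -/
theorem exp_mul_schurConst_le (t : ℝ) (K : Finset (Fin n)) :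
    Real.exp (-(t * ∑ j ∈ K, lam j)) * schurConst lam t ≤ 2 ^ n := by
  have h1 : Real.exp (-(t * ∑ j ∈ K, lam j)) =
      ∏ j, if j ∈ K then Real.exp (-(lam j * t)) else 1 := by
    rw [Finset.prod_ite_mem, Finset.univ_inter, ← Real.exp_sum, Finset.mul_sum,
      ← Finset.sum_neg_distrib]
    simp only [mul_comm]
  have h2 : (2 : ℝ) ^ n = ∏ _j : Fin n, (2 : ℝ) := by simp
  rw [h1, h2, schurConst, ← Finset.prod_mul_distrib]
  refine Finset.prod_le_prod (fun j _ => ?_) fun j _ => ?_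
  · split_ifs <;> positivity
  · have := Real.exp_pos (-(lam j * t))
    rw [← mul_div_assoc, div_le_iff₀ (by positivity)]
    split_ifs <;> linarith

theorem norm_heatOp_le {t : ℝ} (ht : 0 ≤ t) : ‖heatOp lam q t‖ ≤
    ∑ _K : {J : Finset (Fin n) // J.card = q}, (2 : ℝ) ^ n := by
  refine norm_sum_le_of_le _ fun K _ => ?_
  rw [norm_smul, Complex.norm_exp]
  refine le_trans ?_ (exp_mul_schurConst_le (lam := lam) t K.1)
  have h1 : (-((t * ∑ j ∈ K.1, lam j : ℝ) : ℂ)).re = -(t * ∑ j ∈ K.1, lam j) := by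
    rw [Complex.neg_re, Complex.ofReal_re]
  rw [h1]
  refine mul_le_mul_of_nonneg_left ?_ (Real.exp_pos _).le
  have hs := schurConst_nonneg lam t
  have h2 : ‖(tens (EuclideanSpace.single K 1) : Lp ℂ 2 (mu lam) →L[ℂ] L2 lam q)‖ ≤ 1 :=
    (norm_tens_le _).trans (by simp)
  calc _ ≤ ‖(tens (EuclideanSpace.single K 1) : Lp ℂ 2 (mu lam) →L[ℂ] L2 lam q)‖ *
        (‖mehlerOp lam t‖ * ‖(component K : L2 lam q →L[ℂ] _)‖) :=
        (ContinuousLinearMap.opNorm_comp_le _ _).trans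
          (mul_le_mul_of_nonneg_left (ContinuousLinearMap.opNorm_comp_le _ _) (norm_nonneg _))
    _ ≤ 1 * (schurConst lam t * 1) := by
        gcongr
        · exact norm_mehlerOp_le lam ht
        · exact norm_component_le K
    _ = schurConst lam t := by ring

theorem two_mul_abs_add_one_add_pos (l : ℝ) : 0 < 2 * (|l| + 1) + l := by
  have := neg_abs_le l
  have := abs_nonneg l
  linarith

/-- Bounded operators that agree on Gaussians are equal. -/
theorem clm_ext_gauss {L L' : L2 lam q →L[ℂ] L2 lam q}
    (h : ∀ (K : {J : Finset (Fin n) // J.card = q}) (a : Fin n → ℝ) (b c : Fin n → ℂ),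
      (∀ j, 0 < 2 * a j + lam j) →
        L (tens (EuclideanSpace.single K 1) (cls lam (gauss a b c))) =
          L' (tens (EuclideanSpace.single K 1) (cls lam (gauss a b c)))) : L = L' := by
  have hpos : ∀ j, 0 < 2 * (|lam j| + 1) + lam j := fun j => two_mul_abs_add_one_add_pos (lam j)
  have htop : (L - L').ker = ⊤ :=
    eq_top_of_isClosed_of_orthogonal (L - L').isClosed_ker fun x hx =>
      eq_zero_of_inner_gauss hpos x fun K b c => hx _ (by
        rw [LinearMap.mem_ker]
        exact sub_eq_zero.2 (h K _ b c hpos))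
  refine ContinuousLinearMap.ext fun u => sub_eq_zero.1 ?_
  have hu : u ∈ (L - L').ker := htop ▸ Submodule.mem_top
  exact hu

theorem heatOp_add {s t : ℝ} (hs : 0 ≤ s) (ht : 0 ≤ t) :
    heatOp lam q (s + t) = (heatOp lam q s).comp (heatOp lam q t) := by
  refine clm_ext_gauss fun K a b c ha => ?_
  rw [ContinuousLinearMap.comp_apply, heatOp_tens_single, heatOp_tens_single, map_smul,
    heatOp_tens_single, mehlerOp_add_gauss hs ht ha, smul_smul, ← Complex.exp_add]
  congr 2
  push_cast
  ring

theorem heatOp_gauss {t : ℝ} (ht : 0 ≤ t) {a : Fin n → ℝ} (ha : ∀ j, 0 < 2 * a j + lam j)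
    (b c : Fin n → ℂ) (K : {J : Finset (Fin n) // J.card = q}) :
    heatOp lam q t (tens (EuclideanSpace.single K 1) (cls lam (gauss a b c))) =
      tens (EuclideanSpace.single K 1) (Complex.exp (∑ j, (flowAmp (lam j) t (a j) (b j) (c j) -
        (t : ℂ) * if j ∈ K.1 then (lam j : ℂ) else 0)) • cls lam (flowGauss lam t a b c)) := by
  rw [heatOp_tens_single, mehlerOp_gauss ht ha, map_smul, map_smul, smul_smul, ← Complex.exp_add,
    Finset.sum_sub_distrib, ← Finset.mul_sum, Finset.sum_ite_mem, Finset.univ_inter]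
  congr 2
  push_cast
  ring

section Derivatives

variable (l a : ℝ) (b c κ : ℂ)

theorem hasDerivAt_one_add_mul_expInt : HasDerivAt (fun t => 1 + a * expInt l t) a 0 := by
  have h := ((hasDerivAt_expInt l 0).const_mul a).const_add 1
  simpa using h

theorem hasDerivAt_one_sub_mul_expInt : HasDerivAt (fun t => 1 - l * expInt l t) (-l) 0 := by
  have h := ((hasDerivAt_expInt l 0).const_mul l).const_sub 1
  simpa using h

theorem contDiffAt_one_add_mul_expInt : ContDiffAt ℝ 1 (fun t => 1 + a * expInt l t) 0 :=
  contDiffAt_const.add (contDiffAt_const.mul ((contDiff_expInt l).contDiffAt.of_le (by simp)))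

theorem contDiffAt_ofReal {f : ℝ → ℝ} (hf : ContDiffAt ℝ 1 f 0) :
    ContDiffAt ℝ 1 (fun t => (f t : ℂ)) 0 :=
  Complex.ofRealCLM.contDiff.contDiffAt.comp 0 hf

theorem contDiffAt_one_sub_mul_expInt : ContDiffAt ℝ 1 (fun t => 1 - l * expInt l t) 0 :=
  contDiffAt_const.sub (contDiffAt_const.mul ((contDiff_expInt l).contDiffAt.of_le (by simp)))

theorem contDiffAt_flowRate : ContDiffAt ℝ 1 (fun t => flowRate l t a) 0 :=
  (contDiffAt_const.mul (contDiffAt_one_sub_mul_expInt l)).div (contDiffAt_one_add_mul_expInt l a)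
    (by simp [expInt_zero])

theorem hasDerivAt_flowRate : HasDerivAt (fun t => flowRate l t a) (-(a * (a + l))) 0 := by
  have h := ((hasDerivAt_one_sub_mul_expInt l).const_mul a).div (hasDerivAt_one_add_mul_expInt l a)
    (by simp [expInt_zero])
  refine h.congr_deriv ?_
  simp only [expInt_zero]
  ring

theorem contDiffAt_div_one_add {f : ℝ → ℂ} (hf : ContDiffAt ℝ 1 f 0) :
    ContDiffAt ℝ 1 (fun t => f t / (1 + a * expInt l t : ℝ)) 0 := by
  simp only [div_eq_mul_inv]
  exact hf.mul ((contDiffAt_ofReal (contDiffAt_one_add_mul_expInt l a)).inv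
    (by simp [expInt_zero]))

theorem contDiffAt_flow_linear :
    ContDiffAt ℝ 1 (fun t => b / (1 + a * expInt l t : ℝ)) 0 :=
  contDiffAt_div_one_add l a contDiffAt_const

theorem hasDerivAt_flow_linear :
    HasDerivAt (fun t => b / (1 + a * expInt l t : ℝ)) (-(a * b)) 0 := by
  have h := (hasDerivAt_const (0 : ℝ) b).div (hasDerivAt_one_add_mul_expInt l a).ofReal_comp
    (by simp [expInt_zero])
  refine h.congr_deriv ?_
  simp only [expInt_zero]
  push_cast
  ring

theorem contDiffAt_flow_conj_linear :
    ContDiffAt ℝ 1 (fun t => c * (1 - l * expInt l t : ℝ) / (1 + a * expInt l t : ℝ)) 0 :=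
  contDiffAt_div_one_add l a
    (contDiffAt_const.mul (contDiffAt_ofReal (contDiffAt_one_sub_mul_expInt l)))

theorem hasDerivAt_flow_conj_linear :
    HasDerivAt (fun t => c * (1 - l * expInt l t : ℝ) / (1 + a * expInt l t : ℝ))
      (-(c * (a + l))) 0 := by
  have h := ((hasDerivAt_one_sub_mul_expInt l).ofReal_comp.const_mul c).div
    (hasDerivAt_one_add_mul_expInt l a).ofReal_comp (by simp [expInt_zero])
  refine h.congr_deriv ?_
  simp only [expInt_zero]
  push_cast
  ring

theorem contDiffAt_flowAmp : ContDiffAt ℝ 1 (fun t => flowAmp l t a b c - (t : ℂ) * κ) 0 := by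
  have hE : ContDiffAt ℝ 1 (expInt l) 0 := (contDiff_expInt l).contDiffAt.of_le (by simp)
  refine ContDiffAt.sub (ContDiffAt.sub ?_ ?_) ?_
  · exact contDiffAt_div_one_add l a (contDiffAt_const.mul (contDiffAt_ofReal hE))
  · exact contDiffAt_ofReal ((contDiffAt_one_add_mul_expInt l a).log (by simp [expInt_zero]))
  · exact (contDiffAt_ofReal contDiffAt_id).mul contDiffAt_const

theorem hasDerivAt_flowAmp :
    HasDerivAt (fun t => flowAmp l t a b c - (t : ℂ) * κ) (b * c - a - κ) 0 := by
  have h1 := ((hasDerivAt_expInt l 0).ofReal_comp.const_mul (b * c)).div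
    (hasDerivAt_one_add_mul_expInt l a).ofReal_comp (by simp [expInt_zero])
  have h2 := ((hasDerivAt_one_add_mul_expInt l a).log (by simp [expInt_zero])).ofReal_comp
  have h3 := ((hasDerivAt_id (0 : ℝ)).ofReal_comp).mul_const κ
  refine ((h1.sub h2).sub h3).congr_deriv ?_
  simp only [expInt_zero]
  push_cast
  simp

end Derivatives

/-- The Kodaira Laplacian and the generator of the heat operators agree on Gaussians. -/
theorem isGen_heatOp_gauss {a : Fin n → ℝ} (ha : ∀ j, 0 < 2 * a j + lam j) (b c : Fin n → ℂ)
    (K : {J : Finset (Fin n) // J.card = q}) :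
    IsGen (heatOp lam q) (tens (EuclideanSpace.single K 1) (cls lam (gauss a b c)))
      (tens (EuclideanSpace.single K 1) (cls lam (boxGauss lam a b c)) +
        tens (Theta lam q (EuclideanSpace.single K 1)) (cls lam (gauss a b c))) := by
  let κ : Fin n → ℂ := fun j => if j ∈ K.1 then (lam j : ℂ) else 0
  have hg := memLp_gauss ha b c
  have hbox := memLp_boxGauss ha b c
  have hTheta : Theta lam q (EuclideanSpace.single K 1) =
      (∑ j, κ j) • EuclideanSpace.single K (1 : ℂ) := by
    ext L
    rw [Theta_apply, PiLp.smul_apply, smul_eq_mul]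
    simp only [κ, Finset.sum_ite_mem, Finset.univ_inter]
    by_cases h : L = K
    · subst h; simp
    · simp [h]
  have hsum := hbox.add (hg.const_mul (∑ j, κ j))
  have hcls : tens (EuclideanSpace.single K 1) (cls lam fun z =>
      (-1 : ℂ) * (boxGauss lam a b c z + (∑ j, κ j) * gauss a b c z)) =
      -(tens (EuclideanSpace.single K 1) (cls lam (boxGauss lam a b c)) +
        tens (Theta lam q (EuclideanSpace.single K 1)) (cls lam (gauss a b c))) := by
    have h1 : cls lam (fun z => (-1 : ℂ) * (boxGauss lam a b c z + (∑ j, κ j) * gauss a b c z)) =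
        (-1 : ℂ) • cls lam fun z => boxGauss lam a b c z + (∑ j, κ j) * gauss a b c z :=
      cls_smul (-1) hsum
    have h2 := cls_add hbox (hg.const_mul (∑ j, κ j))
    have h3 := cls_smul (∑ j, κ j) hg
    rw [h1, h2, h3, hTheta, tens_smul, map_smul, map_add, map_smul, neg_one_smul]
  have hflow0 := flowGauss_zero (lam := lam) a b c
  have hslope := tendsto_slope_gauss (lam := lam)
    (A := fun j t => flowRate (lam j) t (a j))
    (B := fun j t => b j / (1 + a j * expInt (lam j) t : ℝ))
    (C := fun j t => c j * (1 - lam j * expInt (lam j) t : ℝ) / (1 + a j * expInt (lam j) t : ℝ))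
    (D := fun j t => flowAmp (lam j) t (a j) (b j) (c j) - (t : ℂ) * κ j)
    (F := fun z => (-1 : ℂ) * (boxGauss lam a b c z + (∑ j, κ j) * gauss a b c z))
    (fun j => contDiffAt_flowRate _ _) (fun j => contDiffAt_flow_linear _ _ _)
    (fun j => contDiffAt_flow_conj_linear _ _ _) (fun j => contDiffAt_flowAmp _ _ _ _ _)
    (fun j => by simp [flowAmp_zero]) (fun j => by simpa [flowRate, expInt_zero] using ha j)
    (hsum.const_mul (-1)) (fun z => by
      have h1 : gauss (fun j => flowRate (lam j) 0 (a j))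
          (fun j => b j / (1 + a j * expInt (lam j) 0 : ℝ))
          (fun j => c j * (1 - lam j * expInt (lam j) 0 : ℝ) / (1 + a j * expInt (lam j) 0 : ℝ)) =
          gauss a b c := hflow0
      rw [h1, boxGauss, ← Finset.sum_mul, ← add_mul, ← Finset.sum_add_distrib, ← mul_assoc,
        Finset.mul_sum]
      congr 1
      refine Finset.sum_congr rfl fun j _ => ?_
      rw [(hasDerivAt_flowRate (lam j) (a j)).ofReal_comp.deriv,
        (hasDerivAt_flow_linear (lam j) (a j) (b j)).deriv,
        (hasDerivAt_flow_conj_linear (lam j) (a j) (c j)).deriv,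
        (hasDerivAt_flowAmp (lam j) (a j) (b j) (c j) (κ j)).deriv]
      push_cast
      ring)
  have h1 := ((tens (lam := lam) (EuclideanSpace.single K (1 : ℂ))).continuous.tendsto _).comp hslope
  rw [hcls] at h1
  refine h1.congr' ?_
  filter_upwards [self_mem_nhdsWithin] with t ht
  have h2 : gauss (fun j => flowRate (lam j) 0 (a j))
      (fun j => b j / (1 + a j * expInt (lam j) 0 : ℝ))
      (fun j => c j * (1 - lam j * expInt (lam j) 0 : ℝ) / (1 + a j * expInt (lam j) 0 : ℝ)) =
      gauss a b c := hflow0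
  rw [heatOp_gauss (le_of_lt ht) ha, ← map_sub, ← ContinuousLinearMap.map_smul_of_tower,
    Function.comp_apply, h2]
  rfl

theorem isHeatSemigroup_heatOp (lam : Fin n → ℝ) (q : ℕ) : IsHeatSemigroup IsBox (heatOp lam q) := by
  refine isHeatSemigroup_of_core isAccretiveGraph_isBox heatOp_zero (fun s t => heatOp_add)
    (fun t => norm_heatOp_le)
    (S := {u | ∃ (K : {J : Finset (Fin n) // J.card = q}) (a : Fin n → ℝ) (b c : Fin n → ℂ)
      (κ : ℂ), (∀ j, 0 < 2 * a j + lam j) ∧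
        u = κ • tens (EuclideanSpace.single K 1) (cls lam (gauss a b c))}) ?_ ?_ ?_
  · rintro t ht _ ⟨K, a, b, c, κ, ha, rfl⟩
    refine ⟨K, fun j => flowRate (lam j) t (a j), fun j => b j / (1 + a j * expInt (lam j) t : ℝ),
      fun j => c j * (1 - lam j * expInt (lam j) t : ℝ) / (1 + a j * expInt (lam j) t : ℝ),
      κ * Complex.exp (∑ j, (flowAmp (lam j) t (a j) (b j) (c j) -
        (t : ℂ) * if j ∈ K.1 then (lam j : ℂ) else 0)),
      fun j => two_mul_flowRate_add_pos (ha j) ht, ?_⟩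
    rw [map_smul, heatOp_gauss ht ha, map_smul, smul_smul]
    rfl
  · rintro _ ⟨K, a, b, c, κ, ha, rfl⟩
    exact ⟨_, isAccretiveGraph_isBox.smul κ (isBox_gauss ha b c _),
      (isGen_heatOp_gauss ha b c K).smul κ⟩
  · intro h hh
    exact eq_zero_of_inner_gauss (fun j => two_mul_abs_add_one_add_pos (lam j)) h fun K b c =>
      hh _ ⟨K, _, b, c, 1, fun j => two_mul_abs_add_one_add_pos (lam j), (one_smul _ _).symm⟩

end HeatOperator

/-! ### The heat kernel -/

section HeatKernel

variable {n : ℕ} {lam : Fin n → ℝ} {q : ℕ}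

/-- The heat kernel on `(0,q)`-forms. -/
noncomputable def heatKernel (lam : Fin n → ℝ) (q : ℕ) (t : ℝ) (z w : Fin n → ℂ) :
    Cov n q →L[ℂ] Cov n q :=
  mehler lam t z w • NormedSpace.exp (-(t : ℂ) • Theta lam q)

theorem contDiffOn_inv_expInt (l : ℝ) : ContDiffOn ℝ ∞
    (fun x : ℝ × (Fin n → ℂ) × (Fin n → ℂ) => (expInt l x.1)⁻¹) (Set.Ioi 0 ×ˢ Set.univ) := by
  refine ContDiffOn.inv ((contDiff_expInt l).comp contDiff_fst).contDiffOn fun x hx => ?_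
  exact (expInt_pos l (Set.mem_prod.1 hx).1).ne'

theorem contDiffOn_mehler (lam : Fin n → ℝ) : ContDiffOn ℝ ∞
    (fun x : ℝ × (Fin n → ℂ) × (Fin n → ℂ) => mehler lam x.1 x.2.1 x.2.2)
    (Set.Ioi 0 ×ˢ Set.univ) := by
  have hof : ∀ {f : ℝ × (Fin n → ℂ) × (Fin n → ℂ) → ℝ}, ContDiffOn ℝ ∞ f (Set.Ioi 0 ×ˢ Set.univ) →
      ContDiffOn ℝ ∞ (fun x => (f x : ℂ)) (Set.Ioi 0 ×ˢ Set.univ) := fun hf =>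
    Complex.ofRealCLM.contDiff.comp_contDiffOn hf
  have hz : ∀ j, ContDiff ℝ ∞ fun x : ℝ × (Fin n → ℂ) × (Fin n → ℂ) => x.2.1 j := fun j =>
    (contDiff_coord j).comp (contDiff_fst.comp contDiff_snd)
  have hw : ∀ j, ContDiff ℝ ∞ fun x : ℝ × (Fin n → ℂ) × (Fin n → ℂ) => x.2.2 j := fun j =>
    (contDiff_coord j).comp (contDiff_snd.comp contDiff_snd)
  have hconj : ContDiff ℝ ∞ (starRingEnd ℂ) := Complex.conjCLE.contDiff
  unfold mehler
  refine ContDiffOn.mul (contDiffOn_prod fun j _ => ?_) (ContDiffOn.cexp (ContDiffOn.sum fun j _ =>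
    ContDiffOn.sub ?_ (ContDiffOn.mul ?_ ?_)))
  · exact hof ((contDiffOn_inv_expInt (lam j)).div_const _)
  · exact (contDiff_const.mul ((hz j).mul (hconj.comp (hw j)))).contDiffOn
  · refine hof (ContDiffOn.mul ?_ (contDiffOn_inv_expInt (lam j)))
    exact (contDiff_const.mul contDiff_fst).neg.exp.contDiffOn
  · exact (((hz j).sub (hw j)).mul (hconj.comp ((hz j).sub (hw j)))).contDiffOn

theorem contDiff_exp_ofReal_smul (A : Cov n q →L[ℂ] Cov n q) :
    ContDiff ℝ ∞ fun t : ℝ => NormedSpace.exp (-(t : ℂ) • A) := by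
  have h : ContDiff ℝ ∞ (NormedSpace.exp : (Cov n q →L[ℂ] Cov n q) → _) :=
    contDiff_iff_contDiffAt.2 fun x => (NormedSpace.exp_analytic (𝕂 := ℝ) x).contDiffAt
  exact h.comp (Complex.ofRealCLM.contDiff.neg.smul contDiff_const)

theorem contDiffOn_heatKernel (lam : Fin n → ℝ) (q : ℕ) : ContDiffOn ℝ ∞
    (fun x : ℝ × (Fin n → ℂ) × (Fin n → ℂ) => heatKernel lam q x.1 x.2.1 x.2.2)
    (Set.Ioi 0 ×ˢ Set.univ) :=
  (contDiffOn_mehler lam).smul ((contDiff_exp_ofReal_smul (Theta lam q)).comp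
    contDiff_fst).contDiffOn

theorem heatKernel_apply (t : ℝ) (z w : Fin n → ℂ) (a : Cov n q)
    (K : {J : Finset (Fin n) // J.card = q}) : heatKernel lam q t z w a K =
      Complex.exp (-(t * ∑ j ∈ K.1, lam j : ℝ)) * (mehler lam t z w * a K) := by
  rw [heatKernel, smul_apply, PiLp.smul_apply, exp_Theta_apply, smul_eq_mul]
  ring

theorem integrable_heatKernel {t : ℝ} (ht : 0 < t) (z : Fin n → ℂ) {u : (Fin n → ℂ) → Cov n q}
    (hu : MemLp u 2 (mu lam)) : Integrable (fun w => heatKernel lam q t z w (u w)) (mu lam) := by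
  have h1 : Integrable (fun w => mehler lam t z w • u w) (mu lam) :=
    memLp_one_iff_integrable.1 (MemLp.smul (p := 2) (q := 2) (r := 1)
      (φ := mehler lam t z) hu (memLp_mehler ht z))
  refine Integrable.congr (ContinuousLinearMap.integrable_comp
    (NormedSpace.exp (-(t : ℂ) • Theta lam q)) h1) (Eventually.of_forall fun w => ?_)
  exact ContinuousLinearMap.map_smul _ (mehler lam t z w) (u w)

theorem heatOp_coe {t : ℝ} (ht : 0 < t) {u : (Fin n → ℂ) → Cov n q} (hu : MemLp u 2 (mu lam)) :
    heatOp lam q t (hu.toLp u) =ᵐ[mu lam] fun z => ∫ w, heatKernel lam q t z w (u w) ∂(mu lam) := by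
  have h1 : ∀ K : {J : Finset (Fin n) // J.card = q}, ∀ᵐ z ∂(mu lam),
      heatOp lam q t (hu.toLp u) z K = (∫ w, heatKernel lam q t z w (u w) ∂(mu lam)) K := by
    intro K
    have h2 := component_heatOp t (hu.toLp u) K
    filter_upwards [component_coe K (heatOp lam q t (hu.toLp u)),
      Lp.coeFn_smul (Complex.exp (-(t * ∑ j ∈ K.1, lam j : ℝ)))
        (mehlerOp lam t (component K (hu.toLp u))),
      mehlerOp_coe ht (component K (hu.toLp u))] with z h3 h4 h5
    have h6 := (EuclideanSpace.proj (𝕜 := ℂ) K).integral_comp_comm (integrable_heatKernel ht z hu)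
    have h7 : (∫ w, heatKernel lam q t z w (u w) ∂(mu lam)) K =
        ∫ w, heatKernel lam q t z w (u w) K ∂(mu lam) := h6.symm
    rw [← h3, h2, h4, Pi.smul_apply, h5, h7, smul_eq_mul, ← integral_const_mul]
    refine integral_congr_ae ?_
    filter_upwards [component_coe K (hu.toLp u), hu.coeFn_toLp] with w h8 h9
    rw [h8, h9, heatKernel_apply]
  filter_upwards [ae_all_iff.2 h1] with z hz
  ext K
  exact hz K

theorem isHeatKernel_heatKernel (lam : Fin n → ℝ) (q : ℕ) :
    IsHeatKernel lam q (heatKernel lam q) :=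
  ⟨contDiffOn_heatKernel lam q, heatOp lam q, isHeatSemigroup_heatOp lam q,
    fun _ ht _ _ _ hu => heatOp_coe ht hu⟩

theorem IsHeatKernel.continuous {K : ℝ → (Fin n → ℂ) → (Fin n → ℂ) → (Cov n q →L[ℂ] Cov n q)}
    (hK : IsHeatKernel lam q K) {t : ℝ} (ht : 0 < t) :
    Continuous fun x : (Fin n → ℂ) × (Fin n → ℂ) => K t x.1 x.2 :=
  hK.1.continuousOn.comp_continuous (f := fun x : (Fin n → ℂ) × (Fin n → ℂ) => (t, x.1, x.2))
    (by fun_prop) fun _ => Set.mk_mem_prod ht (Set.mem_univ _)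

theorem continuous_integral_kernel {k : (Fin n → ℂ) → (Fin n → ℂ) → (Cov n q →L[ℂ] Cov n q)}
    (hk : Continuous fun x : (Fin n → ℂ) × (Fin n → ℂ) => k x.1 x.2)
    {u : (Fin n → ℂ) → Cov n q} (hu : Continuous u) (hc : HasCompactSupport u) :
    Continuous fun z => ∫ w, k z w (u w) ∂(mu lam) := by
  have h1 : Continuous (Function.uncurry fun z w => k z w (u w)) :=
    hk.clm_apply (hu.comp continuous_snd)
  have h2 := continuous_parametric_integral_of_continuous (μ := mu lam) h1
    (s := tsupport u) hc
  refine h2.congr fun z => setIntegral_eq_integral_of_forall_compl_eq_zero fun w hw => ?_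
  rw [image_eq_zero_of_notMem_tsupport hw, map_zero]

theorem integrable_kernel {k : (Fin n → ℂ) → (Fin n → ℂ) → (Cov n q →L[ℂ] Cov n q)}
    (hk : Continuous fun x : (Fin n → ℂ) × (Fin n → ℂ) => k x.1 x.2) (z : Fin n → ℂ)
    {u : (Fin n → ℂ) → Cov n q} (hu : Continuous u) (hc : HasCompactSupport u) :
    Integrable (fun w => k z w (u w)) (mu lam) := by
  have h1 : Continuous fun w => k z w :=
    Continuous.comp (g := fun x : (Fin n → ℂ) × (Fin n → ℂ) => k x.1 x.2)
      (f := fun w => (z, w)) hk (Continuous.prodMk_right z)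
  refine (h1.clm_apply hu).integrable_of_hasCompactSupport (hc.mono fun w hw => ?_)
  intro h
  exact hw (by simp [h])

/-- The heat kernel is unique: the heat semigroup is, and a continuous kernel is determined by its
integrals against test forms. -/
theorem IsHeatKernel.unique {K K' : ℝ → (Fin n → ℂ) → (Fin n → ℂ) → (Cov n q →L[ℂ] Cov n q)}
    (hK : IsHeatKernel lam q K) (hK' : IsHeatKernel lam q K') {t : ℝ} (ht : 0 < t)
    (z w : Fin n → ℂ) : K t z w = K' t z w := by
  have hc := hK.continuous ht
  have hc' := hK'.continuous ht
  obtain ⟨-, T, hT, hTK⟩ := hK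
  obtain ⟨-, T', hT', hTK'⟩ := hK'
  have hTT : T t = T' t := hT.unique isAccretiveGraph_isBox hT' (fun h hh =>
    eq_zero_of_inner_gauss (fun j => two_mul_abs_add_one_add_pos (lam j)) h fun L b c =>
      hh _ _ (isBox_gauss (fun j => two_mul_abs_add_one_add_pos (lam j)) b c _)) ht.le
  have key : ∀ u : (Fin n → ℂ) → Cov n q, ContDiff ℝ ∞ u → HasCompactSupport u →
      ∫ w, K t z w (u w) ∂(mu lam) = ∫ w, K' t z w (u w) ∂(mu lam) := by
    intro u hu huc
    have hm : MemLp u 2 (mu lam) := hu.continuous.memLp_of_hasCompactSupport huc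
    have h1 := hTK t ht u hu huc hm
    have h2 := hTK' t ht u hu huc hm
    rw [hTT] at h1
    exact congrFun ((Continuous.ae_eq_iff_eq (mu lam)
      (continuous_integral_kernel hc hu.continuous huc)
      (continuous_integral_kernel hc' hu.continuous huc)).1 (h1.symm.trans h2)) z
  refine ContinuousLinearMap.ext fun e => ?_
  have hsec : ∀ {k : (Fin n → ℂ) → (Fin n → ℂ) → (Cov n q →L[ℂ] Cov n q)},
      (Continuous fun x : (Fin n → ℂ) × (Fin n → ℂ) => k x.1 x.2) →
      Continuous fun w => k z w e := fun {k} hk =>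
    Continuous.clm_apply (Continuous.comp
      (g := fun x : (Fin n → ℂ) × (Fin n → ℂ) => k x.1 x.2)
      (f := fun w => (z, w)) hk (Continuous.prodMk_right z)) continuous_const
  have hae : ∀ᵐ w ∂(mu lam), K t z w e - K' t z w e = 0 := by
    refine ae_eq_zero_of_integral_contDiff_smul_eq_zero
      ((hsec hc).sub (hsec hc')).locallyIntegrable fun g hg hgc => ?_
    have hu : ContDiff ℝ ∞ fun w => g w • e := hg.smul contDiff_const
    have huc : HasCompactSupport fun w => g w • e := hgc.smul_right
    have h1 : ∀ w, g w • (K t z w e - K' t z w e) = K t z w (g w • e) - K' t z w (g w • e) := by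
      intro w
      rw [smul_sub, ContinuousLinearMap.map_smul_of_tower, ContinuousLinearMap.map_smul_of_tower]
    simp only [h1]
    rw [integral_sub (integrable_kernel hc z hu.continuous huc)
      (integrable_kernel hc' z hu.continuous huc), key _ hu huc, sub_self]
  have h2 := (Continuous.ae_eq_iff_eq (mu lam) ((hsec hc).sub (hsec hc')) continuous_const).1 hae
  exact sub_eq_zero.1 (congrFun h2 w)

theorem mehler_zero_zero (lam : Fin n → ℝ) (t : ℝ) :
    mehler lam t 0 0 = ∏ j, todd t (lam j) / (2 * (Real.pi : ℂ)) := by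
  simp [mehler, todd_eq]

theorem heatKernel_zero_zero (lam : Fin n → ℝ) (q : ℕ) (t : ℝ) :
    heatKernel lam q t 0 0 = ((1 / (2 * (Real.pi : ℂ)) ^ n) * detQuot (curv lam) t) •
      NormedSpace.exp (-(t : ℂ) • Theta lam q) := by
  rw [heatKernel, mehler_zero_zero, curv_eq, detQuot_diagonal, Finset.prod_div_distrib]
  simp [div_eq_mul_inv, mul_comm]

theorem heatKernel_zero_zero_eq_prod (lam : Fin n → ℝ) (q : ℕ) (t : ℝ) :
    heatKernel lam q t 0 0 = (List.ofFn fun j : Fin n =>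
      (todd t (lam j) / (2 * (Real.pi : ℂ))) •
        (1 + (Complex.exp (-(t * lam j)) - 1) • wedgeContract j q)).prod := by
  refine ContinuousLinearMap.ext fun a => ?_
  ext K
  rw [prod_ofFn_apply, heatKernel_apply, mehler_zero_zero]
  ring

theorem det_one_sub_exp_curv (lam : Fin n → ℝ) (t : ℝ) :
    (1 - NormedSpace.exp (-(t : ℂ) • curv lam)).det =
      ∏ j, (1 - Complex.exp (-(t * lam j))) := by
  rw [curv_eq, one_sub_exp_diagonal, Matrix.det_diagonal]

theorem det_one_sub_exp_curv_ne_zero {t : ℝ} (ht : 0 < t) (h : (curv lam).det ≠ 0) :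
    (1 - NormedSpace.exp (-(t : ℂ) • curv lam)).det ≠ 0 := by
  rw [curv_eq, Matrix.det_diagonal, Finset.prod_ne_zero_iff] at h
  rw [det_one_sub_exp_curv, Finset.prod_ne_zero_iff]
  intro j hj
  have h1 : lam j ≠ 0 := by exact_mod_cast h j hj
  have h2 : Real.exp (-(t * lam j)) ≠ 1 := by
    rw [Ne, Real.exp_eq_one_iff, neg_eq_zero]
    exact mul_ne_zero ht.ne' h1
  rw [sub_ne_zero]
  exact_mod_cast h2.symm

theorem detQuot_curv (t : ℝ) (h : (curv lam).det ≠ 0) : detQuot (curv lam) t =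
    (curv lam).det / (1 - NormedSpace.exp (-(t : ℂ) • curv lam)).det := by
  rw [det_one_sub_exp_curv]
  rw [curv_eq, Matrix.det_diagonal, Finset.prod_ne_zero_iff] at h
  rw [curv_eq, detQuot_diagonal, Matrix.det_diagonal, ← Finset.prod_div_distrib]
  exact Finset.prod_congr rfl fun j hj => if_neg (h j hj)

end HeatKernel

end ModelHeat

open ModelHeat

theorem theorem3p1 (n : ℕ) (lam : Fin n → ℝ) (q : ℕ) :
    (∃ K : ℝ → (Fin n → ℂ) → (Fin n → ℂ) → (Cov n q →L[ℂ] Cov n q), IsHeatKernel lam q K) ∧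
    ∀ K : ℝ → (Fin n → ℂ) → (Fin n → ℂ) → (Cov n q →L[ℂ] Cov n q), IsHeatKernel lam q K →
      ∀ t : ℝ, 0 < t →
        K t 0 0 = ((1 / (2 * (Real.pi : ℂ)) ^ n) * detQuot (curv lam) t) •
          NormedSpace.exp (-(t : ℂ) • Theta lam q) ∧
        ((curv lam).det ≠ 0 →
          (1 - NormedSpace.exp (-(t : ℂ) • curv lam)).det ≠ 0 ∧
          K t 0 0 = ((1 / (2 * (Real.pi : ℂ)) ^ n) *
            ((curv lam).det / (1 - NormedSpace.exp (-(t : ℂ) • curv lam)).det)) •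
              NormedSpace.exp (-(t : ℂ) • Theta lam q)) ∧
        K t 0 0 = (List.ofFn fun j : Fin n =>
          (todd t (lam j) / (2 * (Real.pi : ℂ))) •
            (1 + (Complex.exp (-(t * lam j)) - 1) • wedgeContract j q)).prod := by
  refine ⟨⟨_, isHeatKernel_heatKernel lam q⟩, fun K hK t ht => ?_⟩
  rw [hK.unique (isHeatKernel_heatKernel lam q) ht]
  refine ⟨heatKernel_zero_zero lam q t, fun h => ⟨det_one_sub_exp_curv_ne_zero ht h, ?_⟩,
    heatKernel_zero_zero_eq_prod lam q t⟩
  rw [← detQuot_curv t h, heatKernel_zero_zero]
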